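/- All digraphs are finite. For an edge set $X$ of a digraph $D$ let $f_D(X)$ be the number of vertices $y$ such that, of the two sets $X$ and $E(D)\setminus X$, one contains an edge ending at $y$ and the other contains an edge starting at $y$. The directed branch-width $\mathrm{dbw}(D)$ is the minimum, over all trees $T$ of maximum degree at most three with a bijection from the leaves of $T$ to $E(D)$, of the maximum of $f_D(X)$ over all edge sets $X$ that correspond to the leaves on one side of an edge of $T$ (it is $0$ if $|E(D)|\le 1$). An instance of the Directed $2$-Reachability Edge Deletion problem ($\mathrm{DRED}$) consists of a digraph $D$, $k,h\in\mathbb N$ and a vertex $s$ of $D$. The question is whether there is a set $F\subseteq E(D)$ with $|F|\le k$ such that at least $h$ vertices of $D$ are not reachable from $s$ in $D-F$ by a directed path with $0$, $1$ or $2$ edges. In $\mathrm{MSO}_2$-logic of digraphs one may quantify over vertices, edges, sets of vertices and sets of edges. Theorem. 1. $\mathrm{DRED}$ is $\mathrm{MSO}_2$-expressible: there are $\mathrm{MSO}_2$-formulas $\varphi_{k,h}(s)$ with one free vertex variable, of length $O((k+h+1)^2)$, such that for all $k,h$, every digraph $D$ and every vertex $s$ of $D$, $D\models\varphi_{k,h}(s)$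 if and only if $(D,k,h,s)$ is a yes-instance of $\mathrm{DRED}$. 2. There is a parameterized reduction from $r$-Clique (does a given undirected graph contain a clique on $r$ vertices? parameter $r$) to $\mathrm{DRED}$, parameterized by $k$ and $h$, all of whose output digraphs are simple (have no loops and no parallel edges) and have directed branch-width at most $1$. 3. $\mathrm{DRED}$ is $\mathbf{W[1]}$-hard when parameterized by $k$ and $h$, even when restricted to simple digraphs of directed branch-width at most $1$. 4. Hence, unless $\mathbf{FPT}=\mathbf{W[1]}$, the problem to decide whether $D\models\varphi$, for a given simple digraph $D$ and a given $\mathrm{MSO}_2$-sentence $\varphi$ of length $|\varphi|$, is not fixed-parameter tractable when it is parameterized by $|\varphi|$ and restricted to digraphs $D$ with $\mathrm{dbw}(D)\le 1$; nor is it fixed-parameter tractable when it is parameterized by $\mathrm{dbw}(D)+|\varphi|$, without restriction on $\mathrm{dbw}(D)$. -/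

import Mathlib

namespace DirectedFPT

/-! ### Machine model: WHILE programs on binary trees, with a step count -/

/-- The data on which programs work, and by which problem instances are presented:
finite binary trees, built from `nil` by pairing. -/
inductive Data : Type
  | nil : Data
  | cons : Data → Data → Data

namespace Data

/-- The number of nodes; this is the size of an instance. -/
def size : Data → ℕ
  | nil => 1
  | cons a b => a.size + b.size + 1

/-- First component (`nil` for `nil`). -/
def hd : Data → Data
  | nil => nil
  | cons a _ => a

/-- Second component (`nil` for `nil`). -/
def tl : Data → Data
  | nil => nil
  | cons _ b => b

/-- Unary numerals. -/
def num : ℕ → Data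
  | 0 => nil
  | n + 1 => cons nil (num n)

/-- Finite lists. -/
def ofList : List Data → Data
  | [] => nil
  | a :: l => cons a (ofList l)

end Data

/-- Expressions over the program variables, which are numbered by `ℕ`. -/
inductive Expr : Type
  | var : ℕ → Expr
  | nil : Expr
  | cons : Expr → Expr → Expr
  | hd : Expr → Expr
  | tl : Expr → Expr

/-- The contents of the program variables. -/
abbrev Store : Type := ℕ → Data

namespace Expr

/-- Value of an expression. -/
def eval (σ : Store) : Expr → Data
  | var i => σ i
  | nil => Data.nil
  | cons a b => Data.cons (a.eval σ) (b.eval σ)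
  | hd a => (a.eval σ).hd
  | tl a => (a.eval σ).tl

/-- Number of elementary operations needed to evaluate an expression. -/
def cost : Expr → ℕ
  | var _ => 1
  | nil => 1
  | cons a b => a.cost + b.cost + 1
  | hd a => a.cost + 1
  | tl a => a.cost + 1

end Expr

/-- Programs. The tests of `cond` and `loop` ask whether a value is different from `nil`;
`loop e c` is "while `e` do `c`". -/
inductive Prog : Type
  | assign : ℕ → Expr → Prog
  | seq : Prog → Prog → Prog
  | cond : Expr → Prog → Prog → Prog
  | loop : Expr → Prog → Prog

/-- `Runs c σ σ' t`: started in the store `σ`, the program `c` halts in the store `σ'`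
after `t` steps. -/
inductive Runs : Prog → Store → Store → ℕ → Prop
  | assign (σ : Store) (i : ℕ) (e : Expr) :
      Runs (Prog.assign i e) σ (Function.update σ i (e.eval σ)) (e.cost + 1)
  | seq {c d : Prog} {σ σ₁ σ₂ : Store} {t u : ℕ} :
      Runs c σ σ₁ t → Runs d σ₁ σ₂ u → Runs (Prog.seq c d) σ σ₂ (t + u)
  | condTrue {e : Expr} {c d : Prog} {σ σ₁ : Store} {t : ℕ} :
      e.eval σ ≠ Data.nil → Runs c σ σ₁ t → Runs (Prog.cond e c d) σ σ₁ (e.cost + 1 + t)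
  | condFalse {e : Expr} {c d : Prog} {σ σ₁ : Store} {t : ℕ} :
      e.eval σ = Data.nil → Runs d σ σ₁ t → Runs (Prog.cond e c d) σ σ₁ (e.cost + 1 + t)
  | loopStop {e : Expr} {c : Prog} {σ : Store} :
      e.eval σ = Data.nil → Runs (Prog.loop e c) σ σ (e.cost + 1)
  | loopStep {e : Expr} {c : Prog} {σ σ₁ σ₂ : Store} {t u : ℕ} :
      e.eval σ ≠ Data.nil → Runs c σ σ₁ t → Runs (Prog.loop e c) σ₁ σ₂ u →
      Runs (Prog.loop e c) σ σ₂ (e.cost + 1 + t + u)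

/-- Initial store: the input in variable `0`, and `nil` in all others. -/
def initStore (x : Data) : Store := fun i => if i = 0 then x else Data.nil

/-! ### Parameterized complexity -/

/-- A parameterized problem is the set of its yes-instances `(x, k)`, `k` being the parameter. -/
abbrev ParamProblem : Type := Set (Data × ℕ)

/-- An instance `(x, k)` as input (or output) of a program: `x` with `k` in unary. -/
def inst (x : Data) (k : ℕ) : Data := Data.cons x (Data.num k)

/-- On the instances in `C`, the problem `Q` is decided by a fixed-parameter algorithm, that is,
in time `f(k) * |(x, k)| ^ e` with `f` computable and `e` constant. The answer is "yes" if
variable `0` finally holds something different from `nil`. -/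
def InFPTOn (Q : ParamProblem) (C : Set (Data × ℕ)) : Prop :=
  ∃ (c : Prog) (f : ℕ → ℕ) (e : ℕ), Computable f ∧
    ∀ x k, (x, k) ∈ C → ∃ (σ : Store) (t : ℕ),
      Runs c (initStore (inst x k)) σ t ∧
      t ≤ f k * (inst x k).size ^ e ∧
      (σ 0 ≠ Data.nil ↔ (x, k) ∈ Q)

/-- The class of fixed-parameter tractable problems. -/
def FPT : Set ParamProblem := {Q | InFPTOn Q Set.univ}

/-- There is a parameterized reduction from `P` to `Q` which produces only instances in `C`.
The output is charged with its full size as a tree, since subtrees may be shared in memory. -/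
def ReducesInto (P Q : ParamProblem) (C : Set (Data × ℕ)) : Prop :=
  ∃ (c : Prog) (f g : ℕ → ℕ) (e : ℕ), Computable f ∧ Computable g ∧
    ∀ x k, ∃ (σ : Store) (t : ℕ) (y : Data) (l : ℕ),
      Runs c (initStore (inst x k)) σ t ∧
      σ 0 = inst y l ∧
      t ≤ f k * (inst x k).size ^ e ∧
      (inst y l).size ≤ f k * (inst x k).size ^ e ∧
      l ≤ g k ∧
      (y, l) ∈ C ∧
      ((x, k) ∈ P ↔ (y, l) ∈ Q)

/-- Quantifier-free first-order formulas in the variables `x_0, …, x_(l-1)` over the relation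
symbols `R_i` of arity `ar i` and one further relation symbol `X` of arity `s`. -/
inductive QFFormula {m : ℕ} (ar : Fin m → ℕ) (s l : ℕ) : Type
  | eq : Fin l → Fin l → QFFormula ar s l
  | rel (i : Fin m) : (Fin (ar i) → Fin l) → QFFormula ar s l
  | relX : (Fin s → Fin l) → QFFormula ar s l
  | neg : QFFormula ar s l → QFFormula ar s l
  | conj : QFFormula ar s l → QFFormula ar s l → QFFormula ar s l

/-- Finite structures with the nonempty universe `Fin n` and relations `R_i` of arity `ar i`,
given by lists of tuples. -/
structure FinStructure {m : ℕ} (ar : Fin m → ℕ) : Type where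
  n : ℕ
  pos : 0 < n
  rel : (i : Fin m) → List (Fin (ar i) → Fin n)

/-- A finite structure as an instance. -/
def FinStructure.enc {m : ℕ} {ar : Fin m → ℕ} (A : FinStructure ar) : Data :=
  Data.cons (Data.num A.n) (Data.ofList (List.ofFn fun i : Fin m =>
    Data.ofList ((A.rel i).map fun a => Data.ofList (List.ofFn fun j => Data.num (a j)))))

/-- Satisfaction of a quantifier-free formula, `X` being interpreted by `S`. -/
def QFFormula.Holds {m : ℕ} {ar : Fin m → ℕ} {s l : ℕ} (A : FinStructure ar)
    (S : Finset (Fin s → Fin A.n)) (v : Fin l → Fin A.n) : QFFormula ar s l → Prop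
  | eq i j => v i = v j
  | rel i w => (fun j => v (w j)) ∈ A.rel i
  | relX w => (fun j => v (w j)) ∈ S
  | neg φ => ¬ φ.Holds A S v
  | conj φ ψ => φ.Holds A S v ∧ ψ.Holds A S v

/-- The weighted definability problem of the `Π₁`-formula `∀ x_0 … x_(l-1), ψ`: given a finite
structure `A` and `k` (the parameter), is there a relation `S` with exactly `k` elements such that
`A` with `X := S` satisfies the formula? -/
def weightedDefinability {m : ℕ} {ar : Fin m → ℕ} {s l : ℕ} (ψ : QFFormula ar s l) :
    ParamProblem :=
  {p | ∃ A : FinStructure ar, p.1 = A.enc ∧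
    ∃ S : Finset (Fin s → Fin A.n), S.card = p.2 ∧ ∀ v : Fin l → Fin A.n, ψ.Holds A S v}

/-- The class `W[1]`: the closure under parameterized reductions of the weighted definability
problems of `Π₁`-formulas. -/
def W1 : Set ParamProblem :=
  {P | ∃ (m : ℕ) (ar : Fin m → ℕ) (s l : ℕ) (ψ : QFFormula ar s l),
    ReducesInto P (weightedDefinability ψ) Set.univ}

/-- `Q` is `W[1]`-hard, even when restricted to the instances in `C`. -/
def W1HardOn (Q : ParamProblem) (C : Set (Data × ℕ)) : Prop :=
  ∀ P ∈ W1, ReducesInto P Q C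

/-- The problem `r`-Clique: given an undirected graph (by its number `n` of vertices and a list
`L` of its edges) and `r` (the parameter), does the graph contain a clique on `r` vertices? -/
def clique : ParamProblem :=
  {p | ∃ (n : ℕ) (L : List (Fin n × Fin n)),
    p.1 = Data.cons (Data.num n)
      (Data.ofList (L.map fun e => Data.cons (Data.num e.1) (Data.num e.2))) ∧
    ∃ K : Finset (Fin n), (SimpleGraph.fromRel fun u v => (u, v) ∈ L).IsNClique p.2 K}

/-! ### Layouts and directed branch-width -/

/-- A layout on `U`: a tree of maximum degree at most three, with a bijection from its leaves
to `U`. -/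
structure Layout (U : Type) : Type where
  n : ℕ
  tree : SimpleGraph (Fin n)
  isTree : tree.IsTree
  degree_le : ∀ v, (tree.neighborSet v).ncard ≤ 3
  leaf : {v : Fin n // (tree.neighborSet v).ncard = 1} ≃ U

/-- The set of elements of `U` at the leaves in the component of `T - xy` that contains `y`. -/
def Layout.side {U : Type} (L : Layout U) (x y : Fin L.n) : Set U :=
  {u | (L.tree.deleteEdges {s(x, y)}).Reachable y (L.leaf.symm u).1}

/-- The layout-`f`-width of `U`: the minimum, over all layouts, of the maximum of `f` over the
edges of the tree. If `U` has at most one element this is `0`. -/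
noncomputable def layoutWidth {U : Type} (f : Set U → ℕ) : ℕ :=
  sInf {w | ∃ L : Layout U, ∀ x y, L.tree.Adj x y → f (L.side x y) ≤ w}

/-- Finite digraphs; loops and parallel edges are allowed. -/
structure FinDigraph : Type where
  /-- number of vertices -/
  n : ℕ
  /-- number of edges -/
  m : ℕ
  /-- the vertex at which an edge starts -/
  src : Fin m → Fin n
  /-- the vertex at which an edge ends -/
  tgt : Fin m → Fin n

namespace FinDigraph

/-- The vertices of a digraph. -/
abbrev V (D : FinDigraph) : Type := Fin D.n

/-- The edges of a digraph. -/
abbrev E (D : FinDigraph) : Type := Fin D.m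

/-- Neither loops nor parallel edges. -/
def Simple (D : FinDigraph) : Prop :=
  (∀ e, D.src e ≠ D.tgt e) ∧ ∀ e f, D.src e = D.src f → D.tgt e = D.tgt f → e = f

/-- The directed vertex separator of the edge partition `(Xᶜ, X)`: the vertices at which an edge
outside `X` ends and an edge in `X` starts. -/
def vertexSep (D : FinDigraph) (X : Set D.E) : Set D.V :=
  {y | ∃ e f, e ∉ X ∧ f ∈ X ∧ D.tgt e = y ∧ D.src f = y}

/-- Directed branch-width. -/
noncomputable def dbw (D : FinDigraph) : ℕ :=
  layoutWidth fun X : Set D.E => (D.vertexSep X ∪ D.vertexSep Xᶜ).ncard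

/-- A digraph as (part of) an instance: the number of vertices and the list of edges. -/
def enc (D : FinDigraph) : Data :=
  Data.cons (Data.num D.n) (Data.ofList (List.ofFn fun e =>
    Data.cons (Data.num (D.src e)) (Data.num (D.tgt e))))

/-! ### Directed 2-Reachability Edge Deletion -/

/-- The `2`-reach of `s` in `D - F`: the vertices to which a directed path with `0`, `1` or `2`
edges leads from `s`. (Repeated vertices on walks of this length add nothing.) -/
def reach (D : FinDigraph) (F : Finset D.E) (s : D.V) : Set D.V :=
  {t | s = t ∨ (∃ e, e ∉ F ∧ D.src e = s ∧ D.tgt e = t) ∨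
    ∃ e f, e ∉ F ∧ f ∉ F ∧ D.src e = s ∧ D.tgt e = D.src f ∧ D.tgt f = t}

/-- `(D, k, h, s)` is a yes-instance of Directed `2`-Reachability Edge Deletion. -/
def Dred (D : FinDigraph) (k h : ℕ) (s : D.V) : Prop :=
  ∃ F : Finset D.E, F.card ≤ k ∧ h ≤ ((D.reach F s)ᶜ).ncard

end FinDigraph

/-- An instance `(D, k, h, s)` of Directed `2`-Reachability Edge Deletion. -/
def dredInst (D : FinDigraph) (k h : ℕ) (s : D.V) : Data :=
  Data.cons D.enc (Data.cons (Data.num k) (Data.cons (Data.num h) (Data.num s)))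

/-- Directed `2`-Reachability Edge Deletion, parameterized by `k` and `h`. -/
def dred : ParamProblem :=
  {p | ∃ (D : FinDigraph) (k h : ℕ) (s : D.V),
    p = (dredInst D k h s, k + h) ∧ D.Dred k h s}

/-- The instances of this problem on simple digraphs of directed branch-width at most `w`. -/
def dredDbwLe (w : ℕ) : Set (Data × ℕ) :=
  {p | ∃ (D : FinDigraph) (k h : ℕ) (s : D.V),
    p = (dredInst D k h s, k + h) ∧ D.Simple ∧ D.dbw ≤ w}

/-! ### `MSO₂`-logic of digraphs -/

/-- `MSO₂`-formulas with `a` free vertex variables, `b` free edge variables, `c` free vertex-set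
variables and `d` free edge-set variables. Variables are numbered from the innermost quantifier of
their sort outwards. -/
inductive MSO2 : ℕ → ℕ → ℕ → ℕ → Type
  /-- equality of vertices -/
  | eqV {a b c d : ℕ} : Fin a → Fin a → MSO2 a b c d
  /-- equality of edges -/
  | eqE {a b c d : ℕ} : Fin b → Fin b → MSO2 a b c d
  /-- the edge starts at the vertex -/
  | src {a b c d : ℕ} : Fin b → Fin a → MSO2 a b c d
  /-- the edge ends at the vertex -/
  | tgt {a b c d : ℕ} : Fin b → Fin a → MSO2 a b c d
  /-- the vertex lies in the vertex-set -/
  | memV {a b c d : ℕ} : Fin a → Fin c → MSO2 a b c d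
  /-- the edge lies in the edge-set -/
  | memE {a b c d : ℕ} : Fin b → Fin d → MSO2 a b c d
  | neg {a b c d : ℕ} : MSO2 a b c d → MSO2 a b c d
  | conj {a b c d : ℕ} : MSO2 a b c d → MSO2 a b c d → MSO2 a b c d
  /-- there is a vertex -/
  | exV {a b c d : ℕ} : MSO2 (a + 1) b c d → MSO2 a b c d
  /-- there is an edge -/
  | exE {a b c d : ℕ} : MSO2 a (b + 1) c d → MSO2 a b c d
  /-- there is a set of vertices -/
  | exVSet {a b c d : ℕ} : MSO2 a b (c + 1) d → MSO2 a b c d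
  /-- there is a set of edges -/
  | exESet {a b c d : ℕ} : MSO2 a b c (d + 1) → MSO2 a b c d

namespace MSO2

/-- The length of a formula: its number of symbols. -/
def length : {a b c d : ℕ} → MSO2 a b c d → ℕ
  | _, _, _, _, eqV _ _ => 3
  | _, _, _, _, eqE _ _ => 3
  | _, _, _, _, src _ _ => 3
  | _, _, _, _, tgt _ _ => 3
  | _, _, _, _, memV _ _ => 3
  | _, _, _, _, memE _ _ => 3
  | _, _, _, _, neg φ => φ.length + 1
  | _, _, _, _, conj φ ψ => φ.length + ψ.length + 1
  | _, _, _, _, exV φ => φ.length + 2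
  | _, _, _, _, exE φ => φ.length + 2
  | _, _, _, _, exVSet φ => φ.length + 2
  | _, _, _, _, exESet φ => φ.length + 2

/-- Satisfaction in a digraph, under an assignment of the free variables. -/
def Holds (D : FinDigraph) : {a b c d : ℕ} → MSO2 a b c d →
    (Fin a → D.V) → (Fin b → D.E) → (Fin c → Set D.V) → (Fin d → Set D.E) → Prop
  | _, _, _, _, eqV x y, v, _, _, _ => v x = v y
  | _, _, _, _, eqE x y, _, e, _, _ => e x = e y
  | _, _, _, _, src x y, v, e, _, _ => D.src (e x) = v y
  | _, _, _, _, tgt x y, v, e, _, _ => D.tgt (e x) = v y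
  | _, _, _, _, memV x X, v, _, W, _ => v x ∈ W X
  | _, _, _, _, memE x X, _, e, _, F => e x ∈ F X
  | _, _, _, _, neg φ, v, e, W, F => ¬ φ.Holds D v e W F
  | _, _, _, _, conj φ ψ, v, e, W, F => φ.Holds D v e W F ∧ ψ.Holds D v e W F
  | _, _, _, _, exV φ, v, e, W, F => ∃ x : D.V, φ.Holds D (Matrix.vecCons x v) e W F
  | _, _, _, _, exE φ, v, e, W, F => ∃ x : D.E, φ.Holds D v (Matrix.vecCons x e) W F
  | _, _, _, _, exVSet φ, v, e, W, F => ∃ X : Set D.V, φ.Holds D v e (Matrix.vecCons X W) F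
  | _, _, _, _, exESet φ, v, e, W, F => ∃ X : Set D.E, φ.Holds D v e W (Matrix.vecCons X F)

/-- A formula as (part of) an instance. -/
def enc : {a b c d : ℕ} → MSO2 a b c d → Data
  | _, _, _, _, eqV x y => Data.ofList [Data.num 0, Data.num x, Data.num y]
  | _, _, _, _, eqE x y => Data.ofList [Data.num 1, Data.num x, Data.num y]
  | _, _, _, _, src x y => Data.ofList [Data.num 2, Data.num x, Data.num y]
  | _, _, _, _, tgt x y => Data.ofList [Data.num 3, Data.num x, Data.num y]
  | _, _, _, _, memV x y => Data.ofList [Data.num 4, Data.num x, Data.num y]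
  | _, _, _, _, memE x y => Data.ofList [Data.num 5, Data.num x, Data.num y]
  | _, _, _, _, neg φ => Data.ofList [Data.num 6, φ.enc]
  | _, _, _, _, conj φ ψ => Data.ofList [Data.num 7, φ.enc, ψ.enc]
  | _, _, _, _, exV φ => Data.ofList [Data.num 8, φ.enc]
  | _, _, _, _, exE φ => Data.ofList [Data.num 9, φ.enc]
  | _, _, _, _, exVSet φ => Data.ofList [Data.num 10, φ.enc]
  | _, _, _, _, exESet φ => Data.ofList [Data.num 11, φ.enc]

end MSO2

/-- `MSO₂`-sentences. -/
abbrev Sentence : Type := MSO2 0 0 0 0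

/-- `D ⊨ φ`. -/
def FinDigraph.Models (D : FinDigraph) (φ : Sentence) : Prop :=
  φ.Holds D ![] ![] ![] ![]

/-- `D ⊨ φ(s)`, for a formula with one free vertex variable. -/
def FinDigraph.ModelsAt (D : FinDigraph) (φ : MSO2 1 0 0 0) (s : D.V) : Prop :=
  φ.Holds D ![s] ![] ![] ![]

/-- The `MSO₂` model-checking problem, given `D` and `φ`, with the parameter `κ D φ`. -/
def modelChecking (κ : FinDigraph → Sentence → ℕ) : ParamProblem :=
  {p | ∃ (D : FinDigraph) (φ : Sentence), p = (Data.cons D.enc φ.enc, κ D φ) ∧ D.Models φ}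

/-- The instances of this problem on simple digraphs of a class `C`. -/
def modelCheckingInst (κ : FinDigraph → Sentence → ℕ) (C : Set FinDigraph) : Set (Data × ℕ) :=
  {p | ∃ (D : FinDigraph) (φ : Sentence), p = (Data.cons D.enc φ.enc, κ D φ) ∧ D.Simple ∧ D ∈ C}

end DirectedFPT

open DirectedFPT

/-! Two combinatorial constructions carry the theorem; a calculus of polynomial-time functions turns
them into reductions in the machine model.

From cliques to edge deletion. Given a graph on `n` vertices, take a source, one vertex per graph
vertex and one vertex per ordered pair. The source has an arc to every graph vertex; the pair `(u,
v)` receives arcs from `u` and from `v` if `u = v` or `uv` is an edge, and an arc directly from the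
source otherwise. Let the budget be `r` and the target `r + r ^ 2`. Deleting the arcs from the
source to a clique of size `r` makes its `r` vertices and their `r ^ 2` pairs unreachable
(`dred_of_hasClique`); a count shows that the target can be met only in this way
(`hasClique_of_dred`). Every path with two arcs starts at the source. Hence the arcs can be listed
by the middle vertices of these paths, and each cut of the caterpillar on this list splits the arcs
at one vertex at most (`dbw_eq_one`).

From `W[1]` to cliques. A solution of a weighted definability problem is a set of `k` tuples. A
quantifier-free formula, under one assignment, reads only a bounded number `q` of tuples. A vertex
of the clique instance guesses the members of the solution at `q + 1` positions, together with at
most `k` further members which repair every assignment that fails for the first guess; a bounded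
search tree produces these repairs. Mutually consistent guesses, one for each word of positions,
exist if and only if there is a solution (`LocalConditions.solvable_iff`).

Expressibility. A formula quantifies the deleted edge set and counts edges and vertices by
existential quantifiers with pairwise inequalities, whence the quadratic length
(`MSO2.modelsAt_deletion`, `MSO2.length_deletion_le`). In the digraphs of the reduction the source
is the only vertex without incoming arcs, so that a sentence can identify it
(`cliqueDigraph_models`); hardness passes to model checking.

Running times. The predicate `PT` is closed under composition, case distinction, list operations and
arithmetic; `reducesInto_of_PT` makes a reduction of any such function whose input may be extended
by a number depending on the parameter only. If a problem to which Clique reduces were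
fixed-parameter tractable, composing reductions would give `W1 ⊆ FPT`; the reverse inclusion is
`FPT_subset_W1`. -/

namespace DirectedFPT

/-! ### Polynomial-time functions between encoded types -/

/-- Types whose elements are presented as binary trees. -/
class Enc (α : Type) where
  enc : α → Data
  inj : Function.Injective enc

open DirectedFPT.Enc (enc)

/-- The size of the encoding. -/
def esize {α : Type} [Enc α] (a : α) : ℕ := (enc a).size

theorem Data.one_le_size (x : Data) : 1 ≤ x.size := by cases x <;> simp [Data.size]

section
variable {α β γ δ : Type} [Enc α] [Enc β] [Enc γ] [Enc δ]

theorem one_le_esize (a : α) : 1 ≤ esize a := Data.one_le_size _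

/-- `g` is bounded by a polynomial in the size of the encoding. -/
def PolyBdd (g : α → ℕ) : Prop := ∃ e, ∀ a, g a ≤ (esize a + 1) ^ e

theorem PolyBdd.mono {g h : α → ℕ} (hh : PolyBdd h) (hg : ∀ a, g a ≤ h a) : PolyBdd g := by
  obtain ⟨e, he⟩ := hh
  exact ⟨e, fun a => (hg a).trans (he a)⟩

/-- The base `esize a + 1` is at least two, so `n ≤ 2 ^ n` suffices. With this base a single
exponent absorbs all constant factors. -/
theorem PolyBdd.const (n : ℕ) : PolyBdd (fun _ : α => n) := by
  refine ⟨n, fun a => ?_⟩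
  calc n ≤ 2 ^ n := Nat.lt_two_pow_self.le
    _ ≤ _ := Nat.pow_le_pow_left (by have := one_le_esize a; omega) n

theorem PolyBdd.size : PolyBdd (fun a : α => esize a) := ⟨1, fun a => by simp⟩

theorem PolyBdd.mul {g h : α → ℕ} (hg : PolyBdd g) (hh : PolyBdd h) :
    PolyBdd (fun a => g a * h a) := by
  obtain ⟨e, he⟩ := hg
  obtain ⟨e', he'⟩ := hh
  exact ⟨e + e', fun a => by rw [pow_add]; exact Nat.mul_le_mul (he a) (he' a)⟩

/-- The sum is at most `(g + 1) * (h + 1)`, which reduces sums to products and to the addition of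
one. -/
theorem PolyBdd.add {g h : α → ℕ} (hg : PolyBdd g) (hh : PolyBdd h) :
    PolyBdd (fun a => g a + h a) := by
  have h2 : PolyBdd (fun a => (g a + 1) * (h a + 1)) := by
    have aux : ∀ {g : α → ℕ}, PolyBdd g → PolyBdd (fun a => g a + 1) := by
      rintro g ⟨e, he⟩
      refine ⟨e + 1, fun a => ?_⟩
      have h1 := he a
      have h2 := one_le_esize a
      have h3 : 1 ≤ (esize a + 1) ^ e := Nat.one_le_pow _ _ (by omega)
      rw [pow_succ]
      nlinarith
    exact (aux hg).mul (aux hh)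
  exact h2.mono fun a => by nlinarith [Nat.zero_le (g a * h a)]

theorem PolyBdd.pow {g : α → ℕ} (hg : PolyBdd g) (n : ℕ) : PolyBdd (fun a => g a ^ n) := by
  obtain ⟨e, he⟩ := hg
  exact ⟨e * n, fun a => by rw [pow_mul]; exact Nat.pow_le_pow_left (he a) n⟩

theorem PolyBdd.comp {g : β → ℕ} (hg : PolyBdd g) {f : α → β}
    (hf : PolyBdd (fun a => esize (f a))) : PolyBdd (fun a => g (f a)) := by
  obtain ⟨e, he⟩ := hg
  exact ((hf.add (.const 1)).pow e).mono fun a => he (f a)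

end

/-! ### Clean procedure calls -/

/-- Called on `x` in variable `0`, the program `c` replaces it by `y` within `t` steps and leaves
all other variables as they were, provided that the variables between `0` and `N` hold `nil`. -/
def Computes (c : Prog) (N : ℕ) (x y : Data) (t : ℕ) : Prop :=
  ∀ τ : Store, τ 0 = x → (∀ i, 0 < i → i < N → τ i = Data.nil) →
    ∃ u ≤ t, Runs c τ (Function.update τ 0 y) u

/-- The program which runs `c` and pairs the input with the output of `c`. -/
def Prog.saved (c : Prog) (N : ℕ) : Prog :=
  Prog.seq (Prog.assign (N + 1) (Expr.var 0)) (Prog.seq c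
    (Prog.seq (Prog.assign 0 (Expr.cons (Expr.var (N + 1)) (Expr.var 0)))
      (Prog.assign (N + 1) Expr.nil)))

namespace Computes

theorem mono {c : Prog} {N N' : ℕ} {x y : Data} {t t' : ℕ} (h : Computes c N x y t)
    (hN : N ≤ N') (ht : t ≤ t') : Computes c N' x y t' := fun τ h0 h1 => by
  obtain ⟨u, hu, hr⟩ := h τ h0 fun i hi hi' => h1 i hi (by omega)
  exact ⟨u, hu.trans ht, hr⟩

theorem seq {c d : Prog} {N : ℕ} {x y z : Data} {t u : ℕ} (h : Computes c N x y t)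
    (h' : Computes d N y z u) : Computes (Prog.seq c d) N x z (t + u) := fun τ h0 h1 => by
  obtain ⟨t', ht', hr⟩ := h τ h0 h1
  obtain ⟨u', hu', hr'⟩ := h' (Function.update τ 0 y) (by simp)
    (fun i hi hi' => by rw [Function.update_of_ne (by omega)]; exact h1 i hi hi')
  rw [Function.update_idem] at hr'
  exact ⟨t' + u', by omega, .seq hr hr'⟩

theorem assign {e : Expr} {x y : Data} (h : ∀ τ : Store, τ 0 = x → e.eval τ = y) :
    Computes (Prog.assign 0 e) 0 x y (e.cost + 1) := fun τ h0 _ =>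
  ⟨_, le_rfl, by have := Runs.assign τ 0 e; rwa [h τ h0] at this⟩

/-- Variable `N + 1` lies outside the scratch range of `c`, and a clean call changes only variable
`0`; so the input survives there. Resetting it to `nil` makes the whole call clean again. The three
assignments cost eight steps. -/
theorem saved {c : Prog} {N : ℕ} {x y : Data} {t : ℕ} (h : Computes c N x y t) :
    Computes (c.saved N) (N + 2) x (Data.cons x y) (t + 8) := fun τ h0 h1 => by
  obtain ⟨u, hu, hr⟩ := h (Function.update τ (N + 1) x)
    (by rw [Function.update_of_ne (by omega)]; exact h0)
    (fun i hi hi' => by rw [Function.update_of_ne (by omega)]; exact h1 i hi (by omega))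
  refine ⟨2 + (u + (4 + 2)), by omega, ?_⟩
  have r1 := Runs.assign τ (N + 1) (Expr.var 0)
  simp only [Expr.eval, h0, Expr.cost] at r1
  refine .seq r1 (.seq hr ?_)
  have r2 := Runs.assign (Function.update (Function.update τ (N + 1) x) 0 y) 0
    (Expr.cons (Expr.var (N + 1)) (Expr.var 0))
  refine .seq r2 ?_
  have r3 := Runs.assign (Function.update (Function.update (Function.update τ (N + 1) x) 0 y) 0
    ((Expr.cons (Expr.var (N + 1)) (Expr.var 0)).eval
      (Function.update (Function.update τ (N + 1) x) 0 y))) (N + 1) Expr.nil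
  refine cast (congrArg (fun s => Runs _ _ s _) ?_) r3
  funext i
  simp only [Expr.eval]
  by_cases hi : i = 0
  · subst hi; simp
  by_cases hi' : i = N + 1
  · subst hi'; simp [h1 (N + 1) (by omega) (by omega)]
  · simp [hi, hi']

theorem branchTrue {e : Expr} {c d : Prog} {N : ℕ} {x y : Data} {t : ℕ}
    (he : ∀ τ : Store, τ 0 = x → e.eval τ ≠ Data.nil) (h : Computes c N x y t) :
    Computes (Prog.cond e c d) N x y (e.cost + 1 + t) := fun τ h0 h1 => by
  obtain ⟨u, hu, hr⟩ := h τ h0 h1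
  exact ⟨_, by omega, .condTrue (he τ h0) hr⟩

theorem branchFalse {e : Expr} {c d : Prog} {N : ℕ} {x y : Data} {t : ℕ}
    (he : ∀ τ : Store, τ 0 = x → e.eval τ = Data.nil) (h : Computes d N x y t) :
    Computes (Prog.cond e c d) N x y (e.cost + 1 + t) := fun τ h0 h1 => by
  obtain ⟨u, hu, hr⟩ := h τ h0 h1
  exact ⟨_, by omega, .condFalse (he τ h0) hr⟩

/-- The trace of the loop is prescribed in advance. Every round costs three steps for the test
besides its body, and the last, failing test costs three more. -/
theorem loop {c : Prog} {N : ℕ} {t : ℕ} : ∀ (T : ℕ) (x : ℕ → Data),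
    (∀ i < T, Computes c N (x i) (x (i + 1)) t) → (∀ i < T, (x i).hd ≠ Data.nil) →
    (x T).hd = Data.nil →
    Computes (Prog.loop (Expr.hd (Expr.var 0)) c) N (x 0) (x T) (T * (t + 3) + 3)
  | 0, x, _, _, h3 => fun τ h0 _ => ⟨3, by omega, by
      have := Runs.loopStop (e := Expr.hd (Expr.var 0)) (c := c) (σ := τ)
        (by simpa [Expr.eval, h0] using h3)
      rwa [← h0, Function.update_eq_self]⟩
  | T + 1, x, h1, h2, h3 => fun τ h0 hN => by
      obtain ⟨u, hu, hr⟩ := h1 0 (by omega) τ h0 hN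
      obtain ⟨v, hv, hr'⟩ := loop T (fun i => x (i + 1)) (fun i hi => h1 (i + 1) (by omega))
        (fun i hi => h2 (i + 1) (by omega)) h3 (Function.update τ 0 (x 1)) (by simp)
        (fun i hi hi' => by rw [Function.update_of_ne (by omega)]; exact hN i hi hi')
      rw [Function.update_idem] at hr'
      refine ⟨3 + u + v, ?_, ?_⟩
      · have : (T + 1) * (t + 3) = T * (t + 3) + (t + 3) := by ring
        omega
      · exact .loopStep (by simpa [Expr.eval, h0] using h2 0 (by omega)) hr hr'

theorem runs {c : Prog} {N : ℕ} {x y : Data} {t : ℕ} (h : Computes c N x y t) :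
    ∃ (σ : Store) (u : ℕ), Runs c (initStore x) σ u ∧ u ≤ t ∧ σ 0 = y := by
  obtain ⟨u, hu, hr⟩ := h (initStore x) (by simp [initStore])
    (fun i hi _ => by simp [initStore, hi.ne'])
  exact ⟨_, u, hr, hu, by simp⟩

end Computes

/-! ### Turning arbitrary programs into clean procedures -/

/-- All variables of the expression are below `N`. -/
def Expr.Below (N : ℕ) : Expr → Prop
  | var i => i < N
  | nil => True
  | cons a b => a.Below N ∧ b.Below N
  | hd a => a.Below N
  | tl a => a.Below N

/-- All variables of the program are below `N`. -/
def Prog.Below (N : ℕ) : Prog → Prop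
  | assign i e => i < N ∧ e.Below N
  | seq c d => c.Below N ∧ d.Below N
  | cond e c d => e.Below N ∧ c.Below N ∧ d.Below N
  | loop e c => e.Below N ∧ c.Below N

theorem Expr.Below.mono {N M : ℕ} (h : N ≤ M) : ∀ {e : Expr}, e.Below N → e.Below M
  | var _, h' => lt_of_lt_of_le h' h
  | nil, _ => trivial
  | cons _ _, h' => ⟨Below.mono h h'.1, Below.mono h h'.2⟩
  | hd a, h' => Below.mono (e := a) h h'
  | tl a, h' => Below.mono (e := a) h h'

theorem Prog.Below.mono {N M : ℕ} (h : N ≤ M) : ∀ {c : Prog}, c.Below N → c.Below M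
  | assign _ _, h' => ⟨lt_of_lt_of_le h'.1 h, h'.2.mono h⟩
  | seq _ _, h' => ⟨Below.mono h h'.1, Below.mono h h'.2⟩
  | cond _ _ _, h' => ⟨h'.1.mono h, Below.mono h h'.2.1, Below.mono h h'.2.2⟩
  | loop _ _, h' => ⟨h'.1.mono h, Below.mono h h'.2⟩

theorem Expr.exists_below : ∀ e : Expr, ∃ N, e.Below N
  | var i => ⟨i + 1, Nat.lt_succ_self i⟩
  | nil => ⟨0, trivial⟩
  | cons a b => by
      obtain ⟨N, hN⟩ := exists_below a
      obtain ⟨M, hM⟩ := exists_below b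
      exact ⟨max N M, hN.mono (le_max_left _ _), hM.mono (le_max_right _ _)⟩
  | hd a => exists_below a
  | tl a => exists_below a

theorem Prog.exists_below : ∀ c : Prog, ∃ N, c.Below N
  | assign i e => by
      obtain ⟨N, hN⟩ := e.exists_below
      exact ⟨max (i + 1) N, lt_of_lt_of_le (Nat.lt_succ_self i) (le_max_left _ _),
        hN.mono (le_max_right _ _)⟩
  | seq c d => by
      obtain ⟨N, hN⟩ := exists_below c
      obtain ⟨M, hM⟩ := exists_below d
      exact ⟨max N M, hN.mono (le_max_left _ _), hM.mono (le_max_right _ _)⟩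
  | cond e c d => by
      obtain ⟨K, hK⟩ := e.exists_below
      obtain ⟨N, hN⟩ := exists_below c
      obtain ⟨M, hM⟩ := exists_below d
      exact ⟨max K (max N M), hK.mono (le_max_left _ _),
        hN.mono ((le_max_left _ _).trans (le_max_right _ _)),
        hM.mono ((le_max_right _ _).trans (le_max_right _ _))⟩
  | loop e c => by
      obtain ⟨K, hK⟩ := e.exists_below
      obtain ⟨N, hN⟩ := exists_below c
      exact ⟨max K N, hK.mono (le_max_left _ _), hN.mono (le_max_right _ _)⟩

theorem Expr.eval_congr {N : ℕ} {σ τ : Store} (h : ∀ i < N, τ i = σ i) :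
    ∀ {e : Expr}, e.Below N → e.eval τ = e.eval σ
  | var i, h' => h i h'
  | nil, _ => rfl
  | cons a b, h' => by simp only [eval, eval_congr h h'.1, eval_congr h h'.2]
  | hd a, h' => by simp only [eval, eval_congr (e := a) h h']
  | tl a, h' => by simp only [eval, eval_congr (e := a) h h']

/-- A program behaves in the same way on stores that agree on its variables, and does not touch
other variables. -/
theorem Runs.frame {c : Prog} {σ σ' : Store} {t : ℕ} (hr : Runs c σ σ' t) {N : ℕ}
    (hc : c.Below N) : ∀ τ : Store, (∀ i < N, τ i = σ i) →
    ∃ τ', Runs c τ τ' t ∧ (∀ i < N, τ' i = σ' i) ∧ ∀ i, N ≤ i → τ' i = τ i := by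
  induction hr with
  | assign σ i e =>
    intro τ h
    refine ⟨_, .assign τ i e, fun j hj => ?_, fun j hj => ?_⟩
    · rw [Expr.eval_congr h hc.2]
      by_cases hji : j = i
      · subst hji; simp
      · simp [hji, h j hj]
    · have := hc.1
      rw [Function.update_of_ne (by omega)]
  | seq _ _ ih1 ih2 =>
    intro τ h
    obtain ⟨τ₁, r1, a1, b1⟩ := ih1 hc.1 τ h
    obtain ⟨τ₂, r2, a2, b2⟩ := ih2 hc.2 τ₁ a1
    exact ⟨τ₂, .seq r1 r2, a2, fun i hi => (b2 i hi).trans (b1 i hi)⟩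
  | condTrue he _ ih =>
    intro τ h
    obtain ⟨τ₁, r1, a1, b1⟩ := ih hc.2.1 τ h
    exact ⟨τ₁, .condTrue (by rwa [Expr.eval_congr h hc.1]) r1, a1, b1⟩
  | condFalse he _ ih =>
    intro τ h
    obtain ⟨τ₁, r1, a1, b1⟩ := ih hc.2.2 τ h
    exact ⟨τ₁, .condFalse (by rwa [Expr.eval_congr h hc.1]) r1, a1, b1⟩
  | loopStop he =>
    intro τ h
    exact ⟨τ, .loopStop (by rwa [Expr.eval_congr h hc.1]), h, fun _ _ => rfl⟩
  | loopStep he _ _ ih1 ih2 =>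
    intro τ h
    obtain ⟨τ₁, r1, a1, b1⟩ := ih1 hc.2 τ h
    obtain ⟨τ₂, r2, a2, b2⟩ := ih2 hc τ₁ a1
    exact ⟨τ₂, .loopStep (by rwa [Expr.eval_congr h hc.1]) r1 r2, a2,
      fun i hi => (b2 i hi).trans (b1 i hi)⟩

/-- Sets the variables `1, …, n` to `nil`. -/
def clearVars : ℕ → Prog
  | 0 => Prog.assign 0 (Expr.var 0)
  | n + 1 => Prog.seq (clearVars n) (Prog.assign (n + 1) Expr.nil)

theorem runs_clearVars (τ : Store) : ∀ n, ∃ τ', Runs (clearVars n) τ τ' (2 * n + 2) ∧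
    (∀ i, 0 < i → i ≤ n → τ' i = Data.nil) ∧ τ' 0 = τ 0 ∧ ∀ i, n < i → τ' i = τ i
  | 0 => ⟨_, .assign τ 0 (Expr.var 0), fun i h h' => by omega, by simp [Expr.eval],
      fun i hi => by simp [hi.ne']⟩
  | n + 1 => by
      obtain ⟨τ', r, h1, h2, h3⟩ := runs_clearVars τ n
      refine ⟨_, .seq r (.assign τ' (n + 1) Expr.nil), fun i h h' => ?_, ?_, fun i hi => ?_⟩
      · by_cases hi : i = n + 1
        · subst hi; simp [Expr.eval]
        · simpa [hi] using h1 i h (by omega)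
      · simpa using h2
      · rw [Function.update_of_ne (by omega)]; exact h3 i (by omega)

/-- Every program can be turned into a clean procedure. -/
theorem Prog.exists_computes (c : Prog) : ∃ (c' : Prog) (N K : ℕ), ∀ x σ t,
    Runs c (initStore x) σ t → Computes c' N x (σ 0) (t + K) := by
  obtain ⟨N, hN⟩ : ∃ N, c.Below (N + 1) := by
    obtain ⟨N, hN⟩ := c.exists_below
    exact ⟨N, hN.mono (Nat.le_succ N)⟩
  -- The program touches only the variables up to `N`, and the variables `1, …, N` held `nil` at the
  -- call. Clearing them afterwards therefore leaves variable `0` as the only difference.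
  refine ⟨Prog.seq c (clearVars N), N + 1, 2 * N + 2, fun x σ t hr τ h0 h1 => ?_⟩
  obtain ⟨τ', r', a, b⟩ := hr.frame hN τ (fun i hi => by
    by_cases h : i = 0
    · subst h; simpa [initStore] using h0
    · simpa [initStore, h] using h1 i (by omega) (by omega))
  obtain ⟨τ'', r'', h2, h3, h4⟩ := runs_clearVars τ' N
  refine ⟨_, le_rfl, ?_⟩
  convert Runs.seq r' r'' using 1
  funext i
  by_cases hi : i = 0
  · subst hi; simp [h3, a 0 (by omega)]
  by_cases hi' : i ≤ N
  · simp [hi, h2 i (by omega) hi', h1 i (by omega) (by omega)]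
  · simp [hi, h4 i (by omega), b i (by omega)]

/-! ### The class of polynomial-time functions -/

section
variable {α β γ δ : Type} [Enc α] [Enc β] [Enc γ] [Enc δ]

/-- `f` is computed in polynomial time, and its values are of polynomial size. -/
@[fun_prop]
def PT (f : α → β) : Prop :=
  ∃ (c : Prog) (N : ℕ) (b : α → ℕ), PolyBdd b ∧
    ∀ a, Computes c N (enc a) (enc (f a)) (b a) ∧ esize (f a) ≤ b a

theorem PT.size {f : α → β} (hf : PT f) : PolyBdd (fun a => esize (f a)) := by
  obtain ⟨_, _, b, hb, h⟩ := hf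
  exact hb.mono fun a => (h a).2

@[fun_prop]
theorem PT.comp {g : β → γ} {f : α → β} (hg : PT g) (hf : PT f) : PT (fun a => g (f a)) := by
  have hs := hf.size
  obtain ⟨c, N, b, hb, h⟩ := hf
  obtain ⟨c', N', b', hb', h'⟩ := hg
  refine ⟨Prog.seq c c', max N N', fun a => b a + b' (f a), hb.add (hb'.comp hs), fun a => ⟨?_, ?_⟩⟩
  · exact ((h a).1.mono (le_max_left _ _) le_rfl).seq
      ((h' (f a)).1.mono (le_max_right _ _) le_rfl)
  · exact (h' (f a)).2.trans (Nat.le_add_left _ _)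

theorem PT.ofExpr {f : α → β} (e : Expr) (h : ∀ a (τ : Store), τ 0 = enc a → e.eval τ = enc (f a))
    (hs : PolyBdd (fun a => esize (f a))) : PT f :=
  ⟨Prog.assign 0 e, 0, fun a => e.cost + 1 + esize (f a), (PolyBdd.const _).add hs, fun a =>
    ⟨(Computes.assign (h a)).mono le_rfl (Nat.le_add_right _ _), Nat.le_add_left _ _⟩⟩

@[fun_prop]
theorem PT.id : PT (fun a : α => a) := .ofExpr (Expr.var 0) (fun _ _ h => h) .size

theorem exists_expr_const : ∀ x : Data, ∃ e : Expr, ∀ τ : Store, e.eval τ = x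
  | .nil => ⟨Expr.nil, fun _ => rfl⟩
  | .cons a b => by
      obtain ⟨e, he⟩ := exists_expr_const a
      obtain ⟨e', he'⟩ := exists_expr_const b
      exact ⟨Expr.cons e e', fun τ => by simp [Expr.eval, he, he']⟩

@[fun_prop]
theorem PT.const (b : β) : PT (fun _ : α => b) := by
  obtain ⟨e, he⟩ := exists_expr_const (enc b)
  exact .ofExpr e (fun _ τ _ => he τ) (.const _)

instance : Enc Data := ⟨fun x => x, fun _ _ h => h⟩

instance : Enc Unit := ⟨fun _ => Data.nil, fun _ _ _ => rfl⟩

instance : Enc Bool :=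
  ⟨fun b => if b then Data.cons .nil .nil else .nil, fun a b => by cases a <;> cases b <;> simp⟩

instance : Enc (α × β) :=
  ⟨fun p => Data.cons (enc p.1) (enc p.2), fun p q h => by
    simp only [Data.cons.injEq] at h
    exact Prod.ext (Enc.inj h.1) (Enc.inj h.2)⟩

theorem Data.num_injective : Function.Injective Data.num := fun a => by
  induction a with
  | zero => intro b h; cases b <;> simp_all [Data.num]
  | succ a ih =>
    intro b h
    cases b with
    | zero => simp [Data.num] at h
    | succ b => simp only [Data.num, Data.cons.injEq, true_and] at h; rw [ih h]

instance : Enc ℕ := ⟨Data.num, Data.num_injective⟩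

theorem Data.ofList_injective : Function.Injective Data.ofList := fun a => by
  induction a with
  | nil => intro b h; cases b <;> simp_all [Data.ofList]
  | cons x a ih =>
    intro b h
    cases b with
    | nil => simp [Data.ofList] at h
    | cons y b => simp only [Data.ofList, Data.cons.injEq] at h; rw [h.1, ih h.2]

instance : Enc (List α) := ⟨fun l => Data.ofList (l.map enc), fun _ _ h =>
  (List.map_injective_iff.2 Enc.inj) (Data.ofList_injective h)⟩

instance : Enc (Option α) := ⟨fun o => match o with
  | none => Data.nil
  | some a => Data.cons Data.nil (enc a), fun o p h => by
    cases o <;> cases p <;> simp_all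
    exact Enc.inj h⟩

theorem enc_data (x : Data) : enc x = x := rfl
theorem enc_prod (p : α × β) : enc p = Data.cons (enc p.1) (enc p.2) := rfl
theorem enc_nil : enc ([] : List α) = Data.nil := rfl
theorem enc_cons (a : α) (l : List α) : enc (a :: l) = Data.cons (enc a) (enc l) := rfl
theorem enc_none : enc (none : Option α) = Data.nil := rfl
theorem enc_some (a : α) : enc (some a) = Data.cons Data.nil (enc a) := rfl
theorem enc_zero : enc 0 = Data.nil := rfl
theorem enc_succ (n : ℕ) : enc (n + 1) = Data.cons Data.nil (enc n) := rfl
theorem enc_true : enc true = Data.cons .nil .nil := rfl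
theorem enc_false : enc false = Data.nil := rfl

theorem esize_prod (p : α × β) : esize p = esize p.1 + esize p.2 + 1 := rfl
theorem esize_mk (a : α) (b : β) : esize (a, b) = esize a + esize b + 1 := rfl
theorem esize_nil : esize ([] : List α) = 1 := rfl
theorem esize_cons (a : α) (l : List α) : esize (a :: l) = esize a + esize l + 1 := rfl
theorem esize_some (a : α) : esize (some a) = esize a + 2 := by
  simp [esize, enc_some, Data.size]; omega
theorem esize_nat : ∀ n : ℕ, esize n = 2 * n + 1
  | 0 => rfl
  | n + 1 => by
      have := esize_nat n
      simp only [esize] at this ⊢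
      rw [enc_succ, Data.size, this, Data.size]; omega

/-- Composition forgets the input. Keeping it next to the value is what makes pairing and case
distinctions possible. -/
theorem PT.saved {f : α → β} (hf : PT f) : PT (fun a => (a, f a)) := by
  obtain ⟨c, N, b, hb, h⟩ := hf
  refine ⟨c.saved N, N + 2, fun a => b a + 8 + esize a, (hb.add (.const _)).add .size,
    fun a => ⟨?_, ?_⟩⟩
  · exact (h a).1.saved.mono le_rfl (Nat.le_add_right _ _)
  · have := (h a).2
    simp only [esize_mk]; omega

@[fun_prop]
theorem PT.fst : PT (fun p : α × β => p.1) :=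
  .ofExpr (Expr.hd (Expr.var 0)) (fun a τ h => by simp [Expr.eval, h, enc_prod, Data.hd])
    (PolyBdd.size.mono fun a => by rw [esize_prod]; omega)

@[fun_prop]
theorem PT.snd : PT (fun p : α × β => p.2) :=
  .ofExpr (Expr.tl (Expr.var 0)) (fun a τ h => by simp [Expr.eval, h, enc_prod, Data.tl])
    (PolyBdd.size.mono fun a => by rw [esize_prod]; omega)

@[fun_prop]
theorem PT.pair {f : α → β} {g : α → γ} (hf : PT f) (hg : PT g) : PT (fun a => (f a, g a)) := by
  have h1 : PT (fun q : (α × β) × γ => (q.1.2, q.2)) :=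
    .ofExpr (Expr.cons (Expr.tl (Expr.hd (Expr.var 0))) (Expr.tl (Expr.var 0)))
      (fun a τ h => by simp [Expr.eval, h, enc_prod, Data.tl, Data.hd])
      (PolyBdd.size.mono fun a => by simp only [esize_prod]; omega)
  -- The two saved calls produce `(a, f a)` and then `((a, f a), g a)`; the rearrangement `h1` drops
  -- `a`.
  exact h1.comp ((PT.saved (hg.comp PT.fst)).comp hf.saved)

/-- Case distinction on whether the encoding of the second component is `nil`. -/
theorem PT.branch {F : α × β → γ} {g : α × β → γ} {h : δ → γ} (hg : PT g) (hh : PT h)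
    (hnil : ∀ p, enc p.2 = Data.nil → F p = g p)
    (hcons : ∀ p, enc p.2 ≠ Data.nil → ∃ d, enc d = enc p ∧ F p = h d) : PT F := by
  obtain ⟨c, N, b, hb, hc⟩ := hg
  obtain ⟨c', N', b', ⟨e', hb'⟩, hc'⟩ := hh
  refine ⟨Prog.cond (Expr.tl (Expr.var 0)) c' c, max N N',
    fun a => 3 + (b a + (esize a + 1) ^ e'), (PolyBdd.const _).add (hb.add
      ((PolyBdd.size.add (.const 1)).pow e')), fun p => ?_⟩
  by_cases hp : enc p.2 = Data.nil
  · rw [hnil p hp]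
    refine ⟨(Computes.branchFalse (e := Expr.tl (Expr.var 0)) (fun τ hτ => ?_)
      ((hc p).1.mono (le_max_left _ _) le_rfl)).mono le_rfl ?_, ?_⟩
    · simpa [Expr.eval, hτ, enc_prod, Data.tl] using hp
    · simp only [Expr.cost]; omega
    · exact (hc p).2.trans (by dsimp only; omega)
  -- The tree stays the same and is merely read as the encoding of an element `d` of another type,
  -- in which the contents of the constructor are accessible.
  · obtain ⟨d, hd, hF⟩ := hcons p hp
    have hs : esize d = esize p := by simp only [esize, hd]
    have := hb' d
    rw [hs] at this
    rw [hF, ← hd]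
    refine ⟨(Computes.branchTrue (e := Expr.tl (Expr.var 0)) (fun τ hτ => ?_)
      ((hc' d).1.mono (le_max_right _ _) le_rfl)).mono le_rfl ?_, ?_⟩
    · simpa [Expr.eval, hτ, hd, enc_prod, Data.tl] using hp
    · simp only [Expr.cost]; omega
    · exact (hc' d).2.trans (by dsimp only; omega)

/-- Loops: from `ι a`, the function `g` is iterated until the first component of the encoding
is `nil`. -/
theorem PT.while {ι : α → β} {g : β → β} (hι : PT ι) (hg : PT g) {F : α → β} (S B : α → ℕ)
    (hS : PolyBdd S) (hB : PolyBdd B)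
    (h : ∀ a, ∃ T ≤ S a, F a = g^[T] (ι a) ∧ (∀ i < T, (enc (g^[i] (ι a))).hd ≠ Data.nil) ∧
      (enc (g^[T] (ι a))).hd = Data.nil ∧ ∀ i ≤ T, esize (g^[i] (ι a)) ≤ B a) : PT F := by
  obtain ⟨c₀, N₀, b₀, hb₀, hc₀⟩ := hι
  obtain ⟨c, N, b, ⟨e, hb⟩, hc⟩ := hg
  refine ⟨Prog.seq c₀ (Prog.loop (Expr.hd (Expr.var 0)) c), max N₀ N,
    fun a => b₀ a + (S a * ((B a + 1) ^ e + 3) + 3) + B a,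
    (hb₀.add ((hS.mul (((hB.add (.const 1)).pow e).add (.const 3))).add (.const 3))).add hB,
    fun a => ?_⟩
  obtain ⟨T, hT, hF, h1, h2, h3⟩ := h a
  rw [hF]
  -- All rounds are charged alike: every intermediate state has size at most `B a`.
  have hl := Computes.loop T (fun i => enc (g^[i] (ι a))) (t := (B a + 1) ^ e) (fun i hi => by
    simp only [Function.iterate_succ_apply']
    exact (hc _).1.mono le_rfl ((hb _).trans (Nat.pow_le_pow_left (by
      have := h3 i hi.le; omega) e))) h1 h2
  refine ⟨(((hc₀ a).1.mono (le_max_left _ _) le_rfl).seq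
    (hl.mono (le_max_right _ _) le_rfl)).mono le_rfl ?_, (h3 _ le_rfl).trans (Nat.le_add_left _ _)⟩
  have := Nat.mul_le_mul_right ((B a + 1) ^ e + 3) hT
  dsimp only
  omega

end


section
variable {α β γ δ : Type} [Enc α] [Enc β] [Enc γ] [Enc δ]

/-! ### Options, booleans, lists -/

/-- Changes of type that do not change the tree take one trivial assignment. Lists of units,
numerals and trees are converted into each other in this way. -/
theorem PT.ofEncEq {f : α → β} (h : ∀ a, enc (f a) = enc a) : PT f :=
  .ofExpr (Expr.var 0) (fun a τ hτ => by rw [h]; exact hτ)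
    (PolyBdd.size.mono fun a => by simp only [esize, h]; exact le_rfl)

@[fun_prop]
theorem PT.some {f : α → β} (hf : PT f) : PT (fun a => some (f a)) :=
  PT.comp (g := fun b => Option.some b) (.ofExpr (Expr.cons Expr.nil (Expr.var 0))
    (fun a τ hτ => by simp [Expr.eval, hτ, enc_some])
    ((PolyBdd.size.add (.const 2)).mono fun a => by rw [esize_some])) hf

@[fun_prop]
theorem PT.cons {f : α → β} {g : α → List β} (hf : PT f) (hg : PT g) :
    PT (fun a => f a :: g a) :=
  PT.comp (g := fun p : β × List β => p.1 :: p.2) (.ofEncEq fun _ => rfl) (hf.pair hg)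

@[fun_prop]
theorem PT.tail {f : α → List β} (hf : PT f) : PT (fun a => (f a).tail) :=
  PT.comp (g := List.tail) (.ofExpr (Expr.tl (Expr.var 0))
    (fun a τ hτ => by cases a <;> simp [Expr.eval, hτ, enc_cons, enc_nil, Data.tl])
    (PolyBdd.size.mono fun a => by
      cases a <;> simp only [List.tail_cons, List.tail_nil, esize_cons] <;> omega)) hf

-- `some b` and `((), b)` have the same encoding, so `PT.branch` can hand the contents of the option
-- to `h`.
@[fun_prop]
theorem PT.option_elim {f : α → Option β} {g : α → γ} {h : α → β → γ} (hf : PT f) (hg : PT g)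
    (hh : PT (fun p : α × β => h p.1 p.2)) : PT (fun a => (f a).elim (g a) (h a)) := by
  have hh' : PT (fun p : α × Unit × β => h p.1 p.2.2) :=
    PT.comp (g := fun p : α × β => h p.1 p.2) (f := fun p : α × Unit × β => (p.1, p.2.2)) hh
      (by fun_prop)
  refine PT.comp (g := fun p : α × Option β => p.2.elim (g p.1) (h p.1)) ?_ hf.saved
  refine PT.branch (g := fun p => g p.1) (by fun_prop) hh' ?_ ?_
  · rintro ⟨a, _ | b⟩ h
    · rfl
    · simp [enc_some] at h
  · rintro ⟨a, _ | b⟩ h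
    · simp [enc_none] at h
    · exact ⟨(a, (), b), rfl, rfl⟩

@[fun_prop]
theorem PT.head? {f : α → List β} (hf : PT f) : PT (fun a => (f a).head?) := by
  refine PT.comp (g := fun p : α × List β => p.2.head?) ?_ hf.saved
  refine PT.branch (g := fun _ => none) (h := fun p : α × β × List β => Option.some p.2.1)
    (by fun_prop) (by fun_prop) ?_ ?_
  · rintro ⟨a, _ | ⟨b, l⟩⟩ h
    · rfl
    · simp [enc_cons] at h
  · rintro ⟨a, _ | ⟨b, l⟩⟩ h
    · simp [enc_nil] at h
    · exact ⟨(a, b, l), rfl, rfl⟩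

@[fun_prop]
theorem PT.cond {p : α → Bool} {f g : α → β} (hp : PT p) (hf : PT f) (hg : PT g) :
    PT (fun a => bif p a then f a else g a) := by
  refine PT.comp (g := fun q : α × Bool => bif q.2 then f q.1 else g q.1) ?_ hp.saved
  refine PT.branch (g := fun q => g q.1) (h := fun p : α × Unit × Unit => f p.1)
    (by fun_prop) (by fun_prop) ?_ ?_
  · rintro ⟨a, _ | _⟩ h
    · rfl
    · simp [enc_true] at h
  · rintro ⟨a, _ | _⟩ h
    · simp [enc_false] at h
    · exact ⟨(a, (), ()), rfl, rfl⟩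

@[fun_prop]
theorem PT.not {p : α → Bool} (hp : PT p) : PT (fun a => !p a) :=
  PT.comp (g := fun b : Bool => !b)
    (by have : PT (fun b : Bool => bif b then false else true) := by fun_prop
        convert this using 2 with b; cases b <;> rfl) hp

@[fun_prop]
theorem PT.and {p q : α → Bool} (hp : PT p) (hq : PT q) : PT (fun a => p a && q a) := by
  have : PT (fun a => bif p a then q a else false) := by fun_prop
  convert this using 2 with a; cases p a <;> rfl

@[fun_prop]
theorem PT.or {p q : α → Bool} (hp : PT p) (hq : PT q) : PT (fun a => p a || q a) := by
  have : PT (fun a => bif p a then true else q a) := by fun_prop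
  convert this using 2 with a; cases p a <;> rfl

@[fun_prop]
theorem PT.getD_option {f : α → Option β} {g : α → β} (hf : PT f) (hg : PT g) :
    PT (fun a => (f a).getD (g a)) := by
  have : PT (fun a => (f a).elim (g a) (fun b => b)) := by fun_prop
  convert this using 2 with a; cases f a <;> rfl

@[fun_prop]
theorem PT.isSome {f : α → Option β} (hf : PT f) : PT (fun a => (f a).isSome) := by
  have : PT (fun a => (f a).elim false (fun _ => true)) := by fun_prop
  convert this using 2 with a; cases f a <;> rfl

/-! ### Folds -/

theorem esize_le_of_mem {b : β} {l : List β} (h : b ∈ l) : esize b ≤ esize l := by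
  induction l with
  | nil => simp at h
  | cons c l ih =>
    rw [esize_cons]
    rcases List.mem_cons.1 h with rfl | h
    · omega
    · have := ih h; omega

theorem length_le_esize (l : List β) : l.length ≤ esize l := by
  induction l with
  | nil => simp
  | cons c l ih => rw [esize_cons, List.length_cons]; omega

theorem esize_list_le {l : List β} {M : ℕ} (h : ∀ b ∈ l, esize b ≤ M) :
    esize l ≤ l.length * (M + 1) + 1 := by
  induction l with
  | nil => simp [esize_nil]
  | cons c l ih =>
    have h1 := ih fun b hb => h b (by simp [hb])
    have h2 := h c (by simp)
    rw [esize_cons, List.length_cons, Nat.succ_mul]; omega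

/-- The fold is a loop on the triple of unread list, accumulator and input. It stops when the unread
list is encoded by `nil`, which is why this is the first component. The accumulators of all prefixes
must be bounded, since they occur as intermediate states. -/
theorem PT.foldl {f : α → List β} {i : α → γ} {s : α → γ → β → γ} (hf : PT f) (hi : PT i)
    (hs : PT (fun p : α × γ × β => s p.1 p.2.1 p.2.2)) {B : α → ℕ} (hB : PolyBdd B)
    (h : ∀ a l l', f a = l ++ l' → esize (l.foldl (s a) (i a)) ≤ B a) :
    PT (fun a => (f a).foldl (s a) (i a)) := by
  let g : List β × γ × α → List β × γ × α := fun p =>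
    (p.1.tail, p.1.head?.elim p.2.1 (fun b => s p.2.2 p.2.1 b), p.2.2)
  have hg : PT g := by
    have : PT (fun p : (List β × γ × α) × β => s p.1.2.2 p.1.2.1 p.2) :=
      PT.comp (g := fun p : α × γ × β => s p.1 p.2.1 p.2.2)
        (f := fun p : (List β × γ × α) × β => (p.1.2.2, p.1.2.1, p.2)) hs (by fun_prop)
    fun_prop
  have key : ∀ a l l' c, (enc (l, c, a)).hd = enc l ∧
      g^[l.length] (l ++ l', c, a) = (l', l.foldl (s a) c, a) := by
    intro a l
    induction l with
    | nil => exact fun l' c => ⟨rfl, rfl⟩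
    | cons b l ih =>
      intro l' c
      refine ⟨rfl, ?_⟩
      rw [List.length_cons, Function.iterate_succ_apply]
      exact (ih l' (s a c b)).2
  have hw : PT (fun a => (([] : List β), (f a).foldl (s a) (i a), a)) := by
    refine PT.while (ι := fun a => (f a, i a, a)) (by fun_prop) hg
      (fun a => esize (f a)) (fun a => esize (f a) + B a + esize a + 2) hf.size
      (((hf.size.add hB).add .size).add (.const 2)) fun a => ?_
    have hst : ∀ n ≤ (f a).length, g^[n] (f a, i a, a) =
        ((f a).drop n, ((f a).take n).foldl (s a) (i a), a) := fun n hn => by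
      have := (key a ((f a).take n) ((f a).drop n) (i a)).2
      rwa [List.take_append_drop, List.length_take, min_eq_left hn] at this
    refine ⟨(f a).length, length_le_esize _, ?_, fun n hn => ?_, ?_, fun n hn => ?_⟩
    · rw [hst _ le_rfl]; simp
    · rw [hst n hn.le, (key _ _ [] _).1]
      intro h0
      have : (f a).drop n = [] := Enc.inj h0
      simp at this; omega
    · rw [hst _ le_rfl]; simp [enc_prod, enc_nil, Data.hd]
    · rw [hst n hn, esize_mk, esize_mk]
      have h1 := h a ((f a).take n) ((f a).drop n) (by simp)
      have h2 : ∀ (m : ℕ) (l : List β), esize (l.drop m) ≤ esize l := by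
        intro m
        induction m with
        | zero => intro l; simp
        | succ m ih =>
          intro l
          cases l with
          | nil => simp
          | cons b l => rw [List.drop_succ_cons, esize_cons]; have := ih l; omega
      have := h2 n (f a)
      omega
  exact PT.comp (g := fun p : List β × γ × α => p.2.1) (by fun_prop) hw

/-- Folds in which every step increases the size of the accumulator by a bounded amount only. -/
theorem PT.foldl_of_growth {f : α → List β} {i : α → γ} {s : α → γ → β → γ} (hf : PT f)
    (hi : PT i) (hs : PT (fun p : α × γ × β => s p.1 p.2.1 p.2.2)) {D : α → ℕ} (hD : PolyBdd D)
    (h : ∀ a c, ∀ b ∈ f a, esize (s a c b) ≤ esize c + D a) :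
    PT (fun a => (f a).foldl (s a) (i a)) := by
  refine PT.foldl hf hi hs (B := fun a => esize (i a) + esize (f a) * D a)
    (hi.size.add (hf.size.mul hD)) fun a l l' hl => ?_
  have key : ∀ (l : List β) (c : γ), (∀ b ∈ l, b ∈ f a) →
      esize (l.foldl (s a) c) ≤ esize c + l.length * D a := by
    intro l
    induction l with
    | nil => simp
    | cons b l ih =>
      intro c hb
      have h1 := ih (s a c b) fun b' hb' => hb b' (by simp [hb'])
      have h2 := h a c b (hb b (by simp))
      rw [List.foldl_cons, List.length_cons, Nat.succ_mul]
      omega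
  refine (key l (i a) fun b hb => by simp [hl, hb]).trans ?_
  have : l.length ≤ esize (f a) :=
    le_trans (by simp [hl]) (length_le_esize (f a))
  have := Nat.mul_le_mul_right (D a) this
  omega

/-- An element of a list is not larger than the list. So one polynomial in the sizes of `a` and `f
a` bounds all values, as is required for folds whose step depends on the element. -/
theorem PT.exists_bound {f : α → List β} {h : α → β → γ} (hf : PT f)
    (hh : PT (fun p : α × β => h p.1 p.2)) :
    ∃ D : α → ℕ, PolyBdd D ∧ ∀ a, ∀ b ∈ f a, esize (h a b) ≤ D a := by
  obtain ⟨e, he⟩ := hh.size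
  refine ⟨fun a => (esize a + esize (f a) + 1 + 1) ^ e,
    (((PolyBdd.size.add hf.size).add (.const 1)).add (.const 1)).pow e, fun a b hb => ?_⟩
  refine (he (a, b)).trans (Nat.pow_le_pow_left ?_ e)
  have := esize_le_of_mem hb
  rw [esize_mk]; omega

@[fun_prop]
theorem PT.reverseAux {f g : α → List β} (hf : PT f) (hg : PT g) :
    PT (fun a => List.reverseAux (f a) (g a)) := by
  have : PT (fun a => (f a).foldl (fun acc b => b :: acc) (g a)) := by
    refine PT.foldl_of_growth hf hg (by fun_prop) (D := fun a => esize (f a) + 1)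
      (hf.size.add (.const 1)) fun a c b hb => ?_
    have := esize_le_of_mem hb
    rw [esize_cons]; omega
  convert this using 2 with a
  generalize g a = l'
  induction f a generalizing l' with
  | nil => rfl
  | cons b l ih => exact ih _

@[fun_prop]
theorem PT.reverse {f : α → List β} (hf : PT f) : PT (fun a => (f a).reverse) := by
  have : PT (fun a => List.reverseAux (f a) []) := by fun_prop
  exact this

@[fun_prop]
theorem PT.append {f g : α → List β} (hf : PT f) (hg : PT g) : PT (fun a => f a ++ g a) := by
  have : PT (fun a => List.reverseAux (f a).reverse (g a)) := by fun_prop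
  convert this using 2 with a
  simp [List.reverseAux_eq]

theorem esize_reverseAux (l l' : List β) :
    esize (List.reverseAux l l') + 1 = esize l + esize l' := by
  induction l generalizing l' with
  | nil => simp [List.reverseAux, esize_nil]; omega
  | cons b l ih => rw [List.reverseAux, ih, esize_cons, esize_cons]; omega

@[fun_prop]
theorem PT.flatMap {f : α → List β} {h : α → β → List γ} (hf : PT f)
    (hh : PT (fun p : α × β => h p.1 p.2)) : PT (fun a => (f a).flatMap (h a)) := by
  have : PT (fun a => ((f a).foldl (fun acc b => List.reverseAux (h a b) acc) []).reverse) := by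
    obtain ⟨D, hD, hD'⟩ := PT.exists_bound hf hh
    refine PT.reverse (PT.foldl_of_growth hf (by fun_prop) ?_ hD fun a c b hb => ?_)
    · refine PT.reverseAux ?_ (by fun_prop)
      exact PT.comp (g := fun p : α × β => h p.1 p.2)
        (f := fun p : α × List γ × β => (p.1, p.2.2)) hh (by fun_prop)
    · have h1 := hD' a b hb
      have h2 := esize_reverseAux (h a b) c
      omega
  convert this using 2 with a
  have key : ∀ (l : List β) (acc : List γ),
      (l.foldl (fun acc b => List.reverseAux (h a b) acc) acc).reverse =
        acc.reverse ++ l.flatMap (h a) := by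
    intro l
    induction l with
    | nil => simp
    | cons b l ih => intro acc; rw [List.foldl_cons, ih]; simp [List.reverseAux_eq]
  rw [key]; rfl

@[fun_prop]
theorem PT.map {f : α → List β} {h : α → β → γ} (hf : PT f)
    (hh : PT (fun p : α × β => h p.1 p.2)) : PT (fun a => (f a).map (h a)) := by
  have : PT (fun a => (f a).flatMap (fun b => [h a b])) := by fun_prop
  convert this using 2 with a
  rw [← List.map_eq_flatMap]

@[fun_prop]
theorem PT.filter {f : α → List β} {p : α → β → Bool} (hf : PT f)
    (hp : PT (fun q : α × β => p q.1 q.2)) : PT (fun a => (f a).filter (p a)) := by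
  have : PT (fun a => (f a).flatMap (fun b => bif p a b then [b] else [])) := by fun_prop
  convert this using 2 with a
  induction f a with
  | nil => rfl
  | cons b l ih => rw [List.filter_cons, List.flatMap_cons, ih]; cases p a b <;> rfl

@[fun_prop]
theorem PT.find? {f : α → List β} {p : α → β → Bool} (hf : PT f)
    (hp : PT (fun q : α × β => p q.1 q.2)) : PT (fun a => (f a).find? (p a)) := by
  have : PT (fun a => ((f a).filter (p a)).head?) := by fun_prop
  convert this using 2 with a
  simp

@[fun_prop]
theorem PT.any {f : α → List β} {p : α → β → Bool} (hf : PT f)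
    (hp : PT (fun q : α × β => p q.1 q.2)) : PT (fun a => (f a).any (p a)) := by
  have : PT (fun a => ((f a).find? (p a)).isSome) := by fun_prop
  convert this using 2 with a
  rw [Bool.eq_iff_iff]; simp

@[fun_prop]
theorem PT.all {f : α → List β} {p : α → β → Bool} (hf : PT f)
    (hp : PT (fun q : α × β => p q.1 q.2)) : PT (fun a => (f a).all (p a)) := by
  have : PT (fun a => !(f a).any (fun b => !p a b)) := by fun_prop
  convert this using 2 with a
  simp [List.all_eq_not_any_not]

/-! ### Natural numbers -/

/-- A numeral and the list of that many units are the same tree; arithmetic is carried out on such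
lists. -/
theorem enc_length (l : List Unit) : enc l.length = enc l := by
  induction l with
  | nil => rfl
  | cons b l ih => rw [List.length_cons, enc_succ, ih]; rfl

theorem enc_replicate (n : ℕ) : enc (List.replicate n ()) = enc n := by
  induction n with
  | zero => rfl
  | succ n ih => rw [List.replicate_succ, enc_cons, ih]; rfl

@[fun_prop]
theorem PT.length {f : α → List β} (hf : PT f) : PT (fun a => (f a).length) := by
  have : PT (fun a => ((f a).map (fun _ => ())).length) :=
    PT.comp (g := fun l : List Unit => l.length) (.ofEncEq enc_length) (by fun_prop)
  simpa using this

theorem PT.replicate {f : α → ℕ} (hf : PT f) : PT (fun a => List.replicate (f a) ()) :=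
  PT.comp (g := fun n => List.replicate n ()) (.ofEncEq enc_replicate) hf

@[fun_prop]
theorem PT.drop {f : α → List β} {n : α → ℕ} (hf : PT f) (hn : PT n) :
    PT (fun a => (f a).drop (n a)) := by
  have : PT (fun a => (List.replicate (n a) ()).foldl (fun l _ => l.tail) (f a)) := by
    refine PT.foldl_of_growth hn.replicate hf (by fun_prop) (D := fun _ => 0) (.const 0)
      fun a c b hb => ?_
    cases c with
    | nil => simp
    | cons d c => rw [List.tail_cons, esize_cons]; omega
  convert this using 2 with a
  generalize f a = l
  induction n a generalizing l with
  | zero => rfl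
  | succ m ih =>
    rw [List.replicate_succ, List.foldl_cons, ← ih]
    cases l <;> simp

@[fun_prop]
theorem PT.getD {f : α → List β} {n : α → ℕ} {d : α → β} (hf : PT f) (hn : PT n) (hd : PT d) :
    PT (fun a => (f a).getD (n a) (d a)) := by
  have : PT (fun a => ((f a).drop (n a)).head?.getD (d a)) := by fun_prop
  convert this using 2 with a
  simp [List.getD_eq_getElem?_getD]

@[fun_prop]
theorem PT.natAdd {f g : α → ℕ} (hf : PT f) (hg : PT g) : PT (fun a => f a + g a) := by
  have : PT (fun a => (List.replicate (f a) () ++ List.replicate (g a) ()).length) :=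
    PT.length (PT.append hf.replicate hg.replicate)
  simpa using this

@[fun_prop]
theorem PT.natMul {f g : α → ℕ} (hf : PT f) (hg : PT g) : PT (fun a => f a * g a) := by
  have : PT (fun a => ((List.replicate (f a) ()).flatMap
      (fun _ => List.replicate (g a) ())).length) :=
    PT.length (PT.flatMap hf.replicate (PT.replicate (hg.comp PT.fst)))
  simpa using this

@[fun_prop]
theorem PT.natSub {f g : α → ℕ} (hf : PT f) (hg : PT g) : PT (fun a => f a - g a) := by
  have : PT (fun a => ((List.replicate (f a) ()).drop (g a)).length) :=
    PT.length (PT.drop hf.replicate hg)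
  simpa using this

@[fun_prop]
theorem PT.natPow {f : α → ℕ} (hf : PT f) (n : ℕ) : PT (fun a => f a ^ n) := by
  induction n with
  | zero => simp only [pow_zero]; fun_prop
  | succ n ih => simp only [pow_succ]; fun_prop

@[fun_prop]
theorem PT.natLE {f g : α → ℕ} (hf : PT f) (hg : PT g) : PT (fun a => decide (f a ≤ g a)) := by
  have : PT (fun a => !((List.replicate (f a - g a) ()).head?.isSome)) :=
    PT.not (PT.isSome (PT.head? (PT.replicate (hf.natSub hg))))
  convert this using 2 with a
  rw [Bool.eq_iff_iff]; simp [List.head?_replicate, Nat.sub_eq_zero_iff_le]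

@[fun_prop]
theorem PT.natLT {f g : α → ℕ} (hf : PT f) (hg : PT g) : PT (fun a => decide (f a < g a)) := by
  have : PT (fun a => decide (f a + 1 ≤ g a)) := by fun_prop
  exact this

@[fun_prop]
theorem PT.range {f : α → ℕ} (hf : PT f) : PT (fun a => List.range (f a)) := by
  -- The length of the accumulator is the next number, so no separate counter is carried.
  have key : ∀ n, (List.replicate n ()).foldl (fun acc _ => acc.length :: acc) [] =
      (List.range n).reverse := by
    intro n
    induction n with
    | zero => rfl
    | succ n ih => rw [List.replicate_succ', List.foldl_append, ih]; simp [List.range_succ]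
  have : PT (fun a => ((List.replicate (f a) ()).foldl (fun acc _ => acc.length :: acc)
      []).reverse) := by
    refine PT.reverse (PT.foldl hf.replicate (by fun_prop) (by fun_prop)
      (B := fun a => f a * (2 * f a + 2) + 1) ?_ fun a l l' hl => ?_)
    · have hfb : PolyBdd f := hf.size.mono fun a => by rw [esize_nat]; omega
      exact (hfb.mul (((PolyBdd.const 2).mul hfb).add (.const 2))).add (.const 1)
    · have hl1 : l = List.replicate l.length () := List.eq_replicate_of_mem fun _ _ => rfl
      have hl2 : l.length ≤ f a := by
        have := congrArg List.length hl
        simp at this; omega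
      rw [hl1, key]
      refine (esize_list_le (M := 2 * f a + 1) fun b hb => ?_).trans ?_
      · simp at hb
        rw [esize_nat]; omega
      · simp only [List.length_reverse, List.length_range]
        exact Nat.add_le_add_right (Nat.mul_le_mul_right (2 * f a + 2) hl2) 1
  simpa [key] using this

/-! ### Equality and decoding -/

theorem PT.encode : PT (fun a : α => enc a) := .ofEncEq fun _ => rfl

@[fun_prop]
theorem PT.dataHd {f : α → Data} (hf : PT f) : PT (fun a => (f a).hd) :=
  PT.comp (g := Data.hd) (.ofExpr (Expr.hd (Expr.var 0))
    (fun a τ hτ => by simp [Expr.eval, hτ, enc_data])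
    (PolyBdd.size.mono fun a => by cases a <;> simp [esize, enc_data, Data.hd, Data.size]; omega))
    hf

@[fun_prop]
theorem PT.dataTl {f : α → Data} (hf : PT f) : PT (fun a => (f a).tl) :=
  PT.comp (g := Data.tl) (.ofExpr (Expr.tl (Expr.var 0))
    (fun a τ hτ => by simp [Expr.eval, hτ, enc_data])
    (PolyBdd.size.mono fun a => by cases a <;> simp [esize, enc_data, Data.tl, Data.size]; omega))
    hf

theorem esize_data (x : Data) : esize x = x.size := rfl

theorem esize_data_cons (x y : Data) : esize (Data.cons x y) = esize x + esize y + 1 := rfl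

/-- Whether a tree has more than one node. -/
def Data.isCons : Data → Bool
  | nil => false
  | cons _ _ => true

@[fun_prop]
theorem PT.dataIsCons {f : α → Data} (hf : PT f) : PT (fun a => (f a).isCons) := by
  refine PT.comp (g := fun p : α × Data => p.2.isCons) ?_ hf.saved
  refine PT.branch (g := fun _ => false) (h := fun _ : α × Data => true)
    (by fun_prop) (by fun_prop) ?_ ?_
  · rintro ⟨a, _ | _⟩ h
    · rfl
    · simp [enc_data] at h
  · rintro ⟨a, _ | ⟨b, l⟩⟩ h
    · simp [enc_data] at h
    · exact ⟨_, rfl, rfl⟩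

/-- Every tree is the encoding of a list of trees. -/
def Data.toList : Data → List Data
  | nil => []
  | cons a b => a :: b.toList

theorem Data.enc_toList (x : Data) : enc x.toList = x := by
  induction x with
  | nil => rfl
  | cons a b _ ih => rw [toList, enc_cons, ih]; rfl

theorem Data.toList_ofList (l : List Data) : (Data.ofList l).toList = l := by
  induction l with
  | nil => rfl
  | cons a l ih => rw [ofList, toList, ih]

@[fun_prop]
theorem PT.dataToList {f : α → Data} (hf : PT f) : PT (fun a => (f a).toList) :=
  PT.comp (g := Data.toList) (.ofEncEq Data.enc_toList) hf

/-- Decoding of numerals. -/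
def Data.toNat (x : Data) : ℕ := x.toList.length

theorem Data.toNat_num (n : ℕ) : (Data.num n).toNat = n := by
  induction n with
  | zero => rfl
  | succ n ih => simpa [toNat, num, toList] using ih

@[fun_prop]
theorem PT.dataToNat {f : α → Data} (hf : PT f) : PT (fun a => (f a).toNat) := by
  unfold Data.toNat; fun_prop

/-- One step in the comparison of two trees: the first component of the state holds the pairs of
trees which remain to be compared. -/
def compareStep (p : List (Data × Data) × Bool) : List (Data × Data) × Bool :=
  p.1.head?.elim p fun q =>
    bif q.1.isCons then
      bif q.2.isCons then ((q.1.hd, q.2.hd) :: (q.1.tl, q.2.tl) :: p.1.tail, p.2)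
      else ([], false)
    else bif q.2.isCons then ([], false) else (p.1.tail, p.2)

/-- Each step uses up at least one node of a left tree or ends the comparison, so the total size of
the left trees bounds the number of steps. Replacing a pair of `cons` trees by the two pairs of
their components does not enlarge the encoded stack, so all states stay as small as the first. -/
theorem compareStep_spec : ∀ (n : ℕ) (l : List (Data × Data)) (b : Bool),
    (l.map fun q => q.1.size).sum ≤ n →
    ∃ T ≤ n, ∃ c, compareStep^[T] (l, b) = ([], c) ∧
      (c = true ↔ b = true ∧ ∀ q ∈ l, q.1 = q.2) ∧
      (∀ i < T, (compareStep^[i] (l, b)).1 ≠ []) ∧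
      ∀ i ≤ T, esize (compareStep^[i] (l, b)) ≤ esize (l, b) := by
  have step : ∀ (n : ℕ) (p : List (Data × Data) × Bool) (P : Prop), p.1 ≠ [] →
      esize (compareStep p) ≤ esize p →
      (∃ T ≤ n, ∃ c, compareStep^[T] (compareStep p) = ([], c) ∧ (c = true ↔ P) ∧
        (∀ i < T, (compareStep^[i] (compareStep p)).1 ≠ []) ∧
        ∀ i ≤ T, esize (compareStep^[i] (compareStep p)) ≤ esize (compareStep p)) →
      ∃ T ≤ n + 1, ∃ c, compareStep^[T] p = ([], c) ∧ (c = true ↔ P) ∧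
        (∀ i < T, (compareStep^[i] p).1 ≠ []) ∧ ∀ i ≤ T, esize (compareStep^[i] p) ≤ esize p := by
    rintro n p P hp hs ⟨T, hT, c, h1, h2, h3, h4⟩
    refine ⟨T + 1, by omega, c, h1, h2, fun i hi => ?_, fun i hi => ?_⟩
    · cases i with
      | zero => exact hp
      | succ i => exact h3 i (by omega)
    · cases i with
      | zero => exact le_rfl
      | succ i => exact (h4 i (by omega)).trans hs
  have ends : ∀ (n : ℕ) (P : Prop), ¬P → ∃ T ≤ n, ∃ c,
      compareStep^[T] ([], false) = ([], c) ∧ (c = true ↔ P) ∧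
        (∀ i < T, (compareStep^[i] ([], false)).1 ≠ []) ∧
        ∀ i ≤ T, esize (compareStep^[i] ([], false)) ≤
          esize (([], false) : List (Data × Data) × _) :=
    fun n P hP => ⟨0, by omega, false, rfl, by simpa using hP, fun i hi => by omega,
      fun i hi => by rw [Nat.le_zero.1 hi]; exact le_rfl⟩
  have hfalse : ∀ (q : Data × Data) (l : List (Data × Data)) (b : Bool),
      esize (([], false) : List (Data × Data) × Bool) ≤ esize (q :: l, b) := fun q l b => by
    rw [esize_mk, esize_mk, esize_cons, esize_nil]
    have h1 : esize false ≤ esize b := by cases b <;> decide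
    have := one_le_esize l
    omega
  intro n
  induction n with
  | zero =>
    rintro (_ | ⟨⟨x, y⟩, l⟩) b h
    · exact ⟨0, le_rfl, b, rfl, by simp, fun i hi => by omega,
        fun i hi => by rw [Nat.le_zero.1 hi]; exact le_rfl⟩
    · have := x.one_le_size
      simp at h; omega
  | succ n ih =>
    rintro (_ | ⟨⟨_ | ⟨x, x'⟩, _ | ⟨y, y'⟩⟩, l⟩) b h
    · exact ⟨0, by omega, b, rfl, by simp, fun i hi => by omega,
        fun i hi => by rw [Nat.le_zero.1 hi]; exact le_rfl⟩
    · refine step n _ _ (by simp) ?_ ?_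
      · change esize (l, b) ≤ _
        simp only [esize_mk, esize_cons]; omega
      · have := ih l b (by simp [Data.size] at h; omega)
        simpa [compareStep, Data.isCons] using this
    · exact step n _ _ (by simp) (hfalse _ _ _) (ends n _ (by simp))
    · exact step n _ _ (by simp) (hfalse _ _ _) (ends n _ (by simp))
    · refine step n _ _ (by simp) ?_ ?_
      · change esize ((x, y) :: (x', y') :: l, b) ≤ _
        simp only [esize_mk, esize_cons, esize_data_cons]; omega
      · have := ih ((x, y) :: (x', y') :: l) b (by simp [Data.size] at h ⊢; omega)
        simpa [compareStep, Data.isCons, Data.hd, Data.tl, and_assoc] using this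

noncomputable instance : DecidableEq Data := Classical.decEq _

-- Elements are compared through their encodings, which are injective; the tree comparison is run
-- with one pair on its stack.
@[fun_prop]
theorem PT.decEq {f g : α → β} {_ : ∀ a, Decidable (f a = g a)} (hf : PT f) (hg : PT g) :
    PT (fun a => decide (f a = g a)) := by
  have hstep : PT compareStep := by unfold compareStep; fun_prop
  have hw : PT (fun p : Data × Data => (([] : List (Data × Data)), decide (p.1 = p.2))) := by
    refine PT.while (ι := fun p : Data × Data => ([p], true)) (by fun_prop) hstep
      (fun p => esize p) (fun p => esize p + 6) .size (PolyBdd.size.add (.const 6)) fun p => ?_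
    obtain ⟨T, hT, c, h1, h2, h3, h4⟩ := compareStep_spec (esize p) [p] true
      (by
        simp only [List.map_cons, List.map_nil, List.sum_singleton, esize_prod, esize_data]
        omega)
    refine ⟨T, hT, ?_, fun i hi h0 => h3 i hi (Enc.inj h0), by rw [h1]; rfl, fun i hi => ?_⟩
    · rw [h1]
      refine Prod.ext rfl ?_
      rw [Bool.eq_iff_iff, h2]; simp
    · refine (h4 i hi).trans ?_
      rw [esize_mk, esize_cons, esize_nil]
      have : esize true = 3 := rfl
      omega
  have h' : PT (fun p : Data × Data => decide (p.1 = p.2)) := PT.comp PT.snd hw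
  have : PT (fun a => decide (enc (f a) = enc (g a))) :=
    PT.comp h' ((PT.encode.comp hf).pair (PT.encode.comp hg))
  convert this using 2 with a
  rw [Bool.eq_iff_iff, decide_eq_true_iff, decide_eq_true_iff, Enc.inj.eq_iff]

@[fun_prop]
theorem PT.decMem {f : α → β} {g : α → List β} {_ : ∀ a, Decidable (f a ∈ g a)} (hf : PT f)
    (hg : PT g) : PT (fun a => decide (f a ∈ g a)) := by
  classical
  have : PT (fun a => (g a).any (fun b => decide (b = f a))) := by fun_prop
  convert this using 2 with a
  rw [Bool.eq_iff_iff]; simp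

end


/-! ### Computable bounds -/

theorem computable_add {f g : ℕ → ℕ} (hf : Computable f) (hg : Computable g) :
    Computable fun k => f k + g k :=
  (Primrec.nat_add.to_comp : Computable₂ _).comp hf hg

theorem computable_mul {f g : ℕ → ℕ} (hf : Computable f) (hg : Computable g) :
    Computable fun k => f k * g k :=
  (Primrec.nat_mul.to_comp : Computable₂ _).comp hf hg

theorem computable_pow {f g : ℕ → ℕ} (hf : Computable f) (hg : Computable g) :
    Computable fun k => f k ^ g k :=
  ((Primrec₂.unpaired'.1 Nat.Primrec.pow).to_comp : Computable₂ _).comp hf hg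

/-- Partial sums of `f` dominate all earlier values. Such a bound is needed because a reduction
controls the new parameter only from above, while the given function need not be monotone. -/
theorem exists_monotone_bound {f : ℕ → ℕ} (hf : Computable f) :
    ∃ F : ℕ → ℕ, Computable F ∧ ∀ m, ∀ i ≤ m, f i ≤ F m := by
  refine ⟨fun m => Nat.rec (f 0) (fun j acc => acc + f (j + 1)) m, ?_, fun m => ?_⟩
  · refine Computable.nat_rec (f := fun m : ℕ => m) (g := fun _ : ℕ => f 0)
      (h := fun (_ : ℕ) (p : ℕ × ℕ) => p.2 + f (p.1 + 1)) Computable.id (Computable.const _) ?_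
    have h1 : Computable fun q : ℕ × ℕ × ℕ => q.2.2 := Computable.snd.comp Computable.snd
    have h2 : Computable fun q : ℕ × ℕ × ℕ => f (q.2.1 + 1) :=
      hf.comp (Computable.succ.comp (Computable.fst.comp Computable.snd))
    exact (Primrec.nat_add.to_comp : Computable₂ _).comp h1 h2
  · induction m with
    | zero => intro i hi; rw [Nat.le_zero.1 hi]; exact le_rfl
    | succ m ih =>
      intro i hi
      rcases Nat.le_succ_iff.1 hi with h | h
      · exact (ih i h).trans (Nat.le_add_right _ _)
      · rw [h]; exact Nat.le_add_left _ _

/-! ### Composition of reductions -/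

theorem one_le_size_inst (x : Data) (k : ℕ) : 1 ≤ (inst x k).size := Data.one_le_size _

/-- The second program runs on an instance of size at most `f₁ k * s ^ e₁` with a parameter at most
`g₁ k`. Inserting this into its bound separates into a factor depending on `k` and the power `s ^
(e₁ * e₂)`. -/
theorem ReducesInto.trans {P Q R : ParamProblem} {C : Set (Data × ℕ)}
    (h : ReducesInto P Q Set.univ) (h' : ReducesInto Q R C) : ReducesInto P R C := by
  obtain ⟨c₁, f₁, g₁, e₁, hf₁, hg₁, h₁⟩ := h
  obtain ⟨c₂, f₂, g₂, e₂, hf₂, hg₂, h₂⟩ := h'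
  obtain ⟨d₁, N₁, K₁, hd₁⟩ := c₁.exists_computes
  obtain ⟨d₂, N₂, K₂, hd₂⟩ := c₂.exists_computes
  obtain ⟨F, hF, hF'⟩ := exists_monotone_bound hf₂
  obtain ⟨G, hG, hG'⟩ := exists_monotone_bound hg₂
  refine ⟨Prog.seq d₁ d₂, fun k => f₁ k + K₁ + F (g₁ k) * f₁ k ^ e₂ + K₂, fun k => G (g₁ k),
    e₁ + e₁ * e₂, ?_, hG.comp hg₁, fun x k => ?_⟩
  · exact computable_add (computable_add (computable_add hf₁ (Computable.const _))
      (computable_mul (hF.comp hg₁) (computable_pow hf₁ (Computable.const _))))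
      (Computable.const _)
  obtain ⟨σ₁, t₁, y, l, r₁, o₁, ht₁, hs₁, hl₁, -, hiff₁⟩ := h₁ x k
  obtain ⟨σ₂, t₂, z, l', r₂, o₂, ht₂, hs₂, hl₂, hC, hiff₂⟩ := h₂ y l
  have q₁ := hd₁ _ _ _ r₁
  have q₂ := hd₂ _ _ _ r₂
  rw [o₁] at q₁
  rw [o₂] at q₂
  obtain ⟨σ, u, hr, hu, ho⟩ := ((q₁.mono (le_max_left N₁ N₂) le_rfl).seq
    (q₂.mono (le_max_right N₁ N₂) le_rfl)).runs
  set s := (inst x k).size with hs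
  have hs1 : 1 ≤ s := one_le_size_inst x k
  have hsmall : f₂ l * (inst y l).size ^ e₂ ≤ F (g₁ k) * f₁ k ^ e₂ * s ^ (e₁ * e₂) := by
    calc f₂ l * (inst y l).size ^ e₂ ≤ F (g₁ k) * (f₁ k * s ^ e₁) ^ e₂ :=
          Nat.mul_le_mul (hF' _ _ hl₁) (Nat.pow_le_pow_left hs₁ _)
      _ = _ := by rw [mul_pow, ← pow_mul, mul_assoc]
  have a1 : s ^ e₁ ≤ s ^ (e₁ + e₁ * e₂) := Nat.pow_le_pow_right hs1 (Nat.le_add_right _ _)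
  have a2 : s ^ (e₁ * e₂) ≤ s ^ (e₁ + e₁ * e₂) := Nat.pow_le_pow_right hs1 (Nat.le_add_left _ _)
  have a3 : 1 ≤ s ^ (e₁ + e₁ * e₂) := Nat.one_le_pow _ _ hs1
  have b1 : F (g₁ k) * f₁ k ^ e₂ * s ^ (e₁ * e₂) ≤
    F (g₁ k) * f₁ k ^ e₂ * s ^ (e₁ + e₁ * e₂) := Nat.mul_le_mul_left _ a2
  have b2 : f₁ k * s ^ e₁ ≤ f₁ k * s ^ (e₁ + e₁ * e₂) := Nat.mul_le_mul_left _ a1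
  have b3 : K₁ * 1 ≤ K₁ * s ^ (e₁ + e₁ * e₂) := Nat.mul_le_mul_left _ a3
  have b4 : K₂ * 1 ≤ K₂ * s ^ (e₁ + e₁ * e₂) := Nat.mul_le_mul_left _ a3
  refine ⟨σ, u, z, l', hr, ho, ?_, ?_, hl₂.trans (hG' _ _ hl₁), hC, hiff₁.trans hiff₂⟩
  · simp only [add_mul]; omega
  · simp only [add_mul]; omega

/-- The estimate is that for composed reductions. The algorithm for `Q` needs to work on `C` only,
because the reduction produces no other instances. -/
theorem ReducesInto.mem_FPT {P Q : ParamProblem} {C : Set (Data × ℕ)}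
    (h : ReducesInto P Q C) (h' : InFPTOn Q C) : P ∈ FPT := by
  obtain ⟨c₁, f₁, g₁, e₁, hf₁, hg₁, h₁⟩ := h
  obtain ⟨c₂, f₂, e₂, hf₂, h₂⟩ := h'
  obtain ⟨d₁, N₁, K₁, hd₁⟩ := c₁.exists_computes
  obtain ⟨d₂, N₂, K₂, hd₂⟩ := c₂.exists_computes
  obtain ⟨F, hF, hF'⟩ := exists_monotone_bound hf₂
  refine ⟨Prog.seq d₁ d₂, fun k => f₁ k + K₁ + F (g₁ k) * f₁ k ^ e₂ + K₂,
    e₁ + e₁ * e₂, ?_, fun x k _ => ?_⟩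
  · exact computable_add (computable_add (computable_add hf₁ (Computable.const _))
      (computable_mul (hF.comp hg₁) (computable_pow hf₁ (Computable.const _))))
      (Computable.const _)
  obtain ⟨σ₁, t₁, y, l, r₁, o₁, ht₁, hs₁, hl₁, hC, hiff₁⟩ := h₁ x k
  obtain ⟨σ₂, t₂, r₂, ht₂, hiff₂⟩ := h₂ y l hC
  have q₁ := hd₁ _ _ _ r₁
  have q₂ := hd₂ _ _ _ r₂
  rw [o₁] at q₁
  obtain ⟨σ, u, hr, hu, ho⟩ := ((q₁.mono (le_max_left N₁ N₂) le_rfl).seq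
    (q₂.mono (le_max_right N₁ N₂) le_rfl)).runs
  set s := (inst x k).size with hs
  have hs1 : 1 ≤ s := one_le_size_inst x k
  have hsmall : f₂ l * (inst y l).size ^ e₂ ≤ F (g₁ k) * f₁ k ^ e₂ * s ^ (e₁ * e₂) := by
    calc f₂ l * (inst y l).size ^ e₂ ≤ F (g₁ k) * (f₁ k * s ^ e₁) ^ e₂ :=
          Nat.mul_le_mul (hF' _ _ hl₁) (Nat.pow_le_pow_left hs₁ _)
      _ = _ := by rw [mul_pow, ← pow_mul, mul_assoc]
  have a1 : s ^ e₁ ≤ s ^ (e₁ + e₁ * e₂) := Nat.pow_le_pow_right hs1 (Nat.le_add_right _ _)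
  have a2 : s ^ (e₁ * e₂) ≤ s ^ (e₁ + e₁ * e₂) := Nat.pow_le_pow_right hs1 (Nat.le_add_left _ _)
  have a3 : 1 ≤ s ^ (e₁ + e₁ * e₂) := Nat.one_le_pow _ _ hs1
  have b1 : F (g₁ k) * f₁ k ^ e₂ * s ^ (e₁ * e₂) ≤
    F (g₁ k) * f₁ k ^ e₂ * s ^ (e₁ + e₁ * e₂) := Nat.mul_le_mul_left _ a2
  have b2 : f₁ k * s ^ e₁ ≤ f₁ k * s ^ (e₁ + e₁ * e₂) := Nat.mul_le_mul_left _ a1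
  have b3 : K₁ * 1 ≤ K₁ * s ^ (e₁ + e₁ * e₂) := Nat.mul_le_mul_left _ a3
  have b4 : K₂ * 1 ≤ K₂ * s ^ (e₁ + e₁ * e₂) := Nat.mul_le_mul_left _ a3
  refine ⟨σ, u, hr, ?_, by rw [ho]; exact hiff₂.trans hiff₁.symm⟩
  simp only [add_mul]; omega

/-! ### Reductions from polynomial-time functions -/

/-- The length of the padding by which inputs may be extended in a parameterized reduction. -/
def padding (c k : ℕ) : ℕ := (c * (k + 1) + 1) ^ k

theorem computable_padding (c : ℕ) : Computable (padding c) :=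
  computable_pow (computable_add (computable_mul (Computable.const c)
    (computable_add Computable.id (Computable.const 1))) (Computable.const 1)) Computable.id

/-- The number is not polynomial in `k`, so `PT` does not apply to it as a whole. It arises by `k`
multiplications, each of them a `PT` step, on numbers bounded by a computable function of `k`. -/
theorem exists_computes_padding (c : ℕ) : ∃ (p : Prog) (N : ℕ) (f : ℕ → ℕ), Computable f ∧
    ∀ k, Computes p N (enc k) (enc (padding c k)) (f k) := by
  have hi : PT (fun k : ℕ => (k, 1, c * (k + 1) + 1)) := by fun_prop
  have hs : PT (fun q : ℕ × ℕ × ℕ => (q.1 - 1, q.2.1 * q.2.2, q.2.2)) := by fun_prop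
  have ho : PT (fun q : ℕ × ℕ × ℕ => q.2.1) := by fun_prop
  obtain ⟨p₁, N₁, b₁, ⟨e₁, hb₁⟩, h₁⟩ := hi
  obtain ⟨p₂, N₂, b₂, ⟨e₂, hb₂⟩, h₂⟩ := hs
  obtain ⟨p₃, N₃, b₃, ⟨e₃, hb₃⟩, h₃⟩ := ho
  set g := fun q : ℕ × ℕ × ℕ => (q.1 - 1, q.2.1 * q.2.2, q.2.2)
  set S : ℕ → ℕ := fun k => 2 * k + 2 * padding c k + 2 * (c * (k + 1) + 1) + 6 with hS
  have hcS : Computable S :=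
    computable_add (computable_add (computable_add
      (computable_mul (Computable.const 2) Computable.id)
      (computable_mul (Computable.const 2) (computable_padding c)))
      (computable_mul (Computable.const 2) (computable_add (computable_mul (Computable.const c)
      (computable_add Computable.id (Computable.const 1))) (Computable.const 1))))
      (Computable.const 6)
  refine ⟨Prog.seq p₁ (Prog.seq (Prog.loop (Expr.hd (Expr.var 0)) p₂) p₃), max N₁ (max N₂ N₃),
    fun k => (S k) ^ e₁ + ((k * (S k ^ e₂ + 3) + 3) + S k ^ e₃), ?_, fun k => ?_⟩
  · exact computable_add (computable_pow hcS (Computable.const _)) (computable_add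
      (computable_add (computable_mul Computable.id (computable_add
        (computable_pow hcS (Computable.const _)) (Computable.const 3))) (Computable.const 3))
      (computable_pow hcS (Computable.const _)))
  have hit : ∀ i ≤ k, g^[i] (k, 1, c * (k + 1) + 1) =
      (k - i, (c * (k + 1) + 1) ^ i, c * (k + 1) + 1) := by
    intro i
    induction i with
    | zero => intro _; simp
    | succ i ih =>
      intro hi
      rw [Function.iterate_succ_apply', ih (by omega)]
      simp only [g, pow_succ]
      rfl
  have hsz : ∀ i ≤ k, esize (g^[i] (k, 1, c * (k + 1) + 1)) + 1 ≤ S k := fun i hik => by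
    rw [hit i hik]
    have : (c * (k + 1) + 1) ^ i ≤ padding c k := Nat.pow_le_pow_right (by omega) hik
    simp only [esize_mk, esize_nat, hS]
    omega
  have hloop := Computes.loop (c := p₂) (N := N₂) (t := S k ^ e₂) k
    (fun i => enc (g^[i] (k, 1, c * (k + 1) + 1))) (fun i hik => by
      simp only [Function.iterate_succ_apply']
      exact (h₂ _).1.mono le_rfl ((hb₂ _).trans (Nat.pow_le_pow_left (hsz i hik.le) _)))
    (fun i hik => by
      obtain ⟨j, hj⟩ : ∃ j, k - i = j + 1 := ⟨k - i - 1, by omega⟩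
      rw [hit i hik.le, hj]
      simp [enc_prod, Data.hd, enc_succ])
    (by rw [hit k le_rfl]; simp [enc_prod, Data.hd, enc_zero])
  refine Computes.seq (y := enc (k, 1, c * (k + 1) + 1))
    ((h₁ k).1.mono (le_max_left _ _) ((hb₁ _).trans (Nat.pow_le_pow_left ?_ _)))
    (Computes.seq (hloop.mono ((le_max_left _ _).trans (le_max_right _ _)) le_rfl) ?_)
  · rw [esize_nat]; simp only [hS]; omega
  · have := (h₃ (g^[k] (k, 1, c * (k + 1) + 1))).1.mono
      (N' := max N₁ (max N₂ N₃)) ((le_max_right _ _).trans (le_max_right _ _))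
      ((hb₃ _).trans (Nat.pow_le_pow_left (hsz k le_rfl) _))
    have hk : (fun q : ℕ × ℕ × ℕ => q.2.1) (g^[k] (k, 1, c * (k + 1) + 1)) = padding c k := by
      rw [hit k le_rfl]; rfl
    rwa [hk] at this

/-- A polynomial in the sizes of the instance and of the padding is at most a function of `k` times
a power of the instance size. All superpolynomial dependence on the parameter is confined to the
padding. -/
theorem reducesInto_of_PT {P Q : ParamProblem} {C : Set (Data × ℕ)} (c : ℕ) {g : ℕ → ℕ}
    (hg : Computable g) {F : (Data × ℕ) × ℕ → Data × ℕ} (hF : PT F)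
    (h : ∀ x k, (F ((x, k), padding c k)).2 ≤ g k ∧ F ((x, k), padding c k) ∈ C ∧
      ((x, k) ∈ P ↔ F ((x, k), padding c k) ∈ Q)) : ReducesInto P Q C := by
  obtain ⟨p, N, f, hf, hp⟩ := exists_computes_padding c
  have h2 : PT (fun q : Data × ℕ => q.2) := by fun_prop
  obtain ⟨p₁, N₁, b₁, ⟨e₁, hb₁⟩, h₁⟩ := h2
  obtain ⟨p₂, N₂, b₂, ⟨e₂, hb₂⟩, h₂⟩ := hF
  refine ⟨Prog.seq ((Prog.seq p₁ p).saved (max N₁ N)) p₂,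
    fun k => 2 ^ e₁ + f k + 8 + (2 * padding c k + 4) ^ e₂, g, e₁ + e₂, ?_, hg, fun x k => ?_⟩
  · exact computable_add (computable_add (computable_add (Computable.const _) hf)
      (Computable.const 8)) (computable_pow (computable_add (computable_mul (Computable.const 2)
      (computable_padding c)) (Computable.const 4)) (Computable.const _))
  have q := (((h₁ (x, k)).1.mono (le_max_left N₁ N) le_rfl).seq
    ((hp k).mono (le_max_right N₁ N) le_rfl)).saved
  have q' := (q.mono (le_max_left _ N₂) le_rfl).seq
    ((h₂ ((x, k), padding c k)).1.mono (le_max_right (max N₁ N + 2) N₂) le_rfl)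
  obtain ⟨σ, u, hr, hu, ho⟩ := q'.runs
  obtain ⟨hl, hC, hiff⟩ := h x k
  set s := (inst x k).size with hs
  have hs1 : 1 ≤ s := one_le_size_inst x k
  have a1 : s ^ e₁ ≤ s ^ (e₁ + e₂) := Nat.pow_le_pow_right hs1 (Nat.le_add_right _ _)
  have a2 : s ^ e₂ ≤ s ^ (e₁ + e₂) := Nat.pow_le_pow_right hs1 (Nat.le_add_left _ _)
  have a3 : 1 ≤ s ^ (e₁ + e₂) := Nat.one_le_pow _ _ hs1
  have b1 : b₁ (x, k) ≤ 2 ^ e₁ * s ^ (e₁ + e₂) := by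
    refine (hb₁ _).trans ?_
    calc (s + 1) ^ e₁ ≤ (2 * s) ^ e₁ := Nat.pow_le_pow_left (by omega) _
      _ = 2 ^ e₁ * s ^ e₁ := mul_pow _ _ _
      _ ≤ _ := Nat.mul_le_mul_left _ a1
  have b2 : b₂ ((x, k), padding c k) ≤ (2 * padding c k + 4) ^ e₂ * s ^ (e₁ + e₂) := by
    refine (hb₂ _).trans ?_
    have : esize ((x, k), padding c k) = s + (2 * padding c k + 1) + 1 := by
      rw [esize_mk, esize_nat]; rfl
    rw [this]
    calc (s + (2 * padding c k + 1) + 1 + 1) ^ e₂ ≤ ((2 * padding c k + 4) * s) ^ e₂ := by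
          refine Nat.pow_le_pow_left ?_ _
          nlinarith
      _ = (2 * padding c k + 4) ^ e₂ * s ^ e₂ := mul_pow _ _ _
      _ ≤ _ := Nat.mul_le_mul_left _ a2
  have b3 : f k * 1 ≤ f k * s ^ (e₁ + e₂) := Nat.mul_le_mul_left _ a3
  have b4 := (h₂ ((x, k), padding c k)).2
  refine ⟨σ, u, (F ((x, k), padding c k)).1, (F ((x, k), padding c k)).2, hr, ho, ?_, ?_, hl, hC,
    hiff⟩
  · simp only [add_mul]; omega
  · change esize (F ((x, k), padding c k)) ≤ _
    simp only [add_mul]; omega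

/-! ### Fixed-parameter tractable problems are in `W[1]` -/

/-- The structure with one element and no relations. -/
def pointStructure : FinStructure (m := 0) Fin.elim0 := ⟨1, one_pos, fun i => i.elim0⟩

/-- The formula `x_0 = x_0`. -/
def trivialQF : QFFormula (m := 0) Fin.elim0 0 1 := .eq 0 0

/-- The algorithm is run and its answer translated into one of two fixed instances of a trivial
definability problem. As `X` is nullary, it contains at most one tuple: weight `0` is attainable,
weight `2` is not. -/
theorem FPT_subset_W1 : FPT ⊆ W1 := by
  rintro Q ⟨c, f, e, hf, h⟩
  refine ⟨0, Fin.elim0, 0, 1, trivialQF, ?_⟩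
  obtain ⟨d, N, K, hd⟩ := c.exists_computes
  obtain ⟨ey, hey⟩ := exists_expr_const (inst pointStructure.enc 0)
  obtain ⟨en, hen⟩ := exists_expr_const (inst pointStructure.enc 2)
  obtain ⟨M, hM⟩ : ∃ M, M = K + 4 + ey.cost + en.cost + (inst pointStructure.enc 0).size +
    (inst pointStructure.enc 2).size := ⟨_, rfl⟩
  refine ⟨Prog.seq d (Prog.cond (Expr.var 0) (Prog.assign 0 ey) (Prog.assign 0 en)),
    fun k => f k + M, fun _ => 2, e, computable_add hf (Computable.const M), Computable.const 2,
    fun x k => ?_⟩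
  obtain ⟨σ, t, hr, ht, hiff⟩ := h x k trivial
  have hq := hd _ _ _ hr
  have hs : 1 ≤ (inst x k).size ^ e := Nat.one_le_pow _ _ (one_le_size_inst x k)
  have hMs : M * 1 ≤ M * (inst x k).size ^ e := Nat.mul_le_mul_left _ hs
  by_cases hx : (x, k) ∈ Q
  · obtain ⟨τ, u, hu, hle, ho⟩ := (hq.seq ((Computes.branchTrue (e := Expr.var 0)
      (d := Prog.assign 0 en) (fun τ hτ => by simpa [Expr.eval, hτ] using hiff.2 hx)
      (Computes.assign (x := σ 0) fun τ _ => hey τ)).mono (Nat.zero_le N) le_rfl)).runs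
    refine ⟨τ, u, _, 0, hu, ho, ?_, ?_, by simp, trivial, ⟨fun _ => ?_, fun _ => hx⟩⟩
    · simp only [Expr.cost] at hle
      simp only [add_mul]; omega
    · simp only [add_mul]; omega
    · exact ⟨pointStructure, rfl, ∅, rfl, fun v => rfl⟩
  · obtain ⟨τ, u, hu, hle, ho⟩ := (hq.seq ((Computes.branchFalse (e := Expr.var 0)
      (c := Prog.assign 0 ey) (fun τ hτ => by
        simpa [Expr.eval, hτ] using fun h0 => hx (hiff.1 h0))
      (Computes.assign (x := σ 0) fun τ _ => hen τ)).mono (Nat.zero_le N) le_rfl)).runs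
    refine ⟨τ, u, _, 2, hu, ho, ?_, ?_, le_rfl, trivial, ⟨fun h0 => absurd h0 hx, ?_⟩⟩
    · simp only [Expr.cost] at hle
      simp only [add_mul]; omega
    · simp only [add_mul]; omega
    · rintro ⟨A, -, S, hS, -⟩
      have : S.card ≤ 1 := Finset.card_le_one.2 fun a _ b _ => funext fun i => i.elim0
      simp only at hS
      omega


/-! ### Guessing a small solution of a family of local conditions -/

section Words
variable {β : Type}

/-- All lists of length `d` with entries in `l`. -/
def words (l : List β) : ℕ → List (List β)
  | 0 => [[]]
  | d + 1 => l.flatMap fun b => (words l d).map fun w => b :: w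

theorem mem_words {l : List β} {d : ℕ} {w : List β} :
    w ∈ words l d ↔ w.length = d ∧ ∀ b ∈ w, b ∈ l := by
  induction d generalizing w with
  | zero =>
    cases w <;> simp [words]
  | succ d ih =>
    cases w with
    | nil => simp [words]
    | cons b w => simp [words, ih]; tauto

theorem length_words (l : List β) (d : ℕ) : (words l d).length = l.length ^ d := by
  induction d with
  | zero => rfl
  | succ d ih => simp [words, List.length_flatMap, ih, pow_succ, mul_comm]

theorem nodup_words {l : List β} (hl : l.Nodup) (d : ℕ) : (words l d).Nodup := by
  induction d with
  | zero => simp [words]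
  | succ d ih =>
    refine List.nodup_flatMap.2 ⟨fun b _ => ih.map fun _ _ h => (List.cons.inj h).2, ?_⟩
    refine hl.imp fun {a b} hab => ?_
    simp only [Function.onFun, List.disjoint_left, List.mem_map]
    rintro _ ⟨w, _, rfl⟩ ⟨w', _, h⟩
    exact hab (List.cons.inj h).1.symm

end Words

section Search
variable {V X ω : Type} [DecidableEq X]

/-- A claim `(i, x)` says that the `i`-th element of the solution is `x`; the `0`-th element is
the dummy `none`. -/
abbrev Claim (X : Type) : Type := ℕ × Option X

/-- The local conditions: `ev P v` says that the set `P` satisfies the condition `v`; this depends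
only on the intersection of `P` with the elements `pick v w`, where `w` is in `atoms`. -/
structure LocalConditions (V X ω : Type) where
  vs : List V
  us : List X
  atoms : List ω
  pick : V → ω → X
  ev : List (Option X) → V → Bool

namespace LocalConditions
variable (L : LocalConditions V X ω)

/-- The first condition that fails for the first list of claims and is not affected by the
second list of claims. -/
def firstBad (st : List (Claim X) × List (Claim X)) : Option V :=
  L.vs.find? fun v => !L.ev (st.1.map fun c => c.2) v && !L.atoms.any fun w =>
    decide (some (L.pick v w) ∈ st.2.map fun c => c.2) &&
      !decide (some (L.pick v w) ∈ st.1.map fun c => c.2)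

/-- All ways to affect the first failing condition by one more claim. -/
def expand (k : ℕ) (st : List (Claim X) × List (Claim X)) :
    List (List (Claim X) × List (Claim X)) :=
  (L.firstBad st).elim [st] fun v => L.atoms.flatMap fun w => (List.range k).map fun i =>
    (st.1, st.2 ++ [(i + 1, some (L.pick v w))])

/-- The admissible claims. -/
def claims (k : ℕ) : List (Claim X) :=
  (0, none) :: L.us.flatMap fun u => (List.range k).map fun i => (i + 1, some u)

/-- The initial states of the search. -/
def initial (k : ℕ) : List (List (Claim X) × List (Claim X)) :=
  (words (L.claims k) (L.atoms.length + 1)).map fun w => (w, [])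

/-- One level of the search; it is cut off when more than `m` states arise. -/
def level (k m : ℕ) (S : List (List (Claim X) × List (Claim X))) :
    List (List (Claim X) × List (Claim X)) :=
  bif decide ((S.flatMap (L.expand k)).length ≤ m) then S.flatMap (L.expand k) else S

/-- The states after `k` levels of the search. -/
def states (k m : ℕ) : List (List (Claim X) × List (Claim X)) :=
  (List.range k).foldl (fun S _ => L.level k m S) (L.initial k)

/-- The two lists of claims can be true at the same time. -/
def agree (c c' : List (Claim X)) : Bool :=
  c.all fun p => c'.all fun q => decide (decide (p.1 = q.1) = decide (p.2 = q.2))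

/-- The successful states. -/
def nodes (k m : ℕ) : List (List (Claim X) × List (Claim X)) :=
  (L.states k m).filter fun st =>
    !(L.firstBad st).isSome && agree (st.1 ++ st.2) (st.1 ++ st.2)

/-- Adjacency of states. -/
def adj (st st' : List (Claim X) × List (Claim X)) : Bool :=
  !decide ((st.1.map fun c => c.1) = st'.1.map fun c => c.1) &&
    agree (st.1 ++ st.2) (st'.1 ++ st'.2)

/-- The edges between the successful states. -/
def edges (k m : ℕ) : List (ℕ × ℕ) :=
  (List.range (L.nodes k m).length).flatMap fun i =>
    ((List.range (L.nodes k m).length).filter fun j =>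
      adj ((L.nodes k m).getD i ([], [])) ((L.nodes k m).getD j ([], []))).map fun j => (i, j)

/-- The equivalence demands more than a well-defined assignment of elements to indices: different
indices must also carry different elements, so that a solution has exactly `k` elements. -/
theorem agree_iff {c c' : List (Claim X)} :
    agree c c' = true ↔ ∀ p ∈ c, ∀ q ∈ c', (p.1 = q.1 ↔ p.2 = q.2) := by
  simp [agree]

/-- The local conditions are really local. -/
structure Lawful : Prop where
  congr : ∀ P P' : List (Option X), ∀ v ∈ L.vs,
    (∀ w ∈ L.atoms, some (L.pick v w) ∈ P ↔ some (L.pick v w) ∈ P') → L.ev P v = L.ev P' v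
  pick_mem : ∀ v ∈ L.vs, ∀ w ∈ L.atoms, L.pick v w ∈ L.us

/-- A set of `k` elements satisfying all conditions exists. -/
def Solvable (k : ℕ) : Prop := ∃ S : Finset X, S.card = k ∧ (∀ x ∈ S, x ∈ L.us) ∧
  ∀ v ∈ L.vs, L.ev (S.toList.map some) v = true

variable {L}

theorem firstBad_eq_some {st : List (Claim X) × List (Claim X)} {v : V}
    (h : L.firstBad st = some v) : v ∈ L.vs ∧ L.ev (st.1.map fun c => c.2) v = false ∧
      ∀ w ∈ L.atoms, some (L.pick v w) ∈ st.2.map (fun c => c.2) →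
        some (L.pick v w) ∈ st.1.map fun c => c.2 := by
  have h1 := List.find?_some h
  refine ⟨List.mem_of_find?_eq_some h, ?_⟩
  simpa using h1

/-- In a finished state every condition failing for the first list is affected by a claim of the
second one. This is the property of a vertex that a clique of states will exploit. -/
theorem firstBad_eq_none {st : List (Claim X) × List (Claim X)}
    (h : L.firstBad st = none) {v : V} (hv : v ∈ L.vs)
    (he : L.ev (st.1.map fun c => c.2) v = false) :
    ∃ w ∈ L.atoms, some (L.pick v w) ∈ st.2.map (fun c => c.2) ∧
        some (L.pick v w) ∉ st.1.map fun c => c.2 := by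
  have h1 := List.find?_eq_none.1 h v hv
  simpa [he] using h1

/-- This bounds the branching of the search: an atom and one of `k` indices are chosen. The
additional one accounts for finished states, which are carried along unchanged. -/
theorem length_expand (k : ℕ) (st) :
    (L.expand k st).length ≤ L.atoms.length * k + 1 := by
  unfold expand
  cases L.firstBad st with
  | none => simp
  | some v => simp [List.length_flatMap]

theorem length_flatMap_expand (k : ℕ) (S : List (List (Claim X) × List (Claim X))) :
    (S.flatMap (L.expand k)).length ≤ S.length * (L.atoms.length * k + 1) := by
  induction S with
  | nil => simp
  | cons st S ih =>
    rw [List.flatMap_cons, List.length_append, List.length_cons, Nat.succ_mul]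
    have := length_expand (L := L) k st
    omega

/-- The search is not cut off if enough states are admitted. -/
theorem states_eq (k m : ℕ)
    (hm : (L.initial k).length * padding L.atoms.length k ≤ m) :
    L.states k m = (fun S => S.flatMap (L.expand k))^[k] (L.initial k) := by
  set g := fun S : List (List (Claim X) × List (Claim X)) => S.flatMap (L.expand k)
  have hlen : ∀ t, (g^[t] (L.initial k)).length ≤
      (L.initial k).length * (L.atoms.length * (k + 1) + 1) ^ t := by
    intro t
    induction t with
    | zero => simp
    | succ t ih =>
      rw [Function.iterate_succ_apply', pow_succ, ← mul_assoc]
      refine (length_flatMap_expand k _).trans (Nat.mul_le_mul ih ?_)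
      nlinarith [Nat.zero_le L.atoms.length]
  have key : ∀ t ≤ k, (List.range t).foldl (fun S _ => L.level k m S) (L.initial k) =
      g^[t] (L.initial k) := by
    intro t
    induction t with
    | zero => intro _; rfl
    | succ t ih =>
      intro ht
      rw [List.range_succ, List.foldl_append, ih (by omega), Function.iterate_succ_apply']
      simp only [List.foldl_cons, List.foldl_nil, level]
      have h1 := hlen (t + 1)
      rw [Function.iterate_succ_apply'] at h1
      have h2 : (L.initial k).length * (L.atoms.length * (k + 1) + 1) ^ (t + 1) ≤ m :=
        (Nat.mul_le_mul_left _ (Nat.pow_le_pow_right (by omega) ht)).trans hm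
      rw [decide_eq_true (h1.trans h2)]; rfl
  exact key k le_rfl

/-- Shape of the claims that occur in the search. -/
theorem states_shape (hL : L.Lawful) {k m : ℕ} {l : List ℕ} :
    ∀ st ∈ l.foldl (fun S _ => L.level k m S) (L.initial k),
      st.1 ∈ words (L.claims k) (L.atoms.length + 1) ∧ (∀ c ∈ st.2, c ∈ L.claims k) ∧
        st.2.length ≤ l.length := by
  induction l using List.reverseRecOn with
  | nil =>
    intro st hst
    simp only [List.foldl_nil, initial, List.mem_map] at hst
    obtain ⟨w, hw, rfl⟩ := hst
    exact ⟨hw, by simp, by simp⟩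
  | append_singleton l a ih =>
    intro st hst
    rw [List.foldl_append] at hst
    set S := l.foldl (fun S _ => L.level k m S) (L.initial k)
    change st ∈ L.level k m S at hst
    unfold level at hst
    have weaken : ∀ st ∈ S, st.1 ∈ words (L.claims k) (L.atoms.length + 1) ∧
        (∀ c ∈ st.2, c ∈ L.claims k) ∧ st.2.length ≤ (l ++ [a]).length := fun st hst => by
      obtain ⟨h1, h2, h3⟩ := ih st hst
      exact ⟨h1, h2, by simp; omega⟩
    cases hd : decide ((S.flatMap (L.expand k)).length ≤ m) with
    | false => rw [hd] at hst; exact weaken st hst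
    | true =>
      rw [hd] at hst
      obtain ⟨st', hst', hx⟩ := List.mem_flatMap.1 hst
      unfold expand at hx
      cases hb : L.firstBad st' with
      | none =>
        rw [hb] at hx
        obtain rfl := List.mem_singleton.1 hx
        exact weaken _ hst'
      | some v =>
        rw [hb] at hx
        simp only [Option.elim_some, List.mem_flatMap, List.mem_map, List.mem_range] at hx
        obtain ⟨w, hw, i, hi, rfl⟩ := hx
        obtain ⟨h1, h2, h3⟩ := ih st' hst'
        refine ⟨h1, fun c hc => ?_, by simp; omega⟩
        rcases List.mem_append.1 hc with hc | hc
        · exact h2 c hc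
        · obtain rfl := List.mem_singleton.1 hc
          refine List.mem_cons_of_mem _ (List.mem_flatMap.2 ⟨L.pick v w,
            hL.pick_mem v (firstBad_eq_some hb).1 w hw, List.mem_map.2 ⟨i, ?_, rfl⟩⟩)
          simpa using hi

theorem mem_claims {V X ω : Type} {L : LocalConditions V X ω} {k : ℕ}
    {c : Claim X} : c ∈ L.claims k ↔
    c = (0, none) ∨ ∃ i < k, ∃ u ∈ L.us, c = (i + 1, some u) := by
  simp only [claims, List.mem_cons, List.mem_flatMap, List.mem_map, List.mem_range]
  constructor
  · rintro (h | ⟨u, hu, i, hi, rfl⟩)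
    · exact .inl h
    · exact .inr ⟨i, hi, u, hu, rfl⟩
  · rintro (h | ⟨i, hi, u, hu, rfl⟩)
    · exact .inl h
    · exact .inr ⟨u, hu, i, hi, rfl⟩

/-- The search finds the states that describe a solution. -/
theorem exists_node_of_solution (hL : L.Lawful) {k m : ℕ}
    (hm : (L.initial k).length * padding L.atoms.length k ≤ m) {S : Finset X} (hS : S.card = k)
    (hus : ∀ x ∈ S, x ∈ L.us) (hev : ∀ v ∈ L.vs, L.ev (S.toList.map some) v = true)
    {y : ℕ → Option X} (h0 : y 0 = none) (hy : ∀ i < k, ∃ x ∈ S, y (i + 1) = some x)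
    (hinj : ∀ i ≤ k, ∀ j ≤ k, y i = y j → i = j) (hsurj : ∀ x ∈ S, ∃ i < k, y (i + 1) = some x)
    {I : List ℕ} (hI : I ∈ words (List.range (k + 1)) (L.atoms.length + 1)) :
    ∃ st ∈ L.nodes k m, (st.1.map fun c => c.1) = I ∧
      ∀ c ∈ st.1 ++ st.2, c.1 ≤ k ∧ c.2 = y c.1 := by
  obtain ⟨hI1, hI2⟩ := mem_words.1 hI
  have hIk : ∀ i ∈ I, i ≤ k := fun i hi => by have := hI2 i hi; simp at this; omega
  set C := I.map fun i => (i, y i) with hC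
  have hyS : ∀ i ≤ k, ∀ x, y i = some x → x ∈ S := by
    rintro (_ | i) hi x hx
    · simp [h0] at hx
    · obtain ⟨x', hx', h⟩ := hy i (by omega)
      rw [hx] at h
      rwa [Option.some.inj h]
  -- The elements claimed in `C` belong to `S`. If a condition holds for `S` and fails for `C`,
  -- locality gives an atom whose element is in `S` but not in `C`; since `firstBad` skips affected
  -- conditions, this element is not claimed in `D` either.
  have progress : ∀ (D : List (Claim X)) (v : V), L.firstBad (C, D) = some v →
      ∃ w ∈ L.atoms, L.pick v w ∈ S ∧ some (L.pick v w) ∉ C.map (fun c => c.2) ∧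
        some (L.pick v w) ∉ D.map fun c => c.2 := by
    intro D v hv
    obtain ⟨hvs, he, hD⟩ := firstBad_eq_some hv
    by_contra hcon
    push Not at hcon
    have : L.ev (C.map fun c => c.2) v = L.ev (S.toList.map some) v := by
      refine hL.congr _ _ v hvs fun w hw => ⟨fun h => ?_, fun h => ?_⟩
      · simp only [hC, List.map_map, List.mem_map, Function.comp] at h
        obtain ⟨i, hi, h⟩ := h
        simpa using hyS i (hIk i hi) _ h
      · simp only [List.mem_map, Finset.mem_toList] at h
        obtain ⟨x, hx, h⟩ := h
        rw [← Option.some.inj h]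
        by_contra h'
        rw [Option.some.inj h] at hx h'
        exact h' (hD w hw (hcon w hw hx h'))
    rw [hev v hvs] at this
    simp only [this] at he
    exact absurd he (by simp)
  -- Following the branch that always names the true index and element, `t` levels lead to a
  -- finished state or to `t` different members of `S`. As `S` has `k` members, a failing condition
  -- after `k` levels would yield one member too many.
  have search : ∀ t ≤ k, ∃ D, (C, D) ∈ (fun S => S.flatMap (L.expand k))^[t] (L.initial k) ∧
      (∀ c ∈ D, c.1 ≤ k ∧ c.2 = y c.1) ∧
      ∃ l : List X, D.map (fun c => c.2) = l.map some ∧ l.Nodup ∧ (∀ x ∈ l, x ∈ S) ∧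
        (L.firstBad (C, D) = none ∨ l.length = t) := by
    intro t
    induction t with
    | zero =>
      intro _
      refine ⟨[], List.mem_map.2 ⟨C, mem_words.2 ⟨by simpa [hC] using hI1, fun c hc => ?_⟩, rfl⟩,
        by simp, [], by simp⟩
      obtain ⟨i, hi, rfl⟩ := List.mem_map.1 hc
      rw [mem_claims]
      have hik := hIk i hi
      rcases i with _ | i
      · exact .inl (by rw [h0])
      · obtain ⟨x, hx, h⟩ := hy i (by omega)
        exact .inr ⟨i, by omega, x, hus x hx, by rw [h]⟩
    | succ t ih =>
      intro ht
      obtain ⟨D, h1, h2, l, h3, h4, h5, h6⟩ := ih (by omega)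
      cases hb : L.firstBad (C, D) with
      | none =>
        refine ⟨D, ?_, h2, l, h3, h4, h5, .inl hb⟩
        rw [Function.iterate_succ_apply']
        exact List.mem_flatMap.2 ⟨_, h1, by simp [expand, hb]⟩
      | some v =>
        obtain ⟨w, hw, hwS, hwC, hwD⟩ := progress D v hb
        obtain ⟨i, hi, hiy⟩ := hsurj _ hwS
        refine ⟨D ++ [(i + 1, some (L.pick v w))], ?_, ?_, l ++ [L.pick v w], ?_, ?_, ?_, .inr ?_⟩
        · rw [Function.iterate_succ_apply']
          refine List.mem_flatMap.2 ⟨_, h1, ?_⟩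
          simp only [expand, hb, Option.elim_some, List.mem_flatMap, List.mem_map, List.mem_range]
          exact ⟨w, hw, i, hi, rfl⟩
        · intro c hc
          rcases List.mem_append.1 hc with hc | hc
          · exact h2 c hc
          · obtain rfl := List.mem_singleton.1 hc
            exact ⟨hi, hiy.symm⟩
        · simp [h3]
        · refine List.nodup_append.2 ⟨h4, by simp, ?_⟩
          rintro x hx _ hx' rfl
          rw [List.mem_singleton.1 hx'] at hx
          exact hwD (by rw [h3]; exact List.mem_map.2 ⟨_, hx, rfl⟩)
        · intro x hx
          rcases List.mem_append.1 hx with hx | hx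
          · exact h5 x hx
          · rwa [List.mem_singleton.1 hx]
        · rcases h6 with h6 | h6
          · rw [hb] at h6; simp at h6
          · simp [h6]
  obtain ⟨D, h1, h2, l, h3, h4, h5, h6⟩ := search k le_rfl
  have hall : ∀ c ∈ C ++ D, c.1 ≤ k ∧ c.2 = y c.1 := fun c hc => by
    rcases List.mem_append.1 hc with hc | hc
    · obtain ⟨i, hi, rfl⟩ := List.mem_map.1 hc
      exact ⟨hIk i hi, rfl⟩
    · exact h2 c hc
  refine ⟨(C, D), ?_, by simp [hC, Function.comp_def], hall⟩
  rw [nodes, states_eq k m hm]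
  refine List.mem_filter.2 ⟨h1, ?_⟩
  rw [Bool.and_eq_true]
  refine ⟨?_, agree_iff.2 fun p hp q hq => ?_⟩
  · cases hb : L.firstBad (C, D) with
    | none => rfl
    | some v =>
      exfalso
      obtain ⟨w, hw, hwS, hwC, hwD⟩ := progress D v hb
      have hl : l.length = k := by
        rcases h6 with h6 | h6
        · rw [hb] at h6; simp at h6
        · exact h6
      have hnd : (L.pick v w :: l).Nodup := List.nodup_cons.2 ⟨fun hx =>
        hwD (by rw [h3]; exact List.mem_map.2 ⟨_, hx, rfl⟩), h4⟩
      have : (L.pick v w :: l).length ≤ S.card := by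
        rw [← List.toFinset_card_of_nodup hnd]
        refine Finset.card_le_card fun x hx => ?_
        rcases List.mem_cons.1 (List.mem_toFinset.1 hx) with rfl | hx
        · exact hwS
        · exact h5 x hx
      simp at this; omega
  · rw [(hall p hp).2, (hall q hq).2]
    exact ⟨fun h => by rw [h], hinj _ (hall p hp).1 _ (hall q hq).1⟩

end LocalConditions
end Search

/-- The graph with vertices `0, …, n - 1` and edges `L` has a clique on `r` vertices. -/
def HasClique (n : ℕ) (L : List (ℕ × ℕ)) (r : ℕ) : Prop :=
  ∃ K : Finset ℕ, K.card = r ∧ (∀ u ∈ K, u < n) ∧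
    ∀ u ∈ K, ∀ v ∈ K, u ≠ v → (u, v) ∈ L ∨ (v, u) ∈ L

/-! ### Solutions and cliques of states -/

namespace LocalConditions
variable {V X ω : Type} [DecidableEq X] {L : LocalConditions V X ω}

theorem mem_edges {k m i j : ℕ} : (i, j) ∈ L.edges k m ↔
    ∃ (hi : i < (L.nodes k m).length) (hj : j < (L.nodes k m).length),
      adj (L.nodes k m)[i] (L.nodes k m)[j] = true := by
  simp only [edges, List.mem_flatMap, List.mem_map, List.mem_filter, List.mem_range, Prod.mk.injEq]
  constructor
  · rintro ⟨i', hi, j', ⟨hj, h⟩, rfl, rfl⟩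
    refine ⟨hi, hj, ?_⟩
    simpa [List.getD_eq_getElem?_getD, hi, hj] using h
  · rintro ⟨hi, hj, h⟩
    exact ⟨i, hi, j, ⟨hj, by simpa [List.getD_eq_getElem?_getD, hi, hj] using h⟩, rfl, rfl⟩

theorem adj_symm {st st' : List (Claim X) × List (Claim X)} (h : adj st st' = true) :
    adj st' st = true := by
  simp only [adj, Bool.and_eq_true, Bool.not_eq_true', decide_eq_false_iff_not, agree_iff] at h ⊢
  exact ⟨fun h' => h.1 h'.symm, fun p hp q hq => by
    have := h.2 q hq p hp
    rw [eq_comm, this, eq_comm]⟩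

/-- A solution, enumerated as `y 1, …, y k` with the dummy `y 0`, yields a true state for each of
the `(k + 1) ^ d` words of indices, and true states agree. Conversely, the states of such a clique
have pairwise different words, so every word occurs, and agreement makes their claims into one
injective enumeration of a set `S`. Given a condition, some word lists exactly those members of `S`
that the condition reads; the state with this word witnesses that the condition holds for `S`. -/
theorem solvable_iff (hL : L.Lawful) {k m : ℕ}
    (hm : (L.initial k).length * padding L.atoms.length k ≤ m) :
    L.Solvable k ↔
      HasClique (L.nodes k m).length (L.edges k m) ((k + 1) ^ (L.atoms.length + 1)) := by
  classical
  set d := L.atoms.length + 1 with hd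
  set W := (words (List.range (k + 1)) d).toFinset with hW
  have hWcard : W.card = (k + 1) ^ d := by
    rw [hW, List.toFinset_card_of_nodup (nodup_words List.nodup_range d), length_words,
      List.length_range]
  constructor
  · rintro ⟨S, hS, hus, hev⟩
    let e : Fin k ≃ S := (finCongr hS.symm).trans S.equivFin.symm
    let y : ℕ → Option X := fun i =>
      if h : 0 < i ∧ i - 1 < k then some (e ⟨i - 1, h.2⟩).1 else none
    have h0 : y 0 = none := by simp [y]
    have hy1 : ∀ (i : ℕ) (hi : i < k), y (i + 1) = some (e ⟨i, hi⟩).1 := fun i hi => by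
      simp [y, hi]
    have hinj : ∀ i ≤ k, ∀ j ≤ k, y i = y j → i = j := by
      rintro (_ | i) hi (_ | j) hj h
      · rfl
      · rw [h0, hy1 j (by omega)] at h; simp at h
      · rw [h0, hy1 i (by omega)] at h; simp at h
      · rw [hy1 i (by omega), hy1 j (by omega)] at h
        have := e.injective (Subtype.ext (Option.some.inj h))
        simpa using this
    have key : ∀ I ∈ W, ∃ i, ∃ hi : i < (L.nodes k m).length,
        ((L.nodes k m)[i].1.map fun c => c.1) = I ∧
        ∀ c ∈ (L.nodes k m)[i].1 ++ (L.nodes k m)[i].2, c.1 ≤ k ∧ c.2 = y c.1 := by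
      intro I hI
      obtain ⟨st, hst, h1, h2⟩ := exists_node_of_solution hL hm hS hus hev h0
        (fun i hi => ⟨_, (e ⟨i, hi⟩).2, hy1 i hi⟩) hinj
        (fun x hx => ⟨(e.symm ⟨x, hx⟩).1, (e.symm ⟨x, hx⟩).2, by
          rw [hy1 _ (e.symm ⟨x, hx⟩).2]; simp⟩)
        (List.mem_toFinset.1 hI)
      obtain ⟨i, hi, rfl⟩ := List.getElem_of_mem hst
      exact ⟨i, hi, h1, h2⟩
    choose! φ hφ1 hφ2 hφ3 using key
    refine ⟨W.image φ, ?_, ?_, ?_⟩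
    · rw [Finset.card_image_of_injOn, hWcard]
      intro I hI J hJ h
      have h1 := hφ2 I hI
      have h2 := hφ2 J hJ
      simp only [h] at h1
      exact h1.symm.trans h2
    · simp only [Finset.mem_image]
      rintro _ ⟨I, hI, rfl⟩
      exact hφ1 I hI
    · simp only [Finset.mem_image]
      rintro _ ⟨I, hI, rfl⟩ _ ⟨J, hJ, rfl⟩ hne
      refine .inl (mem_edges.2 ⟨hφ1 I hI, hφ1 J hJ, ?_⟩)
      simp only [adj, Bool.and_eq_true, Bool.not_eq_true', decide_eq_false_iff_not, agree_iff]
      refine ⟨fun h => hne ?_, fun p hp q hq => ?_⟩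
      · rw [hφ2 I hI, hφ2 J hJ] at h
        rw [h]
      · have hp' := hφ3 I hI p hp
        have hq' := hφ3 J hJ q hq
        rw [hp'.2, hq'.2]
        exact ⟨fun h => by rw [h], hinj _ hp'.1 _ hq'.1⟩
  · rintro ⟨K, hK, hKn, hKadj⟩
    set N : ℕ → List (Claim X) × List (Claim X) := fun i => (L.nodes k m).getD i ([], []) with hN
    have hNget : ∀ i (hi : i < (L.nodes k m).length), (L.nodes k m)[i] = N i := fun i hi => by
      simp [hN, List.getD_eq_getElem?_getD, hi]
    have hNmem : ∀ i ∈ K, N i ∈ L.nodes k m := fun i hi => by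
      rw [← hNget i (hKn i hi)]; exact List.getElem_mem _
    have hadj : ∀ i ∈ K, ∀ j ∈ K, i ≠ j → adj (N i) (N j) = true := fun i hi j hj hij => by
      rcases hKadj i hi j hj hij with h | h
      · obtain ⟨_, _, h⟩ := mem_edges.1 h
        rwa [hNget, hNget] at h
      · obtain ⟨_, _, h⟩ := mem_edges.1 h
        rw [hNget, hNget] at h
        exact adj_symm h
    have hagree : ∀ i ∈ K, ∀ j ∈ K, ∀ p ∈ (N i).1 ++ (N i).2, ∀ q ∈ (N j).1 ++ (N j).2,
        (p.1 = q.1 ↔ p.2 = q.2) := fun i hi j hj => by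
      by_cases hij : i = j
      · subst hij
        have := (List.mem_filter.1 (hNmem i hi)).2
        rw [Bool.and_eq_true] at this
        exact agree_iff.1 this.2
      · have := hadj i hi j hj hij
        rw [adj, Bool.and_eq_true] at this
        exact agree_iff.1 this.2
    have hbad : ∀ i ∈ K, L.firstBad (N i) = none := fun i hi => by
      have := (List.mem_filter.1 (hNmem i hi)).2
      rw [Bool.and_eq_true] at this
      cases h : L.firstBad (N i) with
      | none => rfl
      | some v => rw [h] at this; simp at this
    have hshape : ∀ i ∈ K, (N i).1.length = d ∧ ∀ c ∈ (N i).1 ++ (N i).2, c ∈ L.claims k :=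
      fun i hi => by
        obtain ⟨h1, h2, -⟩ := states_shape hL _ (List.mem_filter.1 (hNmem i hi)).1
        obtain ⟨h3, h4⟩ := mem_words.1 h1
        refine ⟨h3, fun c hc => ?_⟩
        rcases List.mem_append.1 hc with hc | hc
        · exact h4 c hc
        · exact h2 c hc
    -- Adjacent states have different index words. Hence the clique has as many words as there are
    -- words at all, and each of them occurs.
    have himg : K.image (fun i => (N i).1.map fun c => c.1) = W := by
      refine Finset.eq_of_subset_of_card_le ?_ ?_
      · intro I hI
        obtain ⟨i, hi, rfl⟩ := Finset.mem_image.1 hI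
        refine List.mem_toFinset.2 (mem_words.2 ⟨by simpa using (hshape i hi).1, fun b hb => ?_⟩)
        obtain ⟨c, hc, rfl⟩ := List.mem_map.1 hb
        have := (hshape i hi).2 c (List.mem_append_left _ hc)
        rw [mem_claims] at this
        rcases this with rfl | ⟨i, hi, u, _, rfl⟩ <;> simp; omega
      · rw [hWcard, Finset.card_image_of_injOn, hK]
        intro i hi j hj h
        by_contra hij
        have := hadj i hi j hj hij
        rw [adj, Bool.and_eq_true, Bool.not_eq_true', decide_eq_false_iff_not] at this
        exact this.1 h
    have hword : ∀ I, I.length = d → (∀ i ∈ I, i ≤ k) →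
        ∃ j ∈ K, ((N j).1.map fun c => c.1) = I := fun I h1 h2 => by
      have : I ∈ W := List.mem_toFinset.2 (mem_words.2 ⟨h1, fun b hb => by
        have := h2 b hb; simp; omega⟩)
      rw [← himg] at this
      obtain ⟨j, hj, h⟩ := Finset.mem_image.1 this
      exact ⟨j, hj, h⟩
    -- The constant word at `i` provides a claim about `i`. This requires a word of positive length,
    -- which the additional position in `d` guarantees even if there are no atoms.
    have hyex : ∀ i, ∃ x, i ≤ k → ∃ j ∈ K, (i, x) ∈ (N j).1 ++ (N j).2 := fun i => by
      by_cases hi : i ≤ k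
      · obtain ⟨j, hj, h⟩ := hword (List.replicate d i) (by simp) (fun b hb => by
          rw [List.eq_of_mem_replicate hb]; exact hi)
        have : i ∈ (N j).1.map fun c => c.1 := by rw [h]; simp [hd]
        obtain ⟨c, hc, rfl⟩ := List.mem_map.1 this
        exact ⟨c.2, fun _ => ⟨j, hj, List.mem_append_left _ hc⟩⟩
      · exact ⟨none, fun h => absurd h hi⟩
    choose y hy using hyex
    have hclaim : ∀ j ∈ K, ∀ c ∈ (N j).1 ++ (N j).2, c.1 ≤ k ∧ c.2 = y c.1 := fun j hj c hc => by
      have hck : c.1 ≤ k := by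
        have := (hshape j hj).2 c hc
        rw [mem_claims] at this
        rcases this with rfl | ⟨i, hi, u, _, rfl⟩ <;> simp; omega
      obtain ⟨j', hj', h⟩ := hy c.1 hck
      exact ⟨hck, (hagree j hj j' hj' c hc _ h).1 rfl⟩
    have hyinj : ∀ i ≤ k, ∀ j ≤ k, y i = y j → i = j := fun i hi j hj h => by
      obtain ⟨a, ha, h1⟩ := hy i hi
      obtain ⟨b, hb, h2⟩ := hy j hj
      exact (hagree a ha b hb _ h1 _ h2).2 h
    have hy0 : y 0 = none := by
      obtain ⟨a, ha, h1⟩ := hy 0 (Nat.zero_le k)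
      have := (hshape a ha).2 _ h1
      rw [mem_claims] at this
      simpa using this
    have hysome : ∀ i < k, ∃ x, y (i + 1) = some x ∧ x ∈ L.us := fun i hi => by
      obtain ⟨a, ha, h1⟩ := hy (i + 1) hi
      have := (hshape a ha).2 _ h1
      rw [mem_claims] at this
      rcases this with h | ⟨j, hj, u, hu, h⟩
      · simp at h
      · simp only [Prod.mk.injEq] at h
        exact ⟨u, h.2, hu⟩
    choose u hu using hysome
    set S : Finset X := Finset.univ.image fun i : Fin k => u i i.2 with hS
    have hyS : ∀ i ≤ k, ∀ x, y i = some x → x ∈ S := by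
      rintro (_ | i) hi x hx
      · rw [hy0] at hx; simp at hx
      · rw [(hu i hi).1] at hx
        exact Finset.mem_image.2 ⟨⟨i, hi⟩, Finset.mem_univ _, Option.some.inj hx⟩
    have hSy : ∀ x ∈ S, ∃ i < k, y (i + 1) = some x := fun x hx => by
      obtain ⟨i, -, rfl⟩ := Finset.mem_image.1 hx
      exact ⟨i, i.2, (hu i i.2).1⟩
    refine ⟨S, ?_, fun x hx => ?_, fun v hv => ?_⟩
    · rw [hS, Finset.card_image_of_injective, Finset.card_univ, Fintype.card_fin]
      intro i j h
      have := hyinj (i + 1) i.2 (j + 1) j.2 (by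
        rw [(hu i i.2).1, (hu j j.2).1]; exact congrArg some h)
      exact Fin.ext (by omega)
    · obtain ⟨i, -, rfl⟩ := Finset.mem_image.1 hx
      exact (hu i i.2).2
    · by_contra hev
      rw [Bool.not_eq_true] at hev
      -- The index of the element read through `w` if that element is in `S`, and the dummy index
      -- `0` otherwise.
      let φ : ω → ℕ := fun w =>
        if h : ∃ i < k, y (i + 1) = some (L.pick v w) then h.choose + 1 else 0
      obtain ⟨j, hj, hI⟩ := hword (L.atoms.map φ ++ [0]) (by simp [hd]) (fun b hb => by
        rcases List.mem_append.1 hb with hb | hb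
        · obtain ⟨w, hw, rfl⟩ := List.mem_map.1 hb
          simp only [φ]
          split_ifs with h
          · exact h.choose_spec.1
          · exact Nat.zero_le _
        · rw [List.mem_singleton.1 hb]; exact Nat.zero_le _)
      have hP : (N j).1.map (fun c => c.2) = (L.atoms.map φ ++ [0]).map y := by
        rw [← hI, List.map_map]
        exact List.map_congr_left fun c hc => (hclaim j hj c (List.mem_append_left _ hc)).2
      have hSP : ∀ w ∈ L.atoms, L.pick v w ∈ S →
          some (L.pick v w) ∈ (N j).1.map fun c => c.2 := fun w hw hwS => by
        have h := hSy _ hwS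
        rw [hP]
        refine List.mem_map.2 ⟨φ w, List.mem_append_left _ (List.mem_map.2 ⟨w, hw, rfl⟩), ?_⟩
        simp only [φ, dif_pos h]
        exact h.choose_spec.2
      have hPS : ∀ w, some (L.pick v w) ∈ ((N j).1 ++ (N j).2).map (fun c => c.2) →
          L.pick v w ∈ S := fun w hw => by
        obtain ⟨c, hc, h⟩ := List.mem_map.1 hw
        have := hclaim j hj c hc
        rw [this.2] at h
        exact hyS _ this.1 _ h
      -- On the elements read by `v` the first list of this state and `S` coincide, so `v` fails for
      -- the first list too. The state is finished; hence a claim of its second list names an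
      -- element read by `v` and missing from the first list. But claims are true, so this element
      -- is in `S` and therefore in the first list.
      have heq : L.ev ((N j).1.map fun c => c.2) v = L.ev (S.toList.map some) v := by
        refine hL.congr _ _ v hv fun w hw => ⟨fun h => ?_, fun h => ?_⟩
        · refine List.mem_map.2 ⟨_, Finset.mem_toList.2 (hPS w ?_), rfl⟩
          rw [List.map_append]; exact List.mem_append_left _ h
        · obtain ⟨x, hx, h⟩ := List.mem_map.1 h
          rw [Finset.mem_toList, Option.some.inj h] at hx
          exact hSP w hw hx
      obtain ⟨w, hw, hwH, hwP⟩ := firstBad_eq_none (hbad j hj) hv (heq.trans hev)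
      refine hwP (hSP w hw (hPS w ?_))
      rw [List.map_append]; exact List.mem_append_right _ hwH

end LocalConditions


/-! ### The clique problem on lists of numbers -/

theorem enc_graph (n : ℕ) (L : List (ℕ × ℕ)) : enc (n, L) = Data.cons (Data.num n)
    (Data.ofList (L.map fun e => Data.cons (Data.num e.1) (Data.num e.2))) := rfl

/-- Numbers with explicit bounds replace elements of `Fin n`, whose type depends on the input;
polynomial-time functions act on the former. -/
theorem mem_clique {x : Data} {r : ℕ} : (x, r) ∈ clique ↔ ∃ (n : ℕ) (L : List (ℕ × ℕ)),
    x = enc (n, L) ∧ (∀ e ∈ L, e.1 < n ∧ e.2 < n) ∧ HasClique n L r := by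
  constructor
  · rintro ⟨n, L, hx, K, hK⟩
    refine ⟨n, L.map fun e => (e.1.1, e.2.1), ?_, ?_, K.map Fin.valEmbedding, ?_, ?_, ?_⟩
    · rw [enc_graph, List.map_map]; exact hx
    · intro e he
      obtain ⟨e, -, rfl⟩ := List.mem_map.1 he
      exact ⟨e.1.2, e.2.2⟩
    · rw [Finset.card_map]; exact hK.card_eq
    · intro u hu
      obtain ⟨u, -, rfl⟩ := Finset.mem_map.1 hu
      exact u.2
    · intro u hu v hv huv
      obtain ⟨u, hu', rfl⟩ := Finset.mem_map.1 hu
      obtain ⟨v, hv', rfl⟩ := Finset.mem_map.1 hv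
      have := hK.isClique (Finset.mem_coe.2 hu') (Finset.mem_coe.2 hv')
        (fun h => huv (congrArg _ h))
      rw [SimpleGraph.fromRel_adj] at this
      rcases this.2 with h | h
      · exact .inl (List.mem_map.2 ⟨_, h, rfl⟩)
      · exact .inr (List.mem_map.2 ⟨_, h, rfl⟩)
  · rintro ⟨n, L, rfl, hL, K, hK, hKn, hadj⟩
    refine ⟨n, L.pmap (fun e he => (⟨e.1, he.1⟩, ⟨e.2, he.2⟩)) hL, ?_, K.attachFin hKn, ?_⟩
    · rw [List.map_pmap]
      simp only [List.pmap_eq_map]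
      exact enc_graph n L
    · refine ⟨fun u hu v hv huv => ?_, by rw [Finset.card_attachFin]; exact hK⟩
      rw [SimpleGraph.fromRel_adj]
      refine ⟨huv, ?_⟩
      rw [Finset.mem_coe, Finset.mem_attachFin] at hu hv
      rcases hadj u hu v hv (fun h => huv (Fin.ext h)) with h | h
      · exact .inl (List.mem_pmap.2 ⟨_, h, rfl⟩)
      · exact .inr (List.mem_pmap.2 ⟨_, h, rfl⟩)

theorem clique_enc {n r : ℕ} {L : List (ℕ × ℕ)} (hL : ∀ e ∈ L, e.1 < n ∧ e.2 < n) :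
    (enc (n, L), r) ∈ clique ↔ HasClique n L r := by
  rw [mem_clique]
  constructor
  · rintro ⟨n', L', h, -, h'⟩
    obtain ⟨rfl, rfl⟩ := Prod.mk.inj (Enc.inj h)
    exact h'
  · exact fun h => ⟨n, L, rfl, hL, h⟩

/-! ### The search in polynomial time -/

section
variable {α β : Type} [Enc α] [Enc β]

@[fun_prop]
theorem PT.words {f : α → List β} (hf : PT f) (d : ℕ) : PT (fun a => words (f a) d) := by
  induction d with
  | zero => simp only [DirectedFPT.words]; fun_prop
  | succ d ih =>
    simp only [DirectedFPT.words]
    have : PT (fun p : α × β => (DirectedFPT.words (f p.1) d).map fun w => p.2 :: w) := by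
      refine PT.map (f := fun p : α × β => DirectedFPT.words (f p.1) d)
        (PT.comp (g := fun a => DirectedFPT.words (f a) d) ih PT.fst) (by fun_prop)
    exact PT.flatMap hf this

end

/-- The tuple of the values of the variables in `w` under the assignment `v`. -/
def pick (v w : List ℕ) : List ℕ := w.map fun i => v.getD i 0

namespace QFFormula
variable {m : ℕ} {ar : Fin m → ℕ} {s l : ℕ}

/-- The tuples of variables to which `X` is applied. -/
def atoms : QFFormula ar s l → List (List ℕ)
  | eq _ _ => []
  | rel _ _ => []
  | relX w => [List.ofFn fun j => (w j : ℕ)]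
  | neg φ => φ.atoms
  | conj φ ψ => φ.atoms ++ ψ.atoms

/-- The truth value of the formula for a list of relations `R`, a set `P` of tuples in the place
of `X` and an assignment `v`. -/
def ev (R : List (List (List ℕ))) (P : List (Option (List ℕ))) (v : List ℕ) :
    QFFormula ar s l → Bool
  | eq i j => decide (v.getD i 0 = v.getD j 0)
  | rel i w => decide (pick v (List.ofFn fun j => (w j : ℕ)) ∈ R.getD i [])
  | relX w => decide (some (pick v (List.ofFn fun j => (w j : ℕ))) ∈ P)
  | neg φ => !φ.ev R P v
  | conj φ ψ => φ.ev R P v && ψ.ev R P v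

/-- The local conditions which express the formula. -/
def conditions (ψ : QFFormula ar s l) (n : ℕ) (R : List (List (List ℕ))) :
    LocalConditions (List ℕ) (List ℕ) (List ℕ) where
  vs := words (List.range n) l
  us := words (List.range n) s
  atoms := ψ.atoms
  pick := pick
  ev := fun P v => ψ.ev R P v

/-- The set `P` enters through the atoms in `X` only. This is the locality on which the search is
built. -/
theorem ev_congr {R : List (List (List ℕ))} {P P' : List (Option (List ℕ))} {v : List ℕ} :
    ∀ {ψ : QFFormula ar s l}, (∀ w ∈ ψ.atoms, some (pick v w) ∈ P ↔ some (pick v w) ∈ P') →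
      ψ.ev R P v = ψ.ev R P' v
  | eq _ _, _ => rfl
  | rel _ _, _ => rfl
  | relX _, h => by simp only [ev, h _ (List.mem_singleton_self _)]
  | neg φ, h => by simp only [ev, ev_congr (ψ := φ) h]
  | conj φ ψ, h => by
      simp only [ev, ev_congr (ψ := φ) fun w hw => h w (List.mem_append_left _ hw),
        ev_congr (ψ := ψ) fun w hw => h w (List.mem_append_right _ hw)]

theorem mem_atoms : ∀ {ψ : QFFormula ar s l} {w : List ℕ}, w ∈ ψ.atoms →
    w.length = s ∧ ∀ i ∈ w, i < l
  | eq _ _, w, h => by simp [atoms] at h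
  | rel _ _, w, h => by simp [atoms] at h
  | relX u, w, h => by
      obtain rfl := List.mem_singleton.1 h
      refine ⟨by simp, fun i hi => ?_⟩
      obtain ⟨j, rfl⟩ := (List.mem_ofFn' _ _).1 hi
      exact (u j).2
  | neg φ, w, h => mem_atoms (ψ := φ) h
  | conj φ ψ, w, h => (List.mem_append.1 h).elim mem_atoms mem_atoms

theorem conditions_lawful (ψ : QFFormula ar s l) (n : ℕ) (R : List (List (List ℕ))) :
    (ψ.conditions n R).Lawful where
  congr _ _ _ _ h := ev_congr h
  pick_mem v hv w hw := by
    obtain ⟨h1, h2⟩ := mem_words.1 hv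
    obtain ⟨h3, h4⟩ := mem_atoms hw
    refine mem_words.2 ⟨by simpa [conditions, pick] using h3, fun b hb => ?_⟩
    simp only [conditions, pick, List.mem_map] at hb
    obtain ⟨i, hi, rfl⟩ := hb
    have hil : i < v.length := by rw [h1]; exact h4 i hi
    rw [List.getD_eq_getElem _ _ hil]
    exact h2 _ (List.getElem_mem hil)

/-! ### Running time of the search -/

section PolyTime
variable {α : Type} [Enc α] {nf : α → ℕ} {Rf : α → List (List (List ℕ))} {kf mf : α → ℕ}
  {cf cf' : α → List (Claim (List ℕ))}
  {sf : α → List (Claim (List ℕ)) × List (Claim (List ℕ))}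

@[fun_prop]
theorem PT_pick {f g : α → List ℕ} (hf : PT f) (hg : PT g) : PT (fun a => pick (f a) (g a)) := by
  unfold pick; fun_prop

@[fun_prop]
theorem PT_ev {P : α → List (Option (List ℕ))} {v : α → List ℕ} (hR : PT Rf) (hP : PT P)
    (hv : PT v) (ψ : QFFormula ar s l) : PT (fun a => ψ.ev (Rf a) (P a) (v a)) := by
  induction ψ with
  | eq i j => simp only [ev]; fun_prop
  | rel i w => simp only [ev]; fun_prop
  | relX w => simp only [ev]; fun_prop
  | neg φ ih => simp only [ev]; fun_prop
  | conj φ ψ ih ih' => simp only [ev]; fun_prop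

variable (ψ : QFFormula ar s l)

theorem PT_firstBad (hn : PT nf) (hR : PT Rf) (hs : PT sf) :
    PT (fun a => (ψ.conditions (nf a) (Rf a)).firstBad (sf a)) := by
  have ha := PT.const (α := α) ψ.atoms
  unfold LocalConditions.firstBad conditions
  dsimp only
  generalize ψ.atoms = A at ha ⊢
  fun_prop

theorem PT_expand (hn : PT nf) (hR : PT Rf) (hk : PT kf) (hs : PT sf) :
    PT (fun a => (ψ.conditions (nf a) (Rf a)).expand (kf a) (sf a)) := by
  have h1 := PT_firstBad ψ hn hR hs
  unfold LocalConditions.expand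
  refine PT.option_elim h1 (by fun_prop) ?_
  unfold conditions
  dsimp only
  fun_prop

theorem PT_initial (hn : PT nf) (hk : PT kf) :
    PT (fun a => (ψ.conditions (nf a) (Rf a)).initial (kf a)) := by
  unfold LocalConditions.initial LocalConditions.claims conditions
  dsimp only
  fun_prop

theorem PT_agree (hc : PT cf) (hc' : PT cf') :
    PT (fun a => LocalConditions.agree (cf a) (cf' a)) := by
  unfold LocalConditions.agree
  fun_prop

theorem PT_level (hn : PT nf) (hR : PT Rf) (hk : PT kf) (hm : PT mf)
    {Sf : α → List (List (Claim (List ℕ)) × List (Claim (List ℕ)))} (hs : PT Sf) :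
    PT (fun a => (ψ.conditions (nf a) (Rf a)).level (kf a) (mf a) (Sf a)) := by
  have : PT (fun a => (Sf a).flatMap ((ψ.conditions (nf a) (Rf a)).expand (kf a))) := by
    refine PT.flatMap hs ?_
    exact PT_expand ψ (hn.comp PT.fst) (hR.comp PT.fst) (hk.comp PT.fst) PT.snd
  unfold LocalConditions.level
  fun_prop

/-- The cut-off keeps the number of states polynomial in `m` whatever the inputs are. Each state is
small as well: its claims come from one fixed list, and its second part gains at most one claim per
level. -/
theorem PT_states (hn : PT nf) (hR : PT Rf) (hk : PT kf) (hm : PT mf) :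
    PT (fun a => (ψ.conditions (nf a) (Rf a)).states (kf a) (mf a)) := by
  have h0 := PT_initial (Rf := Rf) ψ hn hk
  have hus : PT (fun a => (ψ.conditions (nf a) (Rf a)).us) := by
    unfold conditions; dsimp only; fun_prop
  have hcl : PT (fun a => (ψ.conditions (nf a) (Rf a)).claims (kf a)) := by
    unfold LocalConditions.claims conditions; dsimp only; fun_prop
  have hkb : PolyBdd kf := hk.size.mono fun a => by rw [esize_nat]; omega
  have hmb : PolyBdd mf := hm.size.mono fun a => by rw [esize_nat]; omega
  let M : α → ℕ := fun a => esize ((ψ.conditions (nf a) (Rf a)).claims (kf a))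
  let N : α → ℕ := fun a => ((ψ.atoms.length + 1) * (M a + 1) + 1) + (kf a * (M a + 1) + 1) + 1
  have hM : PolyBdd M := hcl.size
  have hN : PolyBdd N := (((((PolyBdd.const _).mul (hM.add (.const 1))).add (.const 1))).add
    ((hkb.mul (hM.add (.const 1))).add (.const 1))).add (.const 1)
  unfold LocalConditions.states
  refine PT.foldl (i := fun a => (ψ.conditions (nf a) (Rf a)).initial (kf a))
    (s := fun a S _ => (ψ.conditions (nf a) (Rf a)).level (kf a) (mf a) S)
    (B := fun a => (esize ((ψ.conditions (nf a) (Rf a)).initial (kf a)) + mf a) * (N a + 1) + 1)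
    (by fun_prop) h0 ?_ ?_ ?_
  · exact PT_level ψ (hn.comp PT.fst) (hR.comp PT.fst) (hk.comp PT.fst) (hm.comp PT.fst)
      (PT.comp PT.fst PT.snd)
  · exact ((h0.size.add hmb).mul (hN.add (.const 1))).add (.const 1)
  · intro a r r' hr
    have hrl : r.length ≤ kf a := by
      have := congrArg List.length hr
      simp at this; omega
    set L := ψ.conditions (nf a) (Rf a) with hL
    have hlen : ∀ r : List ℕ, (r.foldl (fun S _ => L.level (kf a) (mf a) S)
        (L.initial (kf a))).length ≤ esize (L.initial (kf a)) + mf a := by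
      intro r
      induction r using List.reverseRecOn with
      | nil => exact (length_le_esize _).trans (Nat.le_add_right _ _)
      | append_singleton r b ih =>
        rw [List.foldl_append]
        simp only [List.foldl_cons, List.foldl_nil]
        generalize r.foldl (fun S _ => L.level (kf a) (mf a) S) (L.initial (kf a)) = S at ih ⊢
        unfold LocalConditions.level
        cases hd : decide ((S.flatMap (L.expand (kf a))).length ≤ mf a) with
        | false => exact ih
        | true => exact (of_decide_eq_true hd).trans (Nat.le_add_left _ _)
    refine (esize_list_le (M := N a) fun st hst => ?_).trans
      (Nat.add_le_add_right (Nat.mul_le_mul_right _ (hlen r)) 1)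
    obtain ⟨h1, h2, h3⟩ := LocalConditions.states_shape (conditions_lawful ψ _ _) st hst
    obtain ⟨h4, h5⟩ := mem_words.1 h1
    have e1 : esize st.1 ≤ st.1.length * (M a + 1) + 1 :=
      esize_list_le fun c hc => esize_le_of_mem (h5 c hc)
    have e2 : esize st.2 ≤ st.2.length * (M a + 1) + 1 :=
      esize_list_le fun c hc => esize_le_of_mem (h2 c hc)
    have e3 := Nat.mul_le_mul_right (M a + 1) (h3.trans hrl)
    rw [h4] at e1
    rw [esize_prod]
    change _ ≤ ((ψ.atoms.length + 1) * (M a + 1) + 1) + (kf a * (M a + 1) + 1) + 1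
    have e4 : esize st.1 ≤ (ψ.atoms.length + 1) * (M a + 1) + 1 := e1
    omega

theorem PT_nodes (hn : PT nf) (hR : PT Rf) (hk : PT kf) (hm : PT mf) :
    PT (fun a => (ψ.conditions (nf a) (Rf a)).nodes (kf a) (mf a)) := by
  unfold LocalConditions.nodes
  refine PT.filter (PT_states ψ hn hR hk hm) (PT.and (PT.not (PT.isSome ?_)) ?_)
  · exact PT_firstBad ψ (hn.comp PT.fst) (hR.comp PT.fst) PT.snd
  · exact PT_agree (by fun_prop) (by fun_prop)

theorem PT_edges (hn : PT nf) (hR : PT Rf) (hk : PT kf) (hm : PT mf) :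
    PT (fun a => (ψ.conditions (nf a) (Rf a)).edges (kf a) (mf a)) := by
  have h1 := PT_nodes ψ hn hR hk hm
  let g : List (List (Claim (List ℕ)) × List (Claim (List ℕ))) → List (ℕ × ℕ) := fun N =>
    (List.range N.length).flatMap fun i => ((List.range N.length).filter fun j =>
      LocalConditions.adj (N.getD i ([], [])) (N.getD j ([], []))).map fun j => (i, j)
  have hg : PT g := by
    unfold g LocalConditions.adj LocalConditions.agree
    fun_prop
  exact hg.comp h1

end PolyTime

/-! ### Structures as lists of numbers -/

/-- A tuple as a list of numbers. -/
def toTuple {n j : ℕ} (f : Fin j → Fin n) : List ℕ := List.ofFn fun i => (f i : ℕ)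

theorem toTuple_injective {n j : ℕ} : Function.Injective (toTuple (n := n) (j := j)) :=
  fun _ _ h => funext fun i => Fin.ext (congrFun (List.ofFn_injective h) i)

theorem mem_words_range {n j : ℕ} {t : List ℕ} :
    t ∈ words (List.range n) j ↔ ∃ f : Fin j → Fin n, toTuple f = t := by
  rw [mem_words]
  constructor
  · rintro ⟨rfl, h⟩
    exact ⟨fun i => ⟨t[i], List.mem_range.1 (h _ (List.getElem_mem _))⟩, by simp [toTuple]⟩
  · rintro ⟨f, rfl⟩
    refine ⟨by simp [toTuple], fun b hb => ?_⟩
    obtain ⟨i, rfl⟩ := (List.mem_ofFn' _ _).1 hb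
    exact List.mem_range.2 (f i).2

theorem getD_toTuple {n j : ℕ} (f : Fin j → Fin n) (i : Fin j) :
    (toTuple f).getD i 0 = f i := by
  simp [toTuple]

theorem pick_toTuple {n j j' : ℕ} (v : Fin j → Fin n) (w : Fin j' → Fin j) :
    pick (toTuple v) (List.ofFn fun i => (w i : ℕ)) = toTuple fun i => v (w i) := by
  rw [pick, List.map_ofFn, toTuple]
  congr 1
  funext i
  exact getD_toTuple v (w i)

/-- The relations of a structure. -/
def relList (A : FinStructure ar) : List (List (List ℕ)) :=
  List.ofFn fun i => (A.rel i).map toTuple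

theorem enc_structure (A : FinStructure ar) : A.enc = enc (A.n, relList A) := by
  rw [enc_prod]
  simp only [FinStructure.enc, relList]
  congr 1
  change _ = Data.ofList (List.map enc _)
  rw [List.map_ofFn]
  congr 2
  funext i
  change _ = Data.ofList (List.map enc _)
  rw [List.map_map]
  congr 2
  funext a
  change _ = Data.ofList (List.map enc (List.ofFn fun i => (a i : ℕ)))
  rw [List.map_ofFn]
  rfl

theorem ev_iff_holds (A : FinStructure ar) {P : List (Option (List ℕ))}
    {S : Finset (Fin s → Fin A.n)} (hP : ∀ f, some (toTuple f) ∈ P ↔ f ∈ S)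
    (v : Fin l → Fin A.n) : ∀ ψ : QFFormula ar s l,
    ψ.ev (relList A) P (toTuple v) = true ↔ ψ.Holds A S v
  | eq i j => by simp only [ev, Holds, getD_toTuple, Fin.ext_iff, decide_eq_true_eq]
  | rel i w => by
      have : (relList A).getD i [] = (A.rel i).map toTuple := by simp [relList]
      simp only [ev, Holds, this, pick_toTuple, decide_eq_true_eq, List.mem_map]
      exact ⟨fun ⟨a, ha, h⟩ => toTuple_injective h ▸ ha, fun h => ⟨_, h, rfl⟩⟩
  | relX w => by simp [ev, Holds, pick_toTuple, hP]
  | neg φ => by simp [ev, Holds, ← ev_iff_holds A hP v φ]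
  | conj φ ψ => by simp [ev, Holds, ev_iff_holds A hP v φ, ev_iff_holds A hP v ψ]

theorem solvable_iff_definable (A : FinStructure ar) (ψ : QFFormula ar s l) (k : ℕ) :
    (ψ.conditions A.n (relList A)).Solvable k ↔
      ∃ S : Finset (Fin s → Fin A.n), S.card = k ∧ ∀ v : Fin l → Fin A.n, ψ.Holds A S v := by
  classical
  constructor
  · rintro ⟨S, hS, hus, hev⟩
    have hSim : (Finset.univ.filter fun f : Fin s → Fin A.n => toTuple f ∈ S).map
        ⟨toTuple, toTuple_injective⟩ = S := by
      ext t
      simp only [Finset.mem_map, Finset.mem_filter, Finset.mem_univ, true_and,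
        Function.Embedding.coeFn_mk]
      refine ⟨fun ⟨f, hf, h⟩ => h ▸ hf, fun ht => ?_⟩
      obtain ⟨f, rfl⟩ := mem_words_range.1 (hus t ht)
      exact ⟨f, ht, rfl⟩
    refine ⟨Finset.univ.filter fun f => toTuple f ∈ S, ?_, fun v => ?_⟩
    · rw [← Finset.card_map ⟨toTuple, toTuple_injective⟩, hSim, hS]
    · refine (ev_iff_holds A (P := S.toList.map some) (fun f => ?_) v ψ).1
        (hev _ (mem_words_range.2 ⟨v, rfl⟩))
      simp
  · rintro ⟨S, hS, h⟩
    refine ⟨S.map ⟨toTuple, toTuple_injective⟩, by rw [Finset.card_map, hS], ?_, ?_⟩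
    · intro t ht
      obtain ⟨f, -, rfl⟩ := Finset.mem_map.1 ht
      exact mem_words_range.2 ⟨f, rfl⟩
    · intro v hv
      obtain ⟨v, rfl⟩ := mem_words_range.1 hv
      refine (ev_iff_holds A (fun f => ?_) v ψ).2 (h v)
      simp [toTuple_injective.eq_iff]

end QFFormula

open QFFormula

/-- The number of elements in an encoded structure. -/
def parseCard (x : Data) : ℕ := x.hd.toNat

/-- The relations in an encoded structure. -/
def parseRels (x : Data) : List (List (List ℕ)) :=
  x.tl.toList.map fun r => r.toList.map fun t => t.toList.map Data.toNat

/-- Whether the lists form a structure with arities `ar`. -/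
def IsStructure {m : ℕ} (ar : Fin m → ℕ) (n : ℕ) (R : List (List (List ℕ))) : Bool :=
  decide (0 < n) && (decide (R.length = m) &&
    (List.ofFn fun i : Fin m => ((i : ℕ), ar i)).all fun q => (R.getD q.1 []).all fun t =>
      decide (t.length = q.2) && t.all fun b => decide (b < n))

/-- Parsing is total, so comparing the input with the encoding of what was parsed detects every
malformed input. -/
theorem PT_isStructure {m : ℕ} (ar : Fin m → ℕ) :
    PT (fun x : Data => decide (x = enc (parseCard x, parseRels x)) &&
      IsStructure ar (parseCard x) (parseRels x)) := by
  have h1 : PT parseCard := by unfold parseCard; fun_prop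
  have h2 : PT parseRels := by unfold parseRels; fun_prop
  have h3 := PT.comp PT.encode (h1.pair h2)
  unfold IsStructure
  fun_prop

theorem Data.toList_enc_list {α : Type} [Enc α] (l : List α) :
    (enc l).toList = l.map enc := Data.toList_ofList _

theorem parseCard_enc {α : Type} [Enc α] (n : ℕ) (a : α) : parseCard (enc (n, a)) = n :=
  Data.toNat_num n

theorem parseRels_enc (n : ℕ) (R : List (List (List ℕ))) : parseRels (enc (n, R)) = R := by
  have h1 : ∀ t : List ℕ, (enc t).toList.map Data.toNat = t := fun t => by
    rw [Data.toList_enc_list, List.map_map]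
    exact (List.map_congr_left fun n _ => Data.toNat_num n).trans (List.map_id t)
  change (enc R).toList.map _ = R
  rw [Data.toList_enc_list, List.map_map]
  refine (List.map_congr_left fun r _ => ?_).trans (List.map_id R)
  simp only [Function.comp]
  rw [Data.toList_enc_list, List.map_map]
  exact (List.map_congr_left fun t _ => h1 t).trans (List.map_id r)

theorem isStructure_relList {m : ℕ} {ar : Fin m → ℕ} (A : FinStructure ar) :
    IsStructure ar A.n (relList A) = true := by
  simp only [IsStructure, Bool.and_eq_true, decide_eq_true_eq, List.all_eq_true]
  refine ⟨A.pos, by simp [relList], fun q hq => ?_⟩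
  obtain ⟨i, rfl⟩ := (List.mem_ofFn' _ _).1 hq
  intro t ht
  have : (relList A).getD i [] = (A.rel i).map toTuple := by simp [relList]
  rw [this] at ht
  obtain ⟨f, -, rfl⟩ := List.mem_map.1 ht
  refine ⟨by simp [toTuple], fun b hb => ?_⟩
  obtain ⟨j, rfl⟩ := (List.mem_ofFn' _ _).1 hb
  exact (f j).2

theorem exists_structure {m : ℕ} {ar : Fin m → ℕ} {n : ℕ} {R : List (List (List ℕ))}
    (h : IsStructure ar n R = true) : ∃ A : FinStructure ar, A.n = n ∧ relList A = R := by
  simp only [IsStructure, Bool.and_eq_true, decide_eq_true_eq, List.all_eq_true] at h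
  obtain ⟨h0, h1, h2⟩ := h
  -- The remainder modulo `n` only serves to obtain elements of `Fin n`; the entries are below `n`
  -- and do not change.
  refine ⟨⟨n, h0, fun i => (R.getD i []).map fun t => fun j =>
    ⟨t.getD j 0 % n, Nat.mod_lt _ h0⟩⟩, rfl, ?_⟩
  refine List.ext_getElem (by simp [relList, h1]) fun i hi hi' => ?_
  have him : i < m := by omega
  have hget : R.getD i [] = R[i] := List.getD_eq_getElem _ _ hi'
  simp only [relList, List.getElem_ofFn, List.map_map, hget]
  refine (List.map_congr_left fun t ht => ?_).trans (List.map_id _)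
  have h3 := h2 (i, ar ⟨i, him⟩) ((List.mem_ofFn' _ _).2 ⟨⟨i, him⟩, rfl⟩) t (by rwa [hget])
  refine List.ext_getElem (by simp [toTuple, h3.1]) fun j hj hj' => ?_
  simp only [toTuple, Function.comp, List.getElem_ofFn, id]
  have : j < t.length := hj'
  rw [List.getD_eq_getElem _ _ this]
  exact Nat.mod_eq_of_lt (h3.2 _ (List.getElem_mem _))

/-- Weighted definability by a `Π₁`-formula reduces to the clique problem. -/
theorem weightedDefinability_reducesInto_clique {m : ℕ} {ar : Fin m → ℕ} {s l : ℕ}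
    (ψ : QFFormula ar s l) : ReducesInto (weightedDefinability ψ) clique Set.univ := by
  let M : (Data × ℕ) × ℕ → ℕ := fun q =>
    ((ψ.conditions (parseCard q.1.1) (parseRels q.1.1)).initial q.1.2).length * q.2
  have h1 : PT (fun q : (Data × ℕ) × ℕ => parseCard q.1.1) := by unfold parseCard; fun_prop
  have h2 : PT (fun q : (Data × ℕ) × ℕ => parseRels q.1.1) := by unfold parseRels; fun_prop
  have h3 : PT (fun q : (Data × ℕ) × ℕ => q.1.2) := by fun_prop
  have hM : PT M := PT.natMul (PT.length
    (PT_initial (Rf := fun q : (Data × ℕ) × ℕ => parseRels q.1.1) ψ h1 h3)) PT.snd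
  have h4 := PT.comp PT.encode ((PT.length (PT_nodes ψ h1 h2 h3 hM)).pair
    (PT_edges ψ h1 h2 h3 hM))
  have h5 : PT (fun q : (Data × ℕ) × ℕ => (q.1.2 + 1) ^ (ψ.atoms.length + 1)) := by fun_prop
  have h6 := (PT_isStructure ar).comp (PT.comp PT.fst (PT.fst (α := Data × ℕ) (β := ℕ)))
  -- Malformed inputs are sent to the graph without vertices and clique size `1`, a no-instance;
  -- hence the additional one in the parameter bound.
  have h7 := PT.cond h6 (h4.pair h5) (PT.const (enc ((0, []) : ℕ × List (ℕ × ℕ)), 1))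
  refine reducesInto_of_PT ψ.atoms.length (g := fun k => (k + 1) ^ (ψ.atoms.length + 1) + 1) ?_ h7
    fun x k => ?_
  · exact computable_add (computable_pow (computable_add Computable.id (Computable.const 1))
      (Computable.const _)) (Computable.const 1)
  cases hv : decide (x = enc (parseCard x, parseRels x)) &&
      IsStructure ar (parseCard x) (parseRels x) with
  | false =>
    simp only [cond_false]
    refine ⟨Nat.le_add_left _ _, trivial, ⟨?_, ?_⟩⟩
    · rintro ⟨A, hA, -⟩
      change x = A.enc at hA
      rw [enc_structure] at hA
      subst hA
      rw [parseCard_enc, parseRels_enc, isStructure_relList] at hv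
      simp at hv
    · intro h
      obtain ⟨K, hK, hKn, -⟩ := (clique_enc (by simp)).1 h
      obtain ⟨u, hu⟩ := Finset.card_pos.1 (by rw [hK]; exact one_pos)
      exact absurd (hKn u hu) (by omega)
  | true =>
    simp only [cond_true]
    refine ⟨Nat.le_add_right _ _, trivial, ?_⟩
    rw [Bool.and_eq_true, decide_eq_true_eq] at hv
    obtain ⟨A, hn, hR⟩ := exists_structure hv.2
    rw [clique_enc, ← hn, ← hR]
    swap
    · rintro ⟨i, j⟩ he
      obtain ⟨hi, hj, -⟩ := LocalConditions.mem_edges.1 he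
      exact ⟨hi, hj⟩
    have hM : M ((x, k), padding ψ.atoms.length k) =
        ((ψ.conditions A.n (relList A)).initial k).length *
          padding (ψ.conditions A.n (relList A)).atoms.length k := by
      simp only [M, ← hn, ← hR]; rfl
    rw [hM]
    have hsol := LocalConditions.solvable_iff (conditions_lawful ψ A.n (relList A)) (k := k) le_rfl
    refine Iff.trans ?_ hsol
    rw [solvable_iff_definable]
    have hx : x = A.enc := by rw [enc_structure, hn, hR]; exact hv.1
    constructor
    · rintro ⟨B, hB, S, hS, h⟩
      change x = B.enc at hB
      have hAB : enc (A.n, relList A) = enc (B.n, relList B) := by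
        rw [← enc_structure, ← enc_structure, ← hx, hB]
      obtain ⟨h1, h2⟩ := Prod.mk.inj (Enc.inj hAB)
      rw [← solvable_iff_definable, h1, h2, solvable_iff_definable]
      exact ⟨S, hS, h⟩
    · rintro ⟨S, hS, h⟩
      exact ⟨A, hx, S, hS, h⟩

theorem reducesInto_clique_of_mem_W1 {P : ParamProblem} (hP : P ∈ W1) :
    ReducesInto P clique Set.univ := by
  obtain ⟨m, ar, s, l, ψ, h⟩ := hP
  exact h.trans (weightedDefinability_reducesInto_clique ψ)


/-! ### Layouts of directed branch-width one -/

section Side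
variable {U : Type} (L : Layout U)

/-- The walk towards `x` is followed until it first uses the edge `xy`, in either direction; at that
moment it is at an end of this edge. -/
theorem reachable_deleteEdges_or {V : Type} {G : SimpleGraph V} (x y : V) :
    ∀ {u : V}, G.Walk u x → (G.deleteEdges {s(x, y)}).Reachable u x ∨
      (G.deleteEdges {s(x, y)}).Reachable u y := by
  intro u w
  induction w with
  | nil => exact .inl (SimpleGraph.Reachable.refl _)
  | @cons a b x h p ih =>
    by_cases hab : s(a, b) = s(x, y)
    · rcases Sym2.eq_iff.1 hab with ⟨rfl, -⟩ | ⟨rfl, -⟩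
      · exact .inl (SimpleGraph.Reachable.refl _)
      · exact .inr (SimpleGraph.Reachable.refl _)
    · have hadj : (G.deleteEdges {s(x, y)}).Adj a b := by
        rw [SimpleGraph.deleteEdges_adj]
        exact ⟨h, by simpa using hab⟩
      exact ih.imp (hadj.reachable.trans ·) (hadj.reachable.trans ·)

/-- A set of tree vertices which contains `y`, does not contain `x`, and is left by the edge `xy`
only is the component of `y` in `T - xy`. -/
theorem Layout.side_eq {x y : Fin L.n} (D : Set (Fin L.n)) (hy : y ∈ D) (hx : x ∉ D)
    (hD : ∀ a b, L.tree.Adj a b → s(a, b) ≠ s(x, y) → a ∈ D → b ∈ D) :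
    L.side x y = {u | (L.leaf.symm u).1 ∈ D} := by
  have hreach : ∀ {a b}, (L.tree.deleteEdges {s(x, y)}).Reachable a b → a ∈ D → b ∈ D := by
    rintro a b ⟨w⟩
    induction w with
    | nil => exact id
    | cons h p ih =>
      rw [SimpleGraph.deleteEdges_adj] at h
      exact fun ha => ih (hD _ _ h.1 (by simpa using h.2) ha)
  ext u
  constructor
  · exact fun h => hreach h hy
  · intro h
    obtain ⟨w⟩ := L.isTree.connected.preconnected (L.leaf.symm u).1 x
    rcases reachable_deleteEdges_or x y w with h' | h'
    · exact absurd (hreach h' h) hx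
    · exact h'.symm

/-- The complement of `D` satisfies the hypotheses of `side_eq` with the ends of the edge exchanged.
-/
theorem Layout.side_swap {x y : Fin L.n} (D : Set (Fin L.n)) (hy : y ∈ D) (hx : x ∉ D)
    (hD : ∀ a b, L.tree.Adj a b → s(a, b) ≠ s(x, y) → a ∈ D → b ∈ D) :
    L.side y x = {u | (L.leaf.symm u).1 ∈ D}ᶜ := by
  rw [L.side_eq Dᶜ hx (by simpa using hy)]
  · rfl
  · intro a b hab hne ha hb
    exact ha (hD b a hab.symm (by rwa [Sym2.eq_swap, Sym2.eq_swap (a := x)]) hb)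

end Side

/-! ### The caterpillar layout -/

/-- The parents of the vertices in the caterpillar with spine `0, …, m - 1` and leaves
`m, …, 2m - 1`. -/
def caterpillarParent (m : ℕ) (v : ℕ) : ℕ := if v < m then v - 1 else v - m

/-- The caterpillar with `m` leaves. -/
def caterpillar (m : ℕ) : SimpleGraph (Fin (2 * m)) where
  Adj a b := (a.1 ≠ 0 ∧ caterpillarParent m a = b) ∨ (b.1 ≠ 0 ∧ caterpillarParent m b = a)
  symm := ⟨fun _ _ h => h.symm⟩
  loopless := ⟨fun a h => by
    have : ∀ v, 0 < m → v ≠ 0 → caterpillarParent m v ≠ v := fun v hm hv => by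
      unfold caterpillarParent; split_ifs <;> omega
    rcases h with h | h <;> exact this a (by have := a.2; omega) h.1 h.2⟩

/-- Every vertex except `0` has a smaller parent. So all are connected to `0`, and the edges
correspond to the vertices other than `0`: a connected graph with one edge less than vertices is a
tree. -/
theorem caterpillar_isTree {m : ℕ} (hm : 0 < m) : (caterpillar m).IsTree := by
  have hlt : ∀ v, v ≠ 0 → caterpillarParent m v < v := fun v hv => by
    unfold caterpillarParent; split_ifs <;> omega
  have h0 : 0 < 2 * m := by omega
  let par : Fin (2 * m) → Fin (2 * m) := fun v => if h : v.1 = 0 then v else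
    ⟨caterpillarParent m v, (hlt v h).trans v.2⟩
  have hpar : ∀ v : Fin (2 * m), v.1 ≠ 0 → (par v).1 = caterpillarParent m v := fun v hv => by
    simp [par, hv]
  have hadj : ∀ a b : Fin (2 * m), (caterpillar m).Adj a b ↔
      (a.1 ≠ 0 ∧ par a = b) ∨ (b.1 ≠ 0 ∧ par b = a) := fun a b => by
    refine or_congr (and_congr_right fun h => ?_) (and_congr_right fun h => ?_)
    · rw [Fin.ext_iff, hpar a h]
    · rw [Fin.ext_iff, hpar b h]
  have hreach : ∀ (k : ℕ) (hk : k < 2 * m), (caterpillar m).Reachable ⟨k, hk⟩ ⟨0, h0⟩ := by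
    intro k
    induction k using Nat.strong_induction_on with
    | _ k ih =>
      intro hk
      by_cases hk0 : k = 0
      · subst hk0; exact SimpleGraph.Reachable.refl _
      · have h1 : (caterpillar m).Adj ⟨k, hk⟩ (par ⟨k, hk⟩) := (hadj _ _).2 (.inl ⟨hk0, rfl⟩)
        have h2 := hpar ⟨k, hk⟩ hk0
        exact h1.reachable.trans (ih (par ⟨k, hk⟩).1 (by rw [h2]; exact hlt k hk0) (par ⟨k, hk⟩).2)
  rw [SimpleGraph.isTree_iff_connected_and_card]
  have : Nonempty (Fin (2 * m)) := ⟨⟨0, h0⟩⟩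
  refine ⟨⟨fun a b => (hreach a a.2).trans (hreach b b.2).symm⟩, ?_⟩
  have hes : (caterpillar m).edgeSet = (fun v => s(v, par v)) '' {v | v.1 ≠ 0} := by
    ext e
    induction e using Sym2.ind with
    | _ a b =>
      rw [SimpleGraph.mem_edgeSet, hadj]
      constructor
      · rintro (⟨h, rfl⟩ | ⟨h, rfl⟩)
        · exact ⟨a, h, rfl⟩
        · exact ⟨b, h, Sym2.eq_swap⟩
      · rintro ⟨v, hv, h⟩
        rcases Sym2.eq_iff.1 h with ⟨rfl, rfl⟩ | ⟨rfl, rfl⟩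
        · exact .inl ⟨hv, rfl⟩
        · exact .inr ⟨hv, rfl⟩
  have hinj : Set.InjOn (fun v => s(v, par v)) {v : Fin (2 * m) | v.1 ≠ 0} := by
    intro v hv w hw h
    rcases Sym2.eq_iff.1 h with ⟨h, -⟩ | ⟨h1, h2⟩
    · exact h
    · have e1 := hlt v hv
      have e2 := hlt w hw
      rw [← hpar v hv, h2] at e1
      rw [← hpar w hw, ← h1] at e2
      omega
  rw [Nat.card_coe_set_eq, hes, hinj.ncard_image]
  have : {v : Fin (2 * m) | v.1 ≠ 0} = {⟨0, h0⟩}ᶜ := by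
    ext v; simp [Fin.ext_iff]
  rw [this, Set.ncard_compl]
  simp only [Set.ncard_singleton, Nat.card_eq_fintype_card, Fintype.card_fin]
  omega

theorem caterpillar_neighborSet_leaf {m : ℕ} {v : Fin (2 * m)} (hv : m ≤ v.1) :
    (caterpillar m).neighborSet v = {⟨v.1 - m, by have := v.2; omega⟩} := by
  ext w
  have hv2 := v.2
  have hw2 := w.2
  simp only [SimpleGraph.mem_neighborSet, caterpillar, caterpillarParent, Set.mem_singleton_iff,
    Fin.ext_iff]
  constructor
  · rintro (h | h) <;> split_ifs at h <;> omega
  · intro h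
    refine .inl ⟨by omega, ?_⟩
    rw [if_neg (by omega)]; omega

/-- A spine vertex is adjacent to its pendant leaf and, because there are two spine vertices, also
to a vertex of the spine. -/
theorem caterpillar_leaf_iff {m : ℕ} (hm : 2 ≤ m) (v : Fin (2 * m)) :
    ((caterpillar m).neighborSet v).ncard = 1 ↔ m ≤ v.1 := by
  refine ⟨fun h => ?_, fun h => by rw [caterpillar_neighborSet_leaf h, Set.ncard_singleton]⟩
  by_contra hlt
  obtain ⟨a, ha⟩ := Set.ncard_eq_one.1 h
  have h1 : (⟨v.1 + m, by omega⟩ : Fin (2 * m)) ∈ (caterpillar m).neighborSet v := by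
    simp only [SimpleGraph.mem_neighborSet, caterpillar, caterpillarParent]
    refine .inr ⟨by omega, ?_⟩
    rw [if_neg (by omega)]; omega
  have h2 : ∃ w : Fin (2 * m), w.1 < m ∧ w ∈ (caterpillar m).neighborSet v := by
    by_cases hv : v.1 = 0
    · refine ⟨⟨1, by omega⟩, hm, .inr ⟨one_ne_zero, ?_⟩⟩
      rw [caterpillarParent, if_pos (show 1 < m from hm)]; exact hv.symm
    · refine ⟨⟨v.1 - 1, by omega⟩, by simp only; omega, .inl ⟨hv, ?_⟩⟩
      rw [caterpillarParent, if_pos (by omega)]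
  obtain ⟨w, hw, hw'⟩ := h2
  rw [ha, Set.mem_singleton_iff] at h1 hw'
  rw [← h1] at hw'
  subst hw'
  simp at hw

theorem caterpillar_degree_le {m : ℕ} (v : Fin (2 * m)) :
    ((caterpillar m).neighborSet v).ncard ≤ 3 := by
  have h1 : (Fin.val '' (caterpillar m).neighborSet v) ⊆
      ((({caterpillarParent m v, v.1 + 1, v.1 + m} : Finset ℕ)) : Set ℕ) := by
    rintro _ ⟨w, hw, rfl⟩
    simp only [SimpleGraph.mem_neighborSet, caterpillar] at hw
    simp only [Finset.coe_insert, Finset.coe_singleton, Set.mem_insert_iff, Set.mem_singleton_iff]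
    rcases hw with h | h
    · exact .inl h.2.symm
    · right
      unfold caterpillarParent at h
      split_ifs at h <;> omega
  rw [← Set.ncard_image_of_injective _ Fin.val_injective]
  refine (Set.ncard_le_ncard h1 (Finset.finite_toSet _)).trans ?_
  rw [Set.ncard_coe_finset]
  exact Finset.card_le_three

/-- The caterpillar as a layout on `Fin m`. -/
def caterpillarLayout {m : ℕ} (hm : 2 ≤ m) : Layout (Fin m) where
  n := 2 * m
  tree := caterpillar m
  isTree := caterpillar_isTree (by omega)
  degree_le := caterpillar_degree_le
  leaf :=
    { toFun := fun v => ⟨v.1.1 - m, by have := v.1.2; omega⟩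
      invFun := fun i => ⟨⟨i.1 + m, by have := i.2; omega⟩, (caterpillar_leaf_iff hm _).2 (by simp)⟩
      left_inv := fun v => by
        have := (caterpillar_leaf_iff hm v.1).1 v.2
        exact Subtype.ext (Fin.ext (by simp only; omega))
      right_inv := fun i => Fin.ext (by simp) }

/-- A tree edge joins a vertex to its parent. Above a pendant leaf it cuts off one element, and on
the spine it cuts off a final segment. -/
theorem caterpillarLayout_side {m : ℕ} (hm : 2 ≤ m) {x y : Fin (2 * m)}
    (h : (caterpillar m).Adj x y) : ∃ X : Set (Fin m),
      ((∃ i, X = {i}) ∨ ∃ j : ℕ, X = {i | j ≤ i.1}) ∧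
        ((caterpillarLayout hm).side x y = X ∨ (caterpillarLayout hm).side x y = Xᶜ) := by
  have key : ∀ v w : Fin (2 * m), v.1 ≠ 0 → caterpillarParent m v = w → ∃ X : Set (Fin m),
      ((∃ i, X = {i}) ∨ ∃ j : ℕ, X = {i | j ≤ i.1}) ∧
        (caterpillarLayout hm).side w v = X ∧ (caterpillarLayout hm).side v w = Xᶜ := by
    intro v w hv hw
    have hv2 := v.2
    have hw2 := w.2
    by_cases hvm : v.1 < m
    · rw [caterpillarParent, if_pos hvm] at hw
      -- The spine from `v` onwards with its pendant leaves; the leaf `a` is attached at position `a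
      -- - m`.
      let D : Set (Fin (2 * m)) := {a | v.1 ≤ if a.1 < m then a.1 else a.1 - m}
      have hD1 : v ∈ D := by simp [D, hvm]
      have hD2 : w ∉ D := by
        simp only [D, Set.mem_ofPred_eq]
        rw [if_pos (by omega)]; omega
      have hD3 : ∀ a b, (caterpillar m).Adj a b → s(a, b) ≠ s(w, v) → a ∈ D → b ∈ D := by
        intro a b hab hne ha
        simp only [D, Set.mem_ofPred_eq] at ha ⊢
        have ha2 := a.2
        have hb2 := b.2
        have hne' : ¬ (a = v ∧ b = w) := fun h => hne (by rw [h.1, h.2, Sym2.eq_swap])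
        rw [Fin.ext_iff, Fin.ext_iff] at hne'
        simp only [caterpillar, caterpillarParent] at hab
        rcases hab with h | h <;> split_ifs at h ha ⊢ <;> omega
      have hX : {u | ((caterpillarLayout hm).leaf.symm u).1 ∈ D} = {i : Fin m | v.1 ≤ i.1} := by
        ext i
        change (v.1 ≤ if i.1 + m < m then i.1 + m else i.1 + m - m) ↔ v.1 ≤ i.1
        rw [if_neg (by omega), Nat.add_sub_cancel]
      refine ⟨{i : Fin m | v.1 ≤ i.1}, .inr ⟨v.1, rfl⟩, ?_, ?_⟩
      · exact ((caterpillarLayout hm).side_eq D hD1 hD2 hD3).trans hX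
      · exact ((caterpillarLayout hm).side_swap D hD1 hD2 hD3).trans (congrArg _ hX)
    · rw [caterpillarParent, if_neg hvm] at hw
      have hD2 : w ∉ ({v} : Set (Fin (2 * m))) := by
        rw [Set.mem_singleton_iff, Fin.ext_iff]; omega
      have hD3 : ∀ a b, (caterpillar m).Adj a b → s(a, b) ≠ s(w, v) →
          a ∈ ({v} : Set (Fin (2 * m))) → b ∈ ({v} : Set (Fin (2 * m))) := by
        intro a b hab hne ha
        rw [Set.mem_singleton_iff] at ha
        subst ha
        have : b ∈ (caterpillar m).neighborSet a := hab
        rw [caterpillar_neighborSet_leaf (by omega), Set.mem_singleton_iff, Fin.ext_iff] at this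
        exact absurd (by rw [Fin.ext (this.trans hw), Sym2.eq_swap]) hne
      have hX : {u | ((caterpillarLayout hm).leaf.symm u).1 ∈ ({v} : Set (Fin (2 * m)))} =
          {(⟨v.1 - m, by omega⟩ : Fin m)} := by
        ext i
        change (⟨i.1 + m, by have := i.2; omega⟩ : Fin (2 * m)) = v ↔ i = ⟨v.1 - m, by omega⟩
        rw [Fin.ext_iff, Fin.ext_iff]
        simp only; omega
      refine ⟨{⟨v.1 - m, by omega⟩}, .inl ⟨_, rfl⟩, ?_, ?_⟩
      · exact ((caterpillarLayout hm).side_eq {v} rfl hD2 hD3).trans hX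
      · exact ((caterpillarLayout hm).side_swap {v} rfl hD2 hD3).trans (congrArg _ hX)
  rcases h with h | h
  · obtain ⟨X, h1, -, h2⟩ := key x y h.1 h.2
    exact ⟨X, h1, .inr h2⟩
  · obtain ⟨X, h1, h2, -⟩ := key y x h.1 h.2
    exact ⟨X, h1, .inl h2⟩

/-- If the edges are listed in the order of the middle vertices of the paths with two edges, the
directed branch-width is at most one; it is one if there is such a path. -/
theorem dbw_eq_one (D : FinDigraph) (key : D.E → ℕ) (hmono : Monotone key)
    (hkey : ∀ e f, D.tgt e = D.src f → key e = (D.tgt e).1 ∧ key f = (D.tgt e).1)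
    (hpath : ∃ e f, e ≠ f ∧ D.tgt e = D.src f) : D.dbw = 1 := by
  have hm : 2 ≤ D.m := by
    obtain ⟨e, f, hef, -⟩ := hpath
    have h1 := e.2
    have h2 := f.2
    have : e.1 ≠ f.1 := fun h => hef (Fin.ext h)
    omega
  -- A separator vertex is the key of edges on both sides of the cut. A single edge has only one
  -- key, and as keys increase weakly along the list, a final segment splits the edges of at most
  -- one key.
  have hcut : ∀ X : Set D.E, ((∃ i, X = {i}) ∨ ∃ j : ℕ, X = {i | j ≤ i.1}) →
      (D.vertexSep X ∪ D.vertexSep Xᶜ).ncard ≤ 1 := by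
    intro X hX
    have hsplit : ∀ y ∈ D.vertexSep X ∪ D.vertexSep Xᶜ,
        ∃ e f, e ∉ X ∧ f ∈ X ∧ key e = y.1 ∧ key f = y.1 := by
      rintro y (⟨e, f, he, hf, rfl, h⟩ | ⟨e, f, he, hf, rfl, h⟩)
      · exact ⟨e, f, he, hf, hkey e f h.symm⟩
      · have := hkey e f h.symm
        exact ⟨f, e, hf, by simpa using he, this.2, this.1⟩
    rw [Set.ncard_le_one]
    intro y hy z hz
    obtain ⟨e, f, he, hf, h1, h2⟩ := hsplit y hy
    obtain ⟨e', f', he', hf', h1', h2'⟩ := hsplit z hz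
    rcases hX with ⟨i, rfl⟩ | ⟨j, rfl⟩
    · rw [Set.mem_singleton_iff] at hf hf'
      rw [hf] at h2
      rw [hf'] at h2'
      exact Fin.ext (h2.symm.trans h2')
    · simp only [Set.mem_ofPred_eq] at he hf he' hf'
      have a1 : key e ≤ key f' := hmono (Fin.le_def.2 (by omega))
      have a2 : key e' ≤ key f := hmono (Fin.le_def.2 (by omega))
      exact Fin.ext (by omega)
  have hmem : 1 ∈ {w | ∃ L : Layout D.E, ∀ x y, L.tree.Adj x y →
      (D.vertexSep (L.side x y) ∪ D.vertexSep (L.side x y)ᶜ).ncard ≤ w} := by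
    refine ⟨caterpillarLayout hm, fun x y hxy => ?_⟩
    obtain ⟨X, hX, h | h⟩ := caterpillarLayout_side hm hxy
    · rw [h]; exact hcut X hX
    · rw [h, compl_compl, Set.union_comm]; exact hcut X hX
  refine le_antisymm (Nat.sInf_le hmem) (le_csInf ⟨1, hmem⟩ ?_)
  rintro w ⟨L, hL⟩
  -- For the lower bound, the tree edge at the leaf of `e` separates `e` from `f`, so their common
  -- vertex is counted in every layout.
  obtain ⟨e, f, hef, h⟩ := hpath
  set a := L.leaf.symm e with ha
  obtain ⟨x, hx⟩ := Set.ncard_eq_one.1 a.2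
  have hxa : L.tree.Adj a.1 x := by
    have : x ∈ L.tree.neighborSet a.1 := by rw [hx]; rfl
    exact this
  have hside : L.side x a.1 = {u | (L.leaf.symm u).1 ∈ ({a.1} : Set (Fin L.n))} := by
    refine L.side_eq {a.1} rfl (fun h => hxa.ne' h) fun b c hbc hne hb => ?_
    rw [Set.mem_singleton_iff] at hb
    subst hb
    have : c ∈ L.tree.neighborSet a.1 := hbc
    rw [hx, Set.mem_singleton_iff] at this
    exact absurd (by rw [this, Sym2.eq_swap]) hne
  refine le_trans ?_ (hL x a.1 hxa.symm)
  rw [Nat.one_le_iff_ne_zero, ← Nat.pos_iff_ne_zero, Set.ncard_pos]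
  refine ⟨D.tgt e, .inr ⟨e, f, ?_, ?_, rfl, h.symm⟩⟩
  · rw [hside]; simp [ha]
  · rw [hside]
    simp only [Set.mem_compl_iff, Set.mem_ofPred_eq, Set.mem_singleton_iff]
    intro h'
    exact hef (L.leaf.symm.injective (Subtype.ext h')).symm


/-! ### Digraphs from lists of arcs -/

/-- The digraph with vertices `0, …, n - 1` and the given list of edges. -/
def FinDigraph.ofList (n : ℕ) (L : List (ℕ × ℕ)) (h : ∀ e ∈ L, e.1 < n ∧ e.2 < n) :
    FinDigraph where
  n := n
  m := L.length
  src i := ⟨(L[i]).1, (h _ (List.getElem_mem _)).1⟩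
  tgt i := ⟨(L[i]).2, (h _ (List.getElem_mem _)).2⟩

theorem FinDigraph.enc_ofList (n : ℕ) (L : List (ℕ × ℕ)) (h : ∀ e ∈ L, e.1 < n ∧ e.2 < n) :
    (FinDigraph.ofList n L h).enc = Enc.enc (n, L) := by
  rw [enc_graph, FinDigraph.enc]
  congr 2
  refine List.ext_getElem (by simp [ofList]) fun i h1 h2 => ?_
  simp [ofList]

theorem FinDigraph.enc_injective : Function.Injective FinDigraph.enc := by
  rintro ⟨n, m, src, tgt⟩ ⟨n', m', src', tgt'⟩ h
  simp only [FinDigraph.enc, Data.cons.injEq] at h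
  obtain ⟨h1, h2⟩ := h
  have hn := Data.num_injective h1
  have hl := Data.ofList_injective h2
  have hm : m = m' := by simpa using congrArg List.length hl
  subst hn
  subst hm
  have hf := List.ofFn_injective hl
  have hsrc : src = src' := funext fun e => by
    have := congrFun hf e
    simp only [Data.cons.injEq] at this
    exact Fin.ext (Data.num_injective this.1)
  have htgt : tgt = tgt' := funext fun e => by
    have := congrFun hf e
    simp only [Data.cons.injEq] at this
    exact Fin.ext (Data.num_injective this.2)
  rw [hsrc, htgt]

theorem mem_dred {D : FinDigraph} {k h l : ℕ} {s : D.V} (hl : l = k + h) :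
    (dredInst D k h s, l) ∈ dred ↔ D.Dred k h s := by
  constructor
  · rintro ⟨D', k', h', s', heq, hd⟩
    simp only [dredInst, Prod.mk.injEq, Data.cons.injEq] at heq
    obtain ⟨⟨h1, h2, h3, h4⟩, -⟩ := heq
    obtain rfl := FinDigraph.enc_injective h1
    obtain rfl := Data.num_injective h2
    obtain rfl := Data.num_injective h3
    rwa [Fin.ext (Data.num_injective h4)]
  · exact fun hd => ⟨D, k, h, s, by rw [hl], hd⟩

/-- All arcs between `0, …, n - 1` allowed by `A`, in the order of their tails, where the arcs
with tail `0` precede the arcs whose tail is their head. -/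
def arcList (n : ℕ) (A : ℕ → ℕ → Bool) : List (ℕ × ℕ) :=
  (List.range n).flatMap fun y => (bif A 0 y then [(0, y)] else []) ++
    ((List.range n).filter fun p => decide (0 < y) && A y p).map fun p => (y, p)

/-- No arc ends in `0`, and no path outside `0` has two arcs. -/
structure ShallowArcs (A : ℕ → ℕ → Bool) : Prop where
  ne_zero : ∀ a b, A a b = true → b ≠ 0
  sink : ∀ a b c, a ≠ 0 → A a b = true → A b c = false

theorem mem_arcList {n : ℕ} {A : ℕ → ℕ → Bool} {a b : ℕ} :
    (a, b) ∈ arcList n A ↔ a < n ∧ b < n ∧ A a b = true := by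
  simp only [arcList, List.mem_flatMap, List.mem_append, List.mem_map, List.mem_filter,
    List.mem_range, Bool.and_eq_true, decide_eq_true_eq, Prod.mk.injEq]
  constructor
  · rintro ⟨y, hy, h | ⟨p, ⟨hp, hy0, hA⟩, rfl, rfl⟩⟩
    · cases hA : A 0 y with
      | false => simp [hA] at h
      | true =>
        simp only [hA, cond_true, List.mem_singleton, Prod.mk.injEq] at h
        obtain ⟨rfl, rfl⟩ := h
        exact ⟨by omega, hy, hA⟩
    · exact ⟨hy, hp, hA⟩
  · rintro ⟨ha, hb, hA⟩
    by_cases h0 : a = 0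
    · subst h0
      exact ⟨b, hb, .inl (by simp [hA])⟩
    · exact ⟨a, ha, .inr ⟨b, ⟨hb, by omega, hA⟩, rfl, rfl⟩⟩

/-- The endpoint of an arc other than `0` which determines its place in the list. -/
def arcKey (e : ℕ × ℕ) : ℕ := if e.1 = 0 then e.2 else e.1

/-- The block produced for `y` consists of arcs with key `y`, and the blocks come in increasing
order. Within a block only the arc `(0, y)` has tail `0`, so nothing is repeated. -/
theorem arcList_pairwise (n : ℕ) (A : ℕ → ℕ → Bool) :
    (arcList n A).Pairwise fun e f => e ≠ f ∧ arcKey e ≤ arcKey f := by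
  have hkey : ∀ y, ∀ e ∈ (bif A 0 y then [(0, y)] else []) ++
      ((List.range n).filter fun p => decide (0 < y) && A y p).map (fun p => (y, p)),
      arcKey e = y := by
    intro y e he
    rcases List.mem_append.1 he with he | he
    · cases hA : A 0 y <;> simp [hA] at he
      rw [he]; simp [arcKey]
    · obtain ⟨p, hp, rfl⟩ := List.mem_map.1 he
      have := (List.mem_filter.1 hp).2
      simp only [Bool.and_eq_true, decide_eq_true_eq] at this
      rw [arcKey, if_neg (by simp only; omega)]
  refine List.pairwise_flatMap.2 ⟨fun y _ => List.pairwise_append.2 ⟨?_, ?_, ?_⟩, ?_⟩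
  · cases A 0 y <;> simp
  · refine List.pairwise_map.2 ?_
    have : ((List.range n).filter fun p => decide (0 < y) && A y p).Nodup :=
      List.nodup_range.filter _
    refine List.Pairwise.imp_of_mem ?_ this
    intro p q hp _ hpq
    have := (List.mem_filter.1 hp).2
    simp only [Bool.and_eq_true, decide_eq_true_eq] at this
    have hy : y ≠ 0 := by omega
    exact ⟨fun h => hpq (Prod.mk.inj h).2, by simp [arcKey, hy]⟩
  · intro e he f hf
    refine ⟨?_, by rw [hkey y e (List.mem_append_left _ he), hkey y f (List.mem_append_right _ hf)]⟩
    rintro rfl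
    obtain ⟨p, hp, rfl⟩ := List.mem_map.1 hf
    have := (List.mem_filter.1 hp).2
    simp only [Bool.and_eq_true, decide_eq_true_eq] at this
    cases hA : A 0 y <;> simp [hA] at he
    omega
  · refine List.pairwise_lt_range.imp fun {y z} hyz e he f hf => ?_
    have h1 := hkey y e he
    have h2 := hkey z f hf
    refine ⟨?_, by omega⟩
    rintro rfl
    omega

/-- The digraph of all arcs between `0, …, n - 1` allowed by `A`. -/
def arcDigraph (n : ℕ) (A : ℕ → ℕ → Bool) : FinDigraph :=
  FinDigraph.ofList n (arcList n A) fun e he => by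
    obtain ⟨h1, h2, -⟩ := mem_arcList.1 (show (e.1, e.2) ∈ arcList n A from he)
    exact ⟨h1, h2⟩

section
variable {n : ℕ} {A : ℕ → ℕ → Bool}

theorem arcDigraph_enc : (arcDigraph n A).enc = enc (n, arcList n A) := by
  unfold arcDigraph
  exact FinDigraph.enc_ofList _ _ _

theorem arcDigraph_arc (e : (arcDigraph n A).E) :
    A ((arcDigraph n A).src e).1 ((arcDigraph n A).tgt e).1 = true :=
  (mem_arcList.1 (List.getElem_mem (l := arcList n A) e.2)).2.2

theorem exists_edge {a b : ℕ} (ha : a < n) (hb : b < n) (h : A a b = true) :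
    ∃ e : (arcDigraph n A).E, ((arcDigraph n A).src e).1 = a ∧ ((arcDigraph n A).tgt e).1 = b := by
  obtain ⟨i, hi, he⟩ := List.getElem_of_mem (mem_arcList.2 ⟨ha, hb, h⟩)
  exact ⟨⟨i, hi⟩, congrArg Prod.fst he, congrArg Prod.snd he⟩

theorem arcDigraph_edge_ext {e f : (arcDigraph n A).E}
    (h1 : (arcDigraph n A).src e = (arcDigraph n A).src f)
    (h2 : (arcDigraph n A).tgt e = (arcDigraph n A).tgt f) : e = f := by
  have hnd : (arcList n A).Nodup := (arcList_pairwise n A).imp fun h => h.1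
  refine Fin.ext ((List.Nodup.getElem_inj_iff hnd (hi := e.2) (hj := f.2)).1 ?_)
  exact Prod.ext (congrArg Fin.val h1) (congrArg Fin.val h2)

/-- A loop cannot be at `0`, where no arc ends, and elsewhere it would follow itself to form a
forbidden path. Parallel arcs would be a repetition in the list. -/
theorem arcDigraph_simple (hA : ShallowArcs A) : (arcDigraph n A).Simple := by
  refine ⟨fun e h => ?_, fun e f => arcDigraph_edge_ext⟩
  have h1 := arcDigraph_arc e
  rw [h] at h1
  have h2 := hA.sink _ _ ((arcDigraph n A).tgt e).1 (hA.ne_zero _ _ h1) h1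
  rw [h1] at h2
  exact absurd h2 (by simp)

/-- The first arc of a path with two arcs starts at `0` and the second one does not, so the middle
vertex is the key of both. -/
theorem arcDigraph_dbw (hA : ShallowArcs A) {a b : ℕ} (ha : a < n) (hb : b < n)
    (h1 : A 0 a = true) (h2 : A a b = true) : (arcDigraph n A).dbw = 1 := by
  refine dbw_eq_one _ (fun e => arcKey ((arcList n A)[e.1]'e.2)) ?_ ?_ ?_
  · intro e f hef
    rcases eq_or_lt_of_le hef with rfl | hlt
    · exact le_rfl
    · exact (List.pairwise_iff_getElem.1 (arcList_pairwise n A) e.1 f.1 e.2 f.2 hlt).2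
  · intro e f h
    have he := arcDigraph_arc e
    have hf := arcDigraph_arc f
    rw [← h] at hf
    have h0 := hA.ne_zero _ _ he
    have hsrc : ((arcDigraph n A).src e).1 = 0 := by
      by_contra hne
      rw [hA.sink _ _ _ hne he] at hf
      exact absurd hf (by simp)
    constructor
    · exact if_pos hsrc
    · have : ((arcDigraph n A).src f).1 ≠ 0 := by rw [← h]; exact h0
      exact (if_neg this).trans (congrArg Fin.val h.symm)
  · obtain ⟨e, he1, he2⟩ := exists_edge (by omega : 0 < n) ha h1
    obtain ⟨f, hf1, hf2⟩ := exists_edge ha hb h2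
    refine ⟨e, f, ?_, Fin.ext (by rw [he2, hf1])⟩
    rintro rfl
    have := hA.ne_zero _ _ h1
    omega

end

/-! ### From cliques to edge deletion -/

section Gadget
variable (n : ℕ) (L : List (ℕ × ℕ))

/-- The vertex for the pair `(u, v)`. -/
def pairVertex (u v : ℕ) : ℕ := 1 + n + (n * u + v)

/-- `u` and `v` may belong to the same clique. -/
def compatible (u v : ℕ) : Bool :=
  decide (u = v) || (decide ((u, v) ∈ L) || decide ((v, u) ∈ L))

/-- `p` is the vertex for a pair that may belong to a clique. -/
def isGoodPair (p : ℕ) : Bool :=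
  (List.range n).any fun u => (List.range n).any fun v =>
    decide (p = pairVertex n u v) && compatible L u v

/-- The arcs of the digraph for the graph with edge list `L`: from `0` to the vertices `1, …, n`,
from these to the vertices of compatible pairs, and from `0` to all other vertices. -/
def cliqueArc (a b : ℕ) : Bool :=
  bif decide (a = 0) then decide (0 < b) && (decide (b ≤ n) || !isGoodPair n L b)
  else (List.range n).any fun u => (List.range n).any fun v =>
    decide (b = pairVertex n u v) &&
      (compatible L u v && (decide (a = 1 + u) || decide (a = 1 + v)))

variable {n L}

theorem pairVertex_inj {u v u' v' : ℕ} (hv : v < n) (hv' : v' < n)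
    (h : pairVertex n u v = pairVertex n u' v') : u = u' ∧ v = v' := by
  have h1 : n * u + v = n * u' + v' := by unfold pairVertex at h; omega
  have hn : 0 < n := by omega
  have h2 := congrArg (· / n) h1
  have h3 := congrArg (· % n) h1
  simp only [Nat.mul_add_div hn, Nat.mul_add_mod, Nat.div_eq_of_lt hv, Nat.div_eq_of_lt hv',
    Nat.mod_eq_of_lt hv, Nat.mod_eq_of_lt hv'] at h2 h3
  exact ⟨by omega, h3⟩

theorem pairVertex_lt {u v : ℕ} (hu : u < n) (hv : v < n) : pairVertex n u v < 1 + n + n * n := by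
  have : n * (u + 1) ≤ n * n := Nat.mul_le_mul_left n hu
  unfold pairVertex
  rw [Nat.mul_succ] at this
  omega

theorem isGoodPair_iff {p : ℕ} : isGoodPair n L p = true ↔
    ∃ u < n, ∃ v < n, p = pairVertex n u v ∧ compatible L u v = true := by
  simp only [isGoodPair, List.any_eq_true, List.mem_range, Bool.and_eq_true, decide_eq_true_eq]

theorem cliqueArc_zero {b : ℕ} : cliqueArc n L 0 b = true ↔
    0 < b ∧ (b ≤ n ∨ isGoodPair n L b = false) := by
  simp [cliqueArc]

theorem cliqueArc_of_ne_zero {a b : ℕ} (ha : a ≠ 0) : cliqueArc n L a b = true ↔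
    ∃ u < n, ∃ v < n, b = pairVertex n u v ∧ compatible L u v = true ∧ (a = 1 + u ∨ a = 1 + v) := by
  simp only [cliqueArc, decide_eq_false ha, cond_false, List.any_eq_true, List.mem_range,
    Bool.and_eq_true, Bool.or_eq_true, decide_eq_true_eq]

theorem cliqueArc_shallow : ShallowArcs (cliqueArc n L) where
  ne_zero a b h := by
    by_cases ha : a = 0
    · subst ha
      have := (cliqueArc_zero.1 h).1
      omega
    · obtain ⟨u, _, v, _, rfl, _⟩ := (cliqueArc_of_ne_zero ha).1 h
      unfold pairVertex; omega
  sink a b c ha h := by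
    obtain ⟨u, _, v, _, rfl, _⟩ := (cliqueArc_of_ne_zero ha).1 h
    rw [← Bool.not_eq_true, cliqueArc_of_ne_zero (by unfold pairVertex; omega)]
    rintro ⟨u', _, v', _, -, -, h | h⟩ <;> unfold pairVertex at h <;> omega

variable (n L) in
/-- The digraph for the graph with edge list `L`. -/
def cliqueDigraph : FinDigraph := arcDigraph (1 + n + n * n) (cliqueArc n L)

variable (n L) in
/-- The source vertex. -/
def cliqueSource : (cliqueDigraph n L).V := ⟨0, by
  change 0 < 1 + n + n * n; omega⟩

theorem cliqueDigraph_simple : (cliqueDigraph n L).Simple := arcDigraph_simple cliqueArc_shallow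

/-- A vertex is compatible with itself, so even an edgeless graph gives the path from the source
through `1` to the pair `(0, 0)`. The width is therefore exactly one. -/
theorem cliqueDigraph_dbw (hn : 0 < n) : (cliqueDigraph n L).dbw = 1 := by
  refine arcDigraph_dbw cliqueArc_shallow (a := 1) (b := pairVertex n 0 0) (by omega)
    (pairVertex_lt hn hn) (cliqueArc_zero.2 ⟨one_pos, .inl hn⟩)
    ((cliqueArc_of_ne_zero one_ne_zero).2 ⟨0, hn, 0, hn, rfl, by simp [compatible], .inl rfl⟩)

theorem hasClique_iff_compatible {r : ℕ} : HasClique n L r ↔ ∃ K : Finset ℕ, K.card = r ∧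
    (∀ u ∈ K, u < n) ∧ ∀ u ∈ K, ∀ v ∈ K, compatible L u v = true := by
  have : ∀ u v, compatible L u v = true ↔ (u ≠ v → (u, v) ∈ L ∨ (v, u) ∈ L) := fun u v => by
    simp only [compatible, Bool.or_eq_true, decide_eq_true_eq]; tauto
  simp only [this, HasClique]

/-- The deleted arcs are those from the source to the clique `K`. The vertex of a pair in `K ×ˢ K`,
diagonal included, has no arc from the source, and its in-neighbours belong to `K`, so it becomes
unreachable together with the vertices of `K`. -/
theorem dred_of_hasClique {r : ℕ} (h : HasClique n L r) :
    (cliqueDigraph n L).Dred r (r + r ^ 2) (cliqueSource n L) := by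
  classical
  obtain ⟨K, hK, hKn, hcomp⟩ := hasClique_iff_compatible.1 h
  set D := cliqueDigraph n L with hD
  have harc : ∀ e : D.E, cliqueArc n L (D.src e).1 (D.tgt e).1 = true := arcDigraph_arc
  set F : Finset D.E := Finset.univ.filter fun e => (D.src e).1 = 0 ∧ ∃ u ∈ K, (D.tgt e).1 = 1 + u
    with hF
  have hpos : ∀ e : D.E, (D.tgt e).1 ≠ 0 := fun e => cliqueArc_shallow.ne_zero _ _ (harc e)
  refine ⟨F, ?_, ?_⟩
  · rw [← hK]
    refine Finset.card_le_card_of_injOn (fun e => (D.tgt e).1 - 1) ?_ ?_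
    · intro e he
      obtain ⟨-, -, u, hu, h⟩ := Finset.mem_filter.1 he
      simp only [h, Nat.add_sub_cancel_left]; exact hu
    · intro e he f hf h
      obtain ⟨-, h1, -⟩ := Finset.mem_filter.1 he
      obtain ⟨-, h2, -⟩ := Finset.mem_filter.1 hf
      refine arcDigraph_edge_ext (Fin.ext (h1.trans h2.symm)) (Fin.ext ?_)
      have := hpos e
      have := hpos f
      change (D.tgt e).1 = (D.tgt f).1
      simp only at h
      omega
  · set T : Finset ℕ := K.image (fun u => 1 + u) ∪ (K ×ˢ K).image fun q => pairVertex n q.1 q.2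
      with hT
    have hcard : T.card = r + r ^ 2 := by
      rw [hT, Finset.card_union_of_disjoint, Finset.card_image_of_injective,
        Finset.card_image_of_injOn, Finset.card_product, hK, sq]
      · rintro ⟨u, v⟩ h1 ⟨u', v'⟩ h2 h
        rw [Finset.mem_coe, Finset.mem_product] at h1 h2
        obtain ⟨h3, h4⟩ := pairVertex_inj (hKn _ h1.2) (hKn _ h2.2) h
        exact Prod.ext h3 h4
      · intro a b h
        simp only at h; omega
      · rw [Finset.disjoint_left]
        intro a h1 h2
        obtain ⟨u, hu, rfl⟩ := Finset.mem_image.1 h1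
        obtain ⟨q, -, hq⟩ := Finset.mem_image.1 h2
        have := hKn u hu
        unfold pairVertex at hq; omega
    rw [← hcard, ← Set.ncard_coe_finset, ← Set.ncard_image_of_injective _ Fin.val_injective]
    refine Set.ncard_le_ncard ?_ (Set.toFinite _)
    intro t ht
    rw [Finset.mem_coe, hT, Finset.mem_union] at ht
    rcases ht with ht | ht
    · obtain ⟨u, hu, rfl⟩ := Finset.mem_image.1 ht
      have hun := hKn u hu
      refine ⟨⟨1 + u, by change _ < 1 + n + n * n; omega⟩, ?_, rfl⟩
      rintro (h | ⟨e, he, h1, h2⟩ | ⟨e, f, -, -, -, h2, h3⟩)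
      · have := congrArg Fin.val h
        simp only [cliqueSource] at this; omega
      · exact he (Finset.mem_filter.2 ⟨Finset.mem_univ _, congrArg Fin.val h1, u, hu,
          congrArg Fin.val h2⟩)
      · have h4 := harc f
        have h5 := hpos e
        rw [h2] at h5
        obtain ⟨u', _, v', _, h6, _⟩ := (cliqueArc_of_ne_zero h5).1 h4
        have h7 : (D.tgt f).1 = 1 + u := congrArg Fin.val h3
        unfold pairVertex at h6; omega
    · obtain ⟨⟨u, v⟩, huv, rfl⟩ := Finset.mem_image.1 ht
      obtain ⟨hu, hv⟩ := Finset.mem_product.1 huv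
      have hun := hKn u hu
      have hvn := hKn v hv
      refine ⟨⟨pairVertex n u v, pairVertex_lt hun hvn⟩, ?_, rfl⟩
      have hgood : isGoodPair n L (pairVertex n u v) = true :=
        isGoodPair_iff.2 ⟨u, hun, v, hvn, rfl, hcomp u hu v hv⟩
      rintro (h | ⟨e, -, h1, h2⟩ | ⟨e, f, he, -, h1, h2, h3⟩)
      · have := congrArg Fin.val h
        simp only [cliqueSource, pairVertex] at this; omega
      · have h4 := harc e
        rw [h1, h2] at h4
        obtain ⟨-, h5 | h5⟩ := cliqueArc_zero.1 h4
        · simp only [pairVertex] at h5; omega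
        · simp only [hgood] at h5; exact absurd h5 (by simp)
      · have h4 := harc f
        have h5 := hpos e
        rw [h2] at h5
        obtain ⟨u', hu', v', hv', h6, -, h7⟩ := (cliqueArc_of_ne_zero h5).1 h4
        rw [h3] at h6
        obtain ⟨rfl, rfl⟩ := pairVertex_inj hvn hv' h6
        rw [← h2] at h7
        refine he (Finset.mem_filter.2 ⟨Finset.mem_univ _, congrArg Fin.val h1, ?_⟩)
        rcases h7 with h7 | h7
        · exact ⟨u, hu, h7⟩
        · exact ⟨v, hv, h7⟩

/-- Let `FK` be the deleted arcs from the source to graph vertices, `K` the vertices they hit and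
`Q` the compatible pairs in `K ×ˢ K`. Every unreached vertex belongs to `K`, to `Q` or to the heads
of the other deleted arcs. Since `K.card + (F \ FK).card ≤ r`, at least `r ^ 2` of them must come
from `Q`, which has at most `K.card ^ 2` elements. So `K` has `r` elements and all its pairs are
compatible. -/
theorem hasClique_of_dred {r : ℕ} (h : (cliqueDigraph n L).Dred r (r + r ^ 2) (cliqueSource n L)) :
    HasClique n L r := by
  classical
  set D := cliqueDigraph n L with hD
  obtain ⟨F, hFr, hh⟩ := h
  set FK := F.filter fun e => (D.src e).1 = 0 ∧ (D.tgt e).1 ≤ n with hFK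
  set K : Finset ℕ := (FK.image fun e => (D.tgt e).1 - 1).filter fun u => u < n with hK
  set Q := (K ×ˢ K).filter fun q => compatible L q.1 q.2 = true with hQ
  have hKc : K.card ≤ FK.card := (Finset.card_filter_le _ _).trans Finset.card_image_le
  have hF : FK.card + (F \ FK).card = F.card := by
    rw [add_comm]; exact Finset.card_sdiff_add_card_eq_card (Finset.filter_subset _ _)
  have harcK : ∀ u < n, ∀ e : D.E, (D.src e).1 = 0 → (D.tgt e).1 = 1 + u → e ∈ F → u ∈ K :=
    fun u hu e h1 h2 he => Finset.mem_filter.2 ⟨Finset.mem_image.2 ⟨e,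
      Finset.mem_filter.2 ⟨he, h1, by omega⟩, by simp [h2]⟩, hu⟩
  set T : Finset ℕ := (K.image fun u => 1 + u) ∪ ((Q.image fun q => pairVertex n q.1 q.2) ∪
    (F \ FK).image fun e => (D.tgt e).1) with hT
  -- An unreached graph vertex, or vertex of an incompatible pair, has lost its arc from the source.
  -- For a compatible pair, either a deleted arc outside `FK` ends there, or both second arcs
  -- survive and the source arcs of both members must be deleted.
  have hsub : Fin.val '' (D.reach F (cliqueSource n L))ᶜ ⊆ (T : Set ℕ) := by
    rintro _ ⟨y, hy, rfl⟩
    have hyN : y.1 < 1 + n + n * n := y.2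
    simp only [Set.mem_compl_iff, FinDigraph.reach, Set.mem_ofPred_eq, not_or, not_exists,
      not_and] at hy
    obtain ⟨h0, h1, h2⟩ := hy
    have hy0 : y.1 ≠ 0 := fun h => h0 (Fin.ext h.symm)
    have hdirect : ∀ e : D.E, (D.src e).1 = 0 → (D.tgt e).1 = y.1 → e ∈ F := fun e h3 h4 => by
      by_contra he
      exact h1 e he (Fin.ext h3) (Fin.ext h4)
    rw [Finset.mem_coe, hT, Finset.mem_union, Finset.mem_union]
    by_cases hyn : y.1 ≤ n
    · left
      obtain ⟨e, he1, he2⟩ := exists_edge (n := 1 + n + n * n) (A := cliqueArc n L) (by omega) hyN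
        (cliqueArc_zero.2 ⟨Nat.pos_of_ne_zero hy0, .inl hyn⟩)
      exact Finset.mem_image.2 ⟨y.1 - 1, harcK _ (by omega) e he1 (he2.trans (by omega))
        (hdirect e he1 he2), by omega⟩
    · right
      cases hg : isGoodPair n L y.1 with
      | false =>
        obtain ⟨e, he1, he2⟩ := exists_edge (n := 1 + n + n * n) (A := cliqueArc n L) (by omega) hyN
          (cliqueArc_zero.2 ⟨Nat.pos_of_ne_zero hy0, .inr hg⟩)
        refine .inr (Finset.mem_image.2
          ⟨e, Finset.mem_sdiff.2 ⟨hdirect e he1 he2, fun h => ?_⟩, he2⟩)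
        have := (Finset.mem_filter.1 h).2.2
        change (D.tgt e).1 = y.1 at he2
        omega
      | true =>
        obtain ⟨u, hu, v, hv, hyuv, hc⟩ := isGoodPair_iff.1 hg
        by_cases hmem : y.1 ∈ (F \ FK).image fun e => (D.tgt e).1
        · exact .inr hmem
        left
        have hside : ∀ w < n, (w = u ∨ w = v) → w ∈ K := fun w hw hwuv => by
          obtain ⟨e, he1, he2⟩ := exists_edge (n := 1 + n + n * n) (A := cliqueArc n L)
            (a := 0) (b := 1 + w) (by omega) (by omega)
            (cliqueArc_zero.2 ⟨by omega, .inl (by omega)⟩)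
          obtain ⟨f, hf1, hf2⟩ := exists_edge (n := 1 + n + n * n) (A := cliqueArc n L)
            (a := 1 + w) (b := y.1) (by omega) hyN ((cliqueArc_of_ne_zero (by omega)).2
              ⟨u, hu, v, hv, hyuv, hc, hwuv.imp (congrArg _) (congrArg _)⟩)
          have hfF : f ∉ F := fun hf => hmem (Finset.mem_image.2 ⟨f, Finset.mem_sdiff.2 ⟨hf,
            fun h => by
              have := (Finset.mem_filter.1 h).2.1
              change (D.src f).1 = 1 + w at hf1
              omega⟩, hf2⟩)
          refine harcK w hw e he1 he2 ?_
          by_contra heF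
          exact h2 e f heF hfF (Fin.ext he1) (Fin.ext (he2.trans hf1.symm)) (Fin.ext hf2)
        exact Finset.mem_image.2 ⟨(u, v), Finset.mem_filter.2 ⟨Finset.mem_product.2
          ⟨hside u hu (.inl rfl), hside v hv (.inr rfl)⟩, hc⟩, hyuv.symm⟩
  have hcount : r + r ^ 2 ≤ K.card + (Q.card + (F \ FK).card) := by
    refine hh.trans ?_
    rw [← Set.ncard_image_of_injective _ Fin.val_injective]
    refine (Set.ncard_le_ncard hsub (Finset.finite_toSet _)).trans ?_
    rw [Set.ncard_coe_finset]
    refine (Finset.card_union_le _ _).trans (add_le_add Finset.card_image_le ?_)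
    exact (Finset.card_union_le _ _).trans (add_le_add Finset.card_image_le Finset.card_image_le)
  have hQK : Q.card ≤ K.card ^ 2 := by
    refine (Finset.card_filter_le _ _).trans ?_
    rw [Finset.card_product, sq]
  have hKr : K.card = r := by
    have h1 : K.card ≤ r := by omega
    refine le_antisymm h1 ?_
    by_contra hlt
    have : K.card ^ 2 < r ^ 2 := Nat.pow_lt_pow_left (by omega) two_ne_zero
    omega
  have hQeq : Q = K ×ˢ K := by
    refine Finset.eq_of_subset_of_card_le (Finset.filter_subset _ _) ?_
    rw [Finset.card_product, ← sq, hKr]; omega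
  refine hasClique_iff_compatible.2 ⟨K, hKr, fun u hu => (Finset.mem_filter.1 hu).2,
    fun u hu v hv => ?_⟩
  have : (u, v) ∈ Q := by rw [hQeq]; exact Finset.mem_product.2 ⟨hu, hv⟩
  exact (Finset.mem_filter.1 this).2

end Gadget

/-! ### The reduction from the clique problem -/

/-- The edges of an encoded graph. -/
def parseEdges (x : Data) : List (ℕ × ℕ) :=
  x.tl.toList.map fun e => (e.hd.toNat, e.tl.toNat)

/-- Whether the tree encodes a graph. -/
noncomputable def isGraph (x : Data) : Bool :=
  decide (x = enc (parseCard x, parseEdges x)) &&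
    (parseEdges x).all fun e => decide (e.1 < parseCard x) && decide (e.2 < parseCard x)

theorem parseEdges_enc (n : ℕ) (L : List (ℕ × ℕ)) : parseEdges (enc (n, L)) = L := by
  change (enc L).toList.map _ = L
  rw [Data.toList_enc_list, List.map_map]
  refine (List.map_congr_left fun e _ => ?_).trans (List.map_id L)
  exact Prod.ext (Data.toNat_num e.1) (Data.toNat_num e.2)

/-- An equivalent instance of the clique problem whose graph has a vertex. -/
noncomputable def normalClique (x : Data) (r : ℕ) : (ℕ × List (ℕ × ℕ)) × ℕ :=
  bif isGraph x then
    bif decide (0 < parseCard x) then ((parseCard x, parseEdges x), r)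
    else bif decide (r = 0) then ((1, []), 0) else ((1, []), 2)
  else ((1, []), 2)

theorem normalClique_pos (x : Data) (r : ℕ) : 0 < (normalClique x r).1.1 := by
  unfold normalClique
  cases isGraph x with
  | false => exact one_pos
  | true =>
    cases h : decide (0 < parseCard x) with
    | true => exact of_decide_eq_true h
    | false => cases decide (r = 0) <;> exact one_pos

theorem normalClique_le (x : Data) (r : ℕ) : (normalClique x r).2 ≤ r + 2 := by
  unfold normalClique
  cases isGraph x with
  | false => simp
  | true =>
    cases decide (0 < parseCard x) with
    | true => simp
    | false => cases decide (r = 0) <;> simp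

theorem not_hasClique_one_two : ¬HasClique 1 [] 2 := by
  rintro ⟨K, hK, hKn, -⟩
  have : K.card ≤ 1 := Finset.card_le_one.2 fun a ha b hb => by
    have := hKn a ha
    have := hKn b hb
    omega
  omega

theorem normalClique_correct (x : Data) (r : ℕ) : (x, r) ∈ clique ↔
    HasClique (normalClique x r).1.1 (normalClique x r).1.2 (normalClique x r).2 := by
  unfold normalClique
  cases hg : isGraph x with
  | false =>
    refine iff_of_false (fun h => ?_) not_hasClique_one_two
    obtain ⟨n, L, rfl, hL, -⟩ := mem_clique.1 h
    rw [← Bool.not_eq_true] at hg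
    refine hg ?_
    rw [isGraph, parseEdges_enc, parseCard_enc]
    simpa using hL
  | true =>
    simp only [isGraph, Bool.and_eq_true, decide_eq_true_eq, List.all_eq_true] at hg
    rw [show ((x, r) ∈ clique ↔ (enc (parseCard x, parseEdges x), r) ∈ clique) by rw [← hg.1],
      clique_enc hg.2]
    cases h : decide (0 < parseCard x) with
    | true => exact Iff.rfl
    | false =>
      have h0 : parseCard x = 0 := by simpa using h
      have h0' : HasClique (parseCard x) (parseEdges x) r ↔ r = 0 := by
        constructor
        · rintro ⟨K, rfl, hKn, -⟩
          rw [Finset.card_eq_zero, Finset.eq_empty_iff_forall_notMem]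
          intro u hu
          have := hKn u hu
          omega
        · rintro rfl
          exact ⟨∅, by simp⟩
      rw [h0']
      cases hr : decide (r = 0) with
      | true => exact iff_of_true (of_decide_eq_true hr) ⟨∅, by simp⟩
      | false => exact iff_of_false (of_decide_eq_false hr) not_hasClique_one_two

theorem PT_normalClique : PT (fun q : Data × ℕ => normalClique q.1 q.2) := by
  have h1 : PT (fun x : Data => parseCard x) := by unfold parseCard; fun_prop
  have h2 : PT (fun x : Data => parseEdges x) := by unfold parseEdges; fun_prop
  have h3 := PT.comp PT.encode (h1.pair h2)
  have h4 : PT (fun x : Data => isGraph x) := by unfold isGraph; fun_prop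
  unfold normalClique
  fun_prop

theorem PT_cliqueArcs : PT (fun q : ℕ × List (ℕ × ℕ) =>
    arcList (1 + q.1 + q.1 * q.1) (cliqueArc q.1 q.2)) := by
  unfold arcList cliqueArc isGoodPair compatible pairVertex
  fun_prop

theorem dredInst_cliqueDigraph (n : ℕ) (L : List (ℕ × ℕ)) (k h : ℕ) :
    dredInst (cliqueDigraph n L) k h (cliqueSource n L) =
      enc ((1 + n + n * n, arcList (1 + n + n * n) (cliqueArc n L)), k, h, 0) := by
  have h1 : (cliqueDigraph n L).enc =
      enc (1 + n + n * n, arcList (1 + n + n * n) (cliqueArc n L)) :=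
    arcDigraph_enc
  rw [dredInst, h1]
  rfl

/-- The clique problem reduces to edge deletion on digraphs of directed branch-width one. -/
theorem clique_reducesInto_dred : ReducesInto clique dred (dredDbwLe 1) := by
  let N : (Data × ℕ) × ℕ → (ℕ × List (ℕ × ℕ)) × ℕ := fun q => normalClique q.1.1 q.1.2
  have hN : PT N := PT_normalClique.comp PT.fst
  have h1 : PT (fun q => arcList (1 + (N q).1.1 + (N q).1.1 * (N q).1.1)
      (cliqueArc (N q).1.1 (N q).1.2)) := PT_cliqueArcs.comp (PT.fst.comp hN)
  have h2 : PT (fun q => ((1 + (N q).1.1 + (N q).1.1 * (N q).1.1,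
      arcList (1 + (N q).1.1 + (N q).1.1 * (N q).1.1) (cliqueArc (N q).1.1 (N q).1.2)),
      (N q).2, (N q).2 + (N q).2 ^ 2, 0)) := by fun_prop
  have h3 : PT (fun q => (N q).2 + ((N q).2 + (N q).2 ^ 2)) := by fun_prop
  have hc : Computable fun k : ℕ => k + 2 := computable_add Computable.id (Computable.const 2)
  -- This map is polynomial without any padding: with constant `0` the padding is `1`. Normalizing
  -- the clique instance may raise its parameter, but not above `k + 2`.
  refine reducesInto_of_PT 0 (g := fun k => (k + 2) + ((k + 2) + (k + 2) ^ 2))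
    (computable_add hc (computable_add hc (computable_pow hc (Computable.const 2))))
    ((PT.comp PT.encode h2).pair h3) fun x k => ?_
  have hle : (N ((x, k), padding 0 k)).2 ≤ k + 2 := normalClique_le x k
  have hcor : (x, k) ∈ clique ↔ HasClique (N ((x, k), padding 0 k)).1.1
    (N ((x, k), padding 0 k)).1.2 (N ((x, k), padding 0 k)).2 := normalClique_correct x k
  have hpos : 0 < (N ((x, k), padding 0 k)).1.1 := normalClique_pos x k
  obtain ⟨⟨⟨n, L⟩, r⟩, hq⟩ : ∃ q, q = N ((x, k), padding 0 k) := ⟨_, rfl⟩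
  simp only [← hq] at hle hcor hpos ⊢
  rw [← dredInst_cliqueDigraph]
  refine ⟨?_, ⟨_, _, _, _, rfl, cliqueDigraph_simple, (cliqueDigraph_dbw hpos).le⟩, ?_⟩
  · exact add_le_add hle (add_le_add hle (Nat.pow_le_pow_left hle 2))
  · rw [hcor, mem_dred rfl]
    exact ⟨dred_of_hasClique, hasClique_of_dred⟩


/-! ### Formulas for edge deletion -/

namespace MSO2

variable {a b c d : ℕ}

/-- A valid formula. -/
def truth : MSO2 a b c d := neg (exV (neg (eqV 0 0)))

/-- `φ`, and the innermost edge is different from the next `j` edges. -/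
def distinctE (φ : MSO2 a (b + 1) c d) : ℕ → MSO2 a (b + 1) c d
  | 0 => φ
  | j + 1 => conj (distinctE φ j) (neg (eqE 0 (Fin.ofNat (b + 1) (j + 1))))

/-- `φ`, and the innermost vertex is different from the next `j` vertices. -/
def distinctV (φ : MSO2 (a + 1) b c d) : ℕ → MSO2 (a + 1) b c d
  | 0 => φ
  | j + 1 => conj (distinctV φ j) (neg (eqV 0 (Fin.ofNat (a + 1) (j + 1))))

/-- The innermost edge set has at least `i` elements other than the free edges. -/
def atLeastE : (i b : ℕ) → MSO2 a b c (d + 1)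
  | 0, _ => truth
  | i + 1, b => exE (conj (distinctE (memE 0 0) b) (atLeastE i (b + 1)))

/-- There is no directed path from `s` to `x` which has at most two edges, all of them outside the
innermost edge set. -/
def notReached (s x : Fin a) : MSO2 a b c (d + 1) :=
  conj (neg (eqV s x)) (conj
    (neg (exE (conj (neg (memE 0 0)) (conj (src 0 s) (tgt 0 x)))))
    (neg (exV (exE (exE (conj (conj (neg (memE 1 0)) (neg (memE 0 0)))
      (conj (conj (src 1 s.succ) (tgt 1 0)) (conj (src 0 0) (tgt 0 x.succ)))))))))

/-- At least `i` vertices other than the free vertices are not reached from the outermost one. -/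
def atLeastV : (i a : ℕ) → MSO2 (a + 1) b c (d + 1)
  | 0, _ => truth
  | i + 1, a =>
    exV (conj (distinctV (notReached (Fin.last (a + 1)) 0) (a + 1)) (atLeastV i (a + 1)))

/-- Deleting at most `k` edges makes at least `h` vertices unreachable. -/
def deletion (k h : ℕ) : MSO2 1 0 0 0 :=
  exESet (conj (neg (atLeastE (k + 1) 0)) (atLeastV h 0))

/-- Some vertex at which no edge ends satisfies `deletion k h`. -/
def sourceDeletion (k h : ℕ) : Sentence :=
  exV (conj (neg (exE (tgt 0 0))) (deletion k h))

/-! ### Meaning of the formulas -/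

section Semantics
variable {D : FinDigraph} {v : Fin a → D.V} {e : Fin b → D.E} {W : Fin c → Set D.V}

theorem holds_truth {F : Fin d → Set D.E} : (truth (a := a) (b := b)).Holds D v e W F := by
  simp [truth, Holds]

theorem holds_distinctE {φ : MSO2 a (b + 1) c d} {x : D.E} {F : Fin d → Set D.E} :
    (distinctE φ b).Holds D v (Matrix.vecCons x e) W F ↔
      φ.Holds D v (Matrix.vecCons x e) W F ∧ x ∉ Set.range e := by
  have key : ∀ j ≤ b, (distinctE φ j).Holds D v (Matrix.vecCons x e) W F ↔
      φ.Holds D v (Matrix.vecCons x e) W F ∧ ∀ i : Fin b, i.1 < j → x ≠ e i := by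
    intro j
    induction j with
    | zero => simp [distinctE]
    | succ j ih =>
      intro hj
      -- `Fin.ofNat` reduces modulo `b + 1`; there is no wrap-around because `j < b`.
      have h1 : Fin.ofNat (b + 1) (j + 1) = Fin.succ ⟨j, hj⟩ :=
        Fin.ext (Nat.mod_eq_of_lt (by omega))
      rw [distinctE, Holds, Holds, Holds, ih (by omega), h1, Matrix.cons_val_succ,
        Matrix.cons_val_zero, and_assoc]
      refine and_congr_right fun _ => ⟨fun h i hi => ?_, fun h =>
        ⟨fun i hi => h i (by omega), h ⟨j, hj⟩ (by simp)⟩⟩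
      rcases Nat.lt_succ_iff_lt_or_eq.1 hi with hi | hi
      · exact h.1 i hi
      · obtain rfl : i = ⟨j, hj⟩ := Fin.ext hi
        exact h.2
  rw [key b le_rfl]
  exact and_congr_right fun _ => ⟨fun h ⟨i, hi⟩ => h i i.2 hi.symm, fun h i _ hi => h ⟨i, hi.symm⟩⟩

theorem holds_distinctV {φ : MSO2 (a + 1) b c d} {x : D.V} {F : Fin d → Set D.E} :
    (distinctV φ a).Holds D (Matrix.vecCons x v) e W F ↔
      φ.Holds D (Matrix.vecCons x v) e W F ∧ x ∉ Set.range v := by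
  have key : ∀ j ≤ a, (distinctV φ j).Holds D (Matrix.vecCons x v) e W F ↔
      φ.Holds D (Matrix.vecCons x v) e W F ∧ ∀ i : Fin a, i.1 < j → x ≠ v i := by
    intro j
    induction j with
    | zero => simp [distinctV]
    | succ j ih =>
      intro hj
      have h1 : Fin.ofNat (a + 1) (j + 1) = Fin.succ ⟨j, hj⟩ :=
        Fin.ext (Nat.mod_eq_of_lt (by omega))
      rw [distinctV, Holds, Holds, Holds, ih (by omega), h1, Matrix.cons_val_succ,
        Matrix.cons_val_zero, and_assoc]
      refine and_congr_right fun _ => ⟨fun h i hi => ?_, fun h =>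
        ⟨fun i hi => h i (by omega), h ⟨j, hj⟩ (by simp)⟩⟩
      rcases Nat.lt_succ_iff_lt_or_eq.1 hi with hi | hi
      · exact h.1 i hi
      · obtain rfl : i = ⟨j, hj⟩ := Fin.ext hi
        exact h.2
  rw [key a le_rfl]
  exact and_congr_right fun _ => ⟨fun h ⟨i, hi⟩ => h i i.2 hi.symm, fun h i _ hi => h ⟨i, hi.symm⟩⟩

/-- Counting by picking elements one after the other. -/
theorem succ_le_ncard_diff_range {α : Type} [Finite α] {n i : ℕ} {S : Set α} {f : Fin n → α} :
    i + 1 ≤ (S \ Set.range f).ncard ↔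
      ∃ x, (x ∈ S ∧ x ∉ Set.range f) ∧ i ≤ (S \ Set.range (Matrix.vecCons x f)).ncard := by
  have h1 : ∀ x, S \ Set.range (Matrix.vecCons x f) = (S \ Set.range f) \ {x} := fun x => by
    rw [Matrix.range_cons, Set.union_comm, Set.sdiff_sdiff]
  constructor
  · intro h
    obtain ⟨x, hx⟩ := (Set.ncard_pos (Set.toFinite _)).1 (by omega : 0 < (S \ Set.range f).ncard)
    refine ⟨x, hx, ?_⟩
    have := Set.ncard_sdiff_singleton_add_one hx (Set.toFinite _)
    rw [h1]; omega
  · rintro ⟨x, hx, h⟩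
    have := Set.ncard_sdiff_singleton_add_one (show x ∈ S \ Set.range f from hx) (Set.toFinite _)
    rw [h1] at h; omega

/-- The free edges are those picked so far. Each quantifier removes one more element from the set,
which is the recursion of `succ_le_ncard_diff_range`. -/
theorem holds_atLeastE {F : Fin (d + 1) → Set D.E} : ∀ {i b : ℕ} {e : Fin b → D.E},
    (atLeastE i b).Holds D v e W F ↔ i ≤ (F 0 \ Set.range e).ncard
  | 0, _, _ => by simp [atLeastE, holds_truth]
  | i + 1, b, e => by
    rw [atLeastE, Holds, succ_le_ncard_diff_range]
    refine exists_congr fun x => ?_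
    rw [Holds, holds_distinctE, holds_atLeastE]
    rfl

theorem holds_notReached {s x : Fin a} {F : Fin (d + 1) → Set D.E} {G : Finset D.E}
    (hG : F 0 = ↑G) : (notReached s x).Holds D v e W F ↔ v x ∈ (D.reach G (v s))ᶜ := by
  have hG' : ∀ y, y ∈ F 0 ↔ y ∈ G := fun y => by rw [hG, Finset.mem_coe]
  simp only [notReached, Holds, FinDigraph.reach, Set.mem_compl_iff, Set.mem_ofPred_eq, not_or,
    Matrix.cons_val_zero, Matrix.cons_val_one, Matrix.cons_val_succ, hG']
  refine and_congr_right fun _ => and_congr_right fun _ => not_congr ⟨?_, ?_⟩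
  · rintro ⟨z, f, g, ⟨h1, h2⟩, ⟨h3, h4⟩, h5, h6⟩
    exact ⟨f, g, h1, h2, h3, h4.trans h5.symm, h6⟩
  · rintro ⟨f, g, h1, h2, h3, h4, h5⟩
    exact ⟨_, f, g, ⟨h1, h2⟩, ⟨h3, h4⟩, rfl, h5⟩

/-- The source remains the outermost variable, with index `Fin.last`, while newly picked vertices
are put in front of it. -/
theorem holds_atLeastV {F : Fin (d + 1) → Set D.E} {G : Finset D.E} (hG : F 0 = ↑G) :
    ∀ {i a : ℕ} {v : Fin (a + 1) → D.V}, (atLeastV i a).Holds D v e W F ↔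
      i ≤ ((D.reach G (v (Fin.last a)))ᶜ \ Set.range v).ncard
  | 0, _, _ => by simp [atLeastV, holds_truth]
  | i + 1, a, v => by
    rw [atLeastV, Holds, succ_le_ncard_diff_range]
    refine exists_congr fun x => ?_
    rw [Holds, holds_distinctV, holds_atLeastV hG, holds_notReached hG, ← Fin.succ_last]
    rfl

/-- The formula counts unreached vertices other than `s`. Nothing is lost, since `s` is always
reached from itself. -/
theorem modelsAt_deletion {k h : ℕ} {s : D.V} :
    D.ModelsAt (deletion k h) s ↔ D.Dred k h s := by
  have key : ∀ G : Finset D.E, (conj (neg (atLeastE (k + 1) 0)) (atLeastV h 0)).Holds D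
      ![s] ![] ![] ![(G : Set D.E)] ↔ G.card ≤ k ∧ h ≤ ((D.reach G s)ᶜ).ncard := fun G => by
    have h1 : (D.reach G s)ᶜ \ Set.range ![s] = (D.reach G s)ᶜ :=
      sdiff_eq_left.2 (Set.disjoint_left.2 fun x hx hxs => hx (by
        obtain ⟨i, rfl⟩ := hxs
        exact .inl (by simp)))
    rw [Holds, Holds, holds_atLeastE, holds_atLeastV (G := G) rfl]
    refine and_congr ?_ ?_
    · simp [Set.range_eq_empty]
    · change h ≤ ((D.reach G s)ᶜ \ Set.range ![s]).ncard ↔ _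
      rw [h1]
  rw [FinDigraph.ModelsAt, deletion, Holds]
  constructor
  · rintro ⟨X, hX⟩
    refine ⟨X.toFinite.toFinset, (key _).1 ?_⟩
    rwa [Set.Finite.coe_toFinset]
  · rintro ⟨G, hG⟩
    exact ⟨G, (key G).2 hG⟩

end Semantics

end MSO2

/-- A nonzero vertex has an incoming arc: from a member of the pair if it represents a compatible
pair, from the source otherwise. The source is thus the only vertex without one, and the quantifier
of the sentence must choose it. -/
theorem cliqueDigraph_models {n : ℕ} {L : List (ℕ × ℕ)} {k h : ℕ} :
    (cliqueDigraph n L).Models (MSO2.sourceDeletion k h) ↔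
      (cliqueDigraph n L).Dred k h (cliqueSource n L) := by
  have h1 : ∀ x : (cliqueDigraph n L).V, (¬∃ e, (cliqueDigraph n L).tgt e = x) ↔
      x = cliqueSource n L := fun x => by
    constructor
    · intro hx
      by_contra hne
      have hpos : 0 < x.1 := Nat.pos_of_ne_zero fun h0 => hne (Fin.ext h0)
      have hlt : x.1 < 1 + n + n * n := x.2
      obtain ⟨y, hy, hA⟩ : ∃ y < 1 + n + n * n, cliqueArc n L y x.1 = true := by
        by_cases hg : isGoodPair n L x.1 = true
        · obtain ⟨u, hu, w, hw, hxu, hc⟩ := isGoodPair_iff.1 hg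
          exact ⟨1 + u, by omega,
            (cliqueArc_of_ne_zero (by omega)).2 ⟨u, hu, w, hw, hxu, hc, .inl rfl⟩⟩
        · exact ⟨0, by omega, cliqueArc_zero.2 ⟨hpos, .inr (Bool.not_eq_true _ ▸ hg)⟩⟩
      obtain ⟨e, -, he⟩ := exists_edge hy hlt hA
      exact hx ⟨e, Fin.ext he⟩
    · rintro rfl ⟨e, he⟩
      have := cliqueArc_shallow.ne_zero _ _ (arcDigraph_arc (n := 1 + n + n * n) e)
      exact this (congrArg Fin.val he)
  have h2 : (cliqueDigraph n L).Models (MSO2.sourceDeletion k h) ↔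
      ∃ x : (cliqueDigraph n L).V, (¬∃ e, (cliqueDigraph n L).tgt e = x) ∧
        (cliqueDigraph n L).ModelsAt (MSO2.deletion k h) x := Iff.rfl
  rw [h2]
  simp only [h1, exists_eq_left, MSO2.modelsAt_deletion]


/-! ### Lengths and encodings of the formulas -/

namespace MSO2

variable {a b c d : ℕ}

theorem length_distinctE (φ : MSO2 a (b + 1) c d) : ∀ j, (distinctE φ j).length = φ.length + 5 * j
  | 0 => rfl
  | j + 1 => by simp only [distinctE, length, length_distinctE φ j]; omega

theorem length_distinctV (φ : MSO2 (a + 1) b c d) : ∀ j, (distinctV φ j).length = φ.length + 5 * j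
  | 0 => rfl
  | j + 1 => by simp only [distinctV, length, length_distinctV φ j]; omega

theorem length_atLeastE : ∀ i b, (atLeastE i b : MSO2 a b c (d + 1)).length =
    7 + ((List.range' b i).map fun j => 6 + 5 * j).sum
  | 0, _ => rfl
  | i + 1, b => by
    rw [atLeastE, length, length, length_distinctE, length_atLeastE i, List.range'_succ,
      List.map_cons, List.sum_cons, length]
    omega

theorem length_atLeastV : ∀ i a, (atLeastV i a : MSO2 (a + 1) b c (d + 1)).length =
    7 + ((List.range' a i).map fun j => 61 + 5 * j).sum
  | 0, _ => rfl
  | i + 1, a => by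
    have h1 : (notReached (Fin.last (a + 1)) 0 : MSO2 (a + 2) b c (d + 1)).length = 53 := rfl
    rw [atLeastV, length, length, length_distinctV, length_atLeastV i, List.range'_succ,
      List.map_cons, List.sum_cons, h1]
    omega

theorem length_deletion (k h : ℕ) : (deletion k h).length = 18 +
    ((List.range (k + 1)).map fun j => 6 + 5 * j).sum +
    ((List.range h).map fun j => 61 + 5 * j).sum := by
  rw [deletion, length, length, length, length_atLeastE, length_atLeastV, List.range_eq_range',
    List.range_eq_range']
  omega

theorem length_sourceDeletion (k h : ℕ) :
    (sourceDeletion k h).length = (deletion k h).length + 9 := by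
  simp only [sourceDeletion, length]
  omega

/-- The quantifier number `j` carries inequalities with all its predecessors, so its contribution is
linear in `j` and the sum is quadratic. -/
theorem length_deletion_le (k h : ℕ) : (deletion k h).length ≤ 100 * (k + h + 1) ^ 2 := by
  have key : ∀ n c, c ≤ 61 → n ≤ k + h + 1 →
      ((List.range n).map fun j => c + 5 * j).sum ≤ n * (61 + 5 * (k + h)) := fun n c hc hn => by
    refine (List.sum_le_card_nsmul _ (61 + 5 * (k + h)) fun x hx => ?_).trans (by simp)
    obtain ⟨j, hj, rfl⟩ := List.mem_map.1 hx
    have := List.mem_range.1 hj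
    omega
  rw [length_deletion]
  have h1 := key (k + 1) 6 (by omega) (by omega)
  have h2 := key h 61 le_rfl (by omega)
  nlinarith

/-- The leading numeral determines the constructor, and with it the numbers of free variables of the
subformulas, so the indices of the type need not be recorded. -/
theorem enc_injective : ∀ {a b c d : ℕ}, Function.Injective (enc : MSO2 a b c d → Data) := by
  intro a b c d φ
  induction φ <;> intro ψ h <;> cases ψ <;>
    simp_all [enc, Data.ofList, Data.num, Data.num_injective.eq_iff, Fin.val_inj]
  all_goals grind

/-- The encoding of a negation. -/
def codeNeg (x : Data) : Data := Data.ofList [Data.num 6, x]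

/-- The encoding of a conjunction. -/
def codeConj (x y : Data) : Data := Data.ofList [Data.num 7, x, y]

/-- The encoding of an atomic formula. -/
def codeAtom (t i j : ℕ) : Data := Data.ofList [Data.num t, Data.num i, Data.num j]

/-- The encoding of a quantified formula. -/
def codeEx (t : ℕ) (x : Data) : Data := Data.ofList [Data.num t, x]

/-- The encoding of `φ` and the difference of variable `0` from the next `j` variables, the
equality symbol being number `t`. -/
def codeDistinct (t : ℕ) (x : Data) (j : ℕ) : Data :=
  (List.range j).foldl (fun y i => codeConj y (codeNeg (codeAtom t 0 (i + 1)))) x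

/-- The codes live in the single type `Data`, without the indices of `MSO2`, so that polynomial-time
functions can produce them. The bound on `j` excludes wrap-around in `Fin.ofNat`. -/
theorem enc_distinctE (φ : MSO2 a (b + 1) c d) : ∀ j ≤ b,
    (distinctE φ j).enc = codeDistinct 1 φ.enc j
  | 0, _ => rfl
  | j + 1, hj => by
    rw [codeDistinct, List.range_succ, List.foldl_append, ← codeDistinct,
      ← enc_distinctE φ j (by omega), distinctE]
    have h1 : (Fin.ofNat (b + 1) (j + 1)).1 = j + 1 := Nat.mod_eq_of_lt (by omega)
    simp only [enc, List.foldl_cons, List.foldl_nil, h1]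
    rfl

theorem enc_distinctV (φ : MSO2 (a + 1) b c d) : ∀ j ≤ a,
    (distinctV φ j).enc = codeDistinct 0 φ.enc j
  | 0, _ => rfl
  | j + 1, hj => by
    rw [codeDistinct, List.range_succ, List.foldl_append, ← codeDistinct,
      ← enc_distinctV φ j (by omega), distinctV]
    have h1 : (Fin.ofNat (a + 1) (j + 1)).1 = j + 1 := Nat.mod_eq_of_lt (by omega)
    simp only [enc, List.foldl_cons, List.foldl_nil, h1]
    rfl

/-- The encoding of `notReached s x`. -/
def codeNotReached (s x : ℕ) : Data :=
  codeConj (codeNeg (codeAtom 0 s x)) (codeConj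
    (codeNeg (codeEx 9 (codeConj (codeNeg (codeAtom 5 0 0))
      (codeConj (codeAtom 2 0 s) (codeAtom 3 0 x)))))
    (codeNeg (codeEx 8 (codeEx 9 (codeEx 9 (codeConj
      (codeConj (codeNeg (codeAtom 5 1 0)) (codeNeg (codeAtom 5 0 0)))
      (codeConj (codeConj (codeAtom 2 1 (s + 1)) (codeAtom 3 1 0))
        (codeConj (codeAtom 2 0 0) (codeAtom 3 0 (x + 1))))))))))

/-- The encoding of a valid formula. -/
def codeTruth : Data := (truth : Sentence).enc

/-- The encoding of `atLeastE i 0`. -/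
def codeAtLeastE (i : ℕ) : Data :=
  (List.range i).foldr (fun j y => codeEx 9 (codeConj (codeDistinct 1 (codeAtom 5 0 0) j) y))
    codeTruth

/-- The encoding of `atLeastV i 0`. -/
def codeAtLeastV (i : ℕ) : Data :=
  (List.range i).foldr (fun j y =>
    codeEx 8 (codeConj (codeDistinct 0 (codeNotReached (j + 1) 0) (j + 1)) y)) codeTruth

theorem enc_atLeastE (i : ℕ) : (atLeastE i 0 : MSO2 a 0 c (d + 1)).enc = codeAtLeastE i := by
  have key : ∀ i b, (atLeastE i b : MSO2 a b c (d + 1)).enc = (List.range' b i).foldr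
      (fun j y => codeEx 9 (codeConj (codeDistinct 1 (codeAtom 5 0 0) j) y)) codeTruth := by
    intro i
    induction i with
    | zero => exact fun b => rfl
    | succ i ih =>
      intro b
      rw [List.range'_succ, List.foldr_cons, ← ih, atLeastE, enc, enc, enc_distinctE _ _ le_rfl]
      rfl
  rw [key, codeAtLeastE, List.range_eq_range']

theorem enc_atLeastV (i : ℕ) : (atLeastV i 0 : MSO2 1 b c (d + 1)).enc = codeAtLeastV i := by
  have key : ∀ i a, (atLeastV i a : MSO2 (a + 1) b c (d + 1)).enc = (List.range' a i).foldr
      (fun j y => codeEx 8 (codeConj (codeDistinct 0 (codeNotReached (j + 1) 0) (j + 1)) y))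
      codeTruth := by
    intro i
    induction i with
    | zero => exact fun a => rfl
    | succ i ih =>
      intro a
      rw [List.range'_succ, List.foldr_cons, ← ih, atLeastV, enc, enc, enc_distinctV _ _ le_rfl]
      rfl
  rw [key, codeAtLeastV, List.range_eq_range']

theorem enc_sourceDeletion (k h : ℕ) : (sourceDeletion k h).enc =
    codeEx 8 (codeConj (codeNeg (codeEx 9 (codeAtom 3 0 0)))
      (codeEx 11 (codeConj (codeNeg (codeAtLeastE (k + 1))) (codeAtLeastV h)))) := by
  rw [← enc_atLeastE (a := 1) (c := 0) (d := 0), ← enc_atLeastV (b := 0) (c := 0) (d := 0)]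
  rfl

end MSO2

/-! ### Computing the formulas in polynomial time -/

section
variable {α : Type} [Enc α]

@[fun_prop]
theorem PT.dataNum {f : α → ℕ} (hf : PT f) : PT (fun a => Data.num (f a)) :=
  PT.comp (g := fun n : ℕ => enc n) PT.encode hf

@[fun_prop]
theorem PT.dataOfList {f : α → List Data} (hf : PT f) : PT (fun a => Data.ofList (f a)) :=
  PT.comp (g := fun l : List Data => Data.ofList l) (.ofEncEq fun l => by
    change Data.ofList l = Data.ofList (l.map enc)
    congr 1
    exact (List.map_id l).symm) hf

/-- The sum is the length of a concatenation of lists of units, so it needs no separate fold. -/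
theorem PT.rangeSum {f : α → ℕ} {g : α → ℕ → ℕ} (hf : PT f)
    (hg : PT (fun p : α × ℕ => g p.1 p.2)) :
    PT (fun a => ((List.range (f a)).map (g a)).sum) := by
  have h1 : PT (fun a => ((List.range (f a)).flatMap fun j => List.replicate (g a j) ()).length) :=
    PT.length (PT.flatMap (PT.range hf) (PT.replicate hg))
  have h2 : (fun a => ((List.range (f a)).map (g a)).sum) =
      fun a => ((List.range (f a)).flatMap fun j => List.replicate (g a j) ()).length :=
    funext fun a => by simp [List.length_flatMap]
  rw [h2]
  exact h1

theorem PT_codeDistinct (t : ℕ) {f : α → Data} {g : α → ℕ} (hf : PT f) (hg : PT g) :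
    PT (fun a => MSO2.codeDistinct t (f a) (g a)) := by
  have h1 : PT (fun p : α × ℕ => MSO2.codeNeg (MSO2.codeAtom t 0 (p.2 + 1))) := by
    unfold MSO2.codeNeg MSO2.codeAtom; fun_prop
  obtain ⟨D, hD, hle⟩ := PT.exists_bound (f := fun a => List.range (g a))
    (h := fun _ i => MSO2.codeNeg (MSO2.codeAtom t 0 (i + 1))) (by fun_prop) h1
  -- Besides its two arguments a coded conjunction has `19` nodes: `15` for the numeral `7` and `4`
  -- for the list.
  refine PT.foldl_of_growth (by fun_prop) hf ?_ (hD.add (.const 19)) fun a y i hi => ?_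
  · unfold MSO2.codeConj MSO2.codeNeg MSO2.codeAtom
    fun_prop
  · have := hle a i hi
    simp only [MSO2.codeConj, esize_data, Data.ofList, Data.size, Data.num] at this ⊢
    omega

theorem PT_foldr_codeEx (t : ℕ) {f : α → ℕ} {g : α → ℕ → Data} (hf : PT f)
    (hg : PT (fun p : α × ℕ => g p.1 p.2)) : PT (fun a => (List.range (f a)).foldr
      (fun j y => MSO2.codeEx t (MSO2.codeConj (g a j) y)) MSO2.codeTruth) := by
  simp only [List.foldr_eq_foldl_reverse]
  obtain ⟨D, hD, hle⟩ := PT.exists_bound (f := fun a => (List.range (f a)).reverse)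
    (by fun_prop) hg
  refine PT.foldl_of_growth (by fun_prop) (PT.const _) ?_
    (hD.add (.const (esize (Data.num t) + 25))) fun a y i hi => ?_
  · have h1 : PT (fun p : α × Data × ℕ => g p.1 p.2.2) :=
      PT.comp (g := fun p : α × ℕ => g p.1 p.2) (f := fun p : α × Data × ℕ => (p.1, p.2.2)) hg
        (by fun_prop)
    unfold MSO2.codeEx MSO2.codeConj
    fun_prop
  · have := hle a i hi
    simp only [MSO2.codeConj, MSO2.codeEx, esize_data, Data.ofList, Data.size, Data.num] at this ⊢
    omega

@[fun_prop]
theorem PT.sourceDeletion {k h : α → ℕ} (hk : PT k) (hh : PT h) :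
    PT (fun a => (MSO2.sourceDeletion (k a) (h a)).enc) := by
  have h1 : PT (fun a => MSO2.codeAtLeastE (k a + 1)) := by
    refine PT_foldr_codeEx (α := α) 9 (f := fun a => k a + 1)
      (g := fun _ j => MSO2.codeDistinct 1 (MSO2.codeAtom 5 0 0) j) (by fun_prop) ?_
    exact PT_codeDistinct 1 (PT.const _) PT.snd
  have h2 : PT (fun a => MSO2.codeAtLeastV (h a)) := by
    refine PT_foldr_codeEx (α := α) 8 (f := h)
      (g := fun _ j => MSO2.codeDistinct 0 (MSO2.codeNotReached (j + 1) 0) (j + 1)) hh ?_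
    refine PT_codeDistinct 0 ?_ (by fun_prop)
    unfold MSO2.codeNotReached MSO2.codeEx MSO2.codeConj MSO2.codeNeg MSO2.codeAtom
    fun_prop
  simp only [MSO2.enc_sourceDeletion]
  unfold MSO2.codeEx MSO2.codeConj MSO2.codeNeg
  fun_prop

@[fun_prop]
theorem PT.length_sourceDeletion {k h : α → ℕ} (hk : PT k) (hh : PT h) :
    PT (fun a => (MSO2.sourceDeletion (k a) (h a)).length) := by
  have h1 : PT (fun a => ((List.range (k a + 1)).map fun j => 6 + 5 * j).sum) :=
    PT.rangeSum (g := fun _ j => 6 + 5 * j) (by fun_prop) (by fun_prop)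
  have h2 : PT (fun a => ((List.range (h a)).map fun j => 61 + 5 * j).sum) :=
    PT.rangeSum (g := fun _ j => 61 + 5 * j) (by fun_prop) (by fun_prop)
  simp only [MSO2.length_sourceDeletion, MSO2.length_deletion]
  fun_prop

end

/-! ### From cliques to model checking -/

theorem mem_modelChecking {κ : FinDigraph → Sentence → ℕ} {D : FinDigraph} {φ : Sentence} {l : ℕ}
    (hl : l = κ D φ) : (Data.cons D.enc φ.enc, l) ∈ modelChecking κ ↔ D.Models φ := by
  constructor
  · rintro ⟨D', φ', heq, hm⟩
    simp only [Prod.mk.injEq, Data.cons.injEq] at heq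
    obtain ⟨⟨h1, h2⟩, -⟩ := heq
    rwa [FinDigraph.enc_injective h1, MSO2.enc_injective h2]
  · exact fun hm => ⟨D, φ, by rw [hl], hm⟩

/-- The clique problem reduces to model checking on digraphs of directed branch-width one, for
parameters which on these digraphs differ from the length by a constant. -/
theorem clique_reducesInto_modelChecking {κ : FinDigraph → Sentence → ℕ} {C : Set FinDigraph}
    (w : ℕ) (hκ : ∀ D φ, D.dbw = 1 → κ D φ = w + φ.length) (hC : ∀ D, D.dbw = 1 → D ∈ C) :
    ReducesInto clique (modelChecking κ) (modelCheckingInst κ C) := by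
  let N : (Data × ℕ) × ℕ → (ℕ × List (ℕ × ℕ)) × ℕ := fun q => normalClique q.1.1 q.1.2
  have hN : PT N := PT_normalClique.comp PT.fst
  have h1 : PT (fun q => arcList (1 + (N q).1.1 + (N q).1.1 * (N q).1.1)
      (cliqueArc (N q).1.1 (N q).1.2)) := PT_cliqueArcs.comp (PT.fst.comp hN)
  have h2 : PT (fun q => ((1 + (N q).1.1 + (N q).1.1 * (N q).1.1,
      arcList (1 + (N q).1.1 + (N q).1.1 * (N q).1.1) (cliqueArc (N q).1.1 (N q).1.2)),
      (MSO2.sourceDeletion (N q).2 ((N q).2 + (N q).2 ^ 2)).enc)) := by fun_prop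
  have h3 : PT (fun q => w + (MSO2.sourceDeletion (N q).2 ((N q).2 + (N q).2 ^ 2)).length) := by
    fun_prop
  have hc : Computable fun k : ℕ => k + 2 := computable_add Computable.id (Computable.const 2)
  refine reducesInto_of_PT 0
    (g := fun k => w + (100 * ((k + 2) + ((k + 2) + (k + 2) ^ 2) + 1) ^ 2 + 9))
    (computable_add (Computable.const w) (computable_add (computable_mul (Computable.const 100)
      (computable_pow (computable_add (computable_add hc (computable_add hc (computable_pow hc
        (Computable.const 2)))) (Computable.const 1)) (Computable.const 2))) (Computable.const 9)))
    ((PT.comp PT.encode h2).pair h3) fun x k => ?_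
  have hle : (N ((x, k), padding 0 k)).2 ≤ k + 2 := normalClique_le x k
  have hcor : (x, k) ∈ clique ↔ HasClique (N ((x, k), padding 0 k)).1.1
    (N ((x, k), padding 0 k)).1.2 (N ((x, k), padding 0 k)).2 := normalClique_correct x k
  have hpos : 0 < (N ((x, k), padding 0 k)).1.1 := normalClique_pos x k
  obtain ⟨⟨⟨n, L⟩, r⟩, hq⟩ : ∃ q, q = N ((x, k), padding 0 k) := ⟨_, rfl⟩
  simp only [← hq] at hle hcor hpos ⊢
  have henc : enc ((1 + n + n * n, arcList (1 + n + n * n) (cliqueArc n L)),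
      (MSO2.sourceDeletion r (r + r ^ 2)).enc) =
      Data.cons (cliqueDigraph n L).enc (MSO2.sourceDeletion r (r + r ^ 2)).enc := by
    rw [enc_prod]
    congr 1
    exact arcDigraph_enc.symm
  -- The width is exactly one on these digraphs, so the parameter is known to be `w` plus the
  -- length; the reduction never has to compute a branch-width.
  have hw := (hκ (cliqueDigraph n L) (MSO2.sourceDeletion r (r + r ^ 2))
    (cliqueDigraph_dbw hpos)).symm
  rw [henc]
  refine ⟨?_, ⟨_, _, Prod.ext rfl hw, cliqueDigraph_simple, hC _ (cliqueDigraph_dbw hpos)⟩, ?_⟩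
  · rw [MSO2.length_sourceDeletion]
    refine Nat.add_le_add_left (Nat.add_le_add_right ((MSO2.length_deletion_le _ _).trans ?_) _) _
    exact Nat.mul_le_mul_left _ (Nat.pow_le_pow_left (Nat.succ_le_succ
      (add_le_add hle (add_le_add hle (Nat.pow_le_pow_left hle 2)))) 2)
  · rw [hcor, mem_modelChecking hw, cliqueDigraph_models]
    exact ⟨dred_of_hasClique, hasClique_of_dred⟩

/-- A problem to which the clique problem reduces is not fixed-parameter tractable unless
`FPT = W[1]`. -/
theorem not_inFPTOn_of_clique_reducesInto {Q : ParamProblem} {C : Set (Data × ℕ)}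
    (h : ReducesInto clique Q C) (hne : FPT ≠ W1) : ¬InFPTOn Q C := fun hQ =>
  hne (FPT_subset_W1.antisymm fun _ hP => ((reducesInto_clique_of_mem_W1 hP).trans h).mem_FPT hQ)

end DirectedFPT

theorem mainTheorem12 :
    -- Directed 2-Reachability Edge Deletion is expressed by `MSO₂`-formulas that depend only on
    -- `k` and `h`, and whose length is quadratically bounded
    (∃ (Φ : ℕ → ℕ → MSO2 1 0 0 0) (c : ℕ), ∀ k h : ℕ,
      (Φ k h).length ≤ c * (k + h + 1) ^ 2 ∧
      ∀ (D : FinDigraph) (s : D.V), D.ModelsAt (Φ k h) s ↔ D.Dred k h s) ∧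
    -- `r`-Clique reduces to it, on digraphs of directed branch-width at most one
    ReducesInto clique dred (dredDbwLe 1) ∧
    -- parameterized by `k` and `h` it is `W[1]`-hard on digraphs of directed branch-width at most one
    W1HardOn dred (dredDbwLe 1) ∧
    -- unless `FPT = W[1]`, there is no fixed-parameter algorithm for `MSO₂` model checking
    -- parameterized by formula length on simple digraphs of directed branch-width at most one, nor
    -- on all simple digraphs parameterized by the sum of directed branch-width and formula length
    (FPT ≠ W1 →
      ¬ InFPTOn (modelChecking fun _ φ => φ.length)
          (modelCheckingInst (fun _ φ => φ.length) {D | D.dbw ≤ 1}) ∧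
      ¬ InFPTOn (modelChecking fun D φ => D.dbw + φ.length)
          (modelCheckingInst (fun D φ => D.dbw + φ.length) Set.univ)) := by
  refine ⟨⟨MSO2.deletion, 100, fun k h => ⟨MSO2.length_deletion_le k h, fun _ _ =>
    MSO2.modelsAt_deletion⟩⟩, clique_reducesInto_dred, fun _ hP =>
    (reducesInto_clique_of_mem_W1 hP).trans clique_reducesInto_dred, fun hne => ⟨?_, ?_⟩⟩
  -- The constant added to the length is `0` when the length alone is the parameter, and `1`, the
  -- branch-width of the output digraphs, in the second case.
  · exact not_inFPTOn_of_clique_reducesInto (clique_reducesInto_modelChecking 0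
      (fun _ _ _ => (zero_add _).symm) fun _ h => h.le) hne
  · exact not_inFPTOn_of_clique_reducesInto (clique_reducesInto_modelChecking 1
      (fun _ _ h => by rw [h]) fun _ _ => Set.mem_univ _) hne
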